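/- There is an algorithm (one fixed program, for a random access machine whose integer arithmetic operations, comparisons and memory accesses each take one unit of time) with the following property. Let $n,k\in\mathbb N=\{0,1,2,\dots\}$ satisfy $n>5000(k+1)$ and let $w:E(K_n)\to\mathbb Z$ be an edge weighting of the complete graph on $n$ vertices. For a subgraph $G$ of $K_n$ write $w(G)=\sum_{e\in E(G)}w(e)$ and $w[G]=\sum_{e\in E(G)}|w(e)|$, and let $d=w(K_n)/\binom n2$ be the average weight of an edge. Then, on input $(n,w,k)$, the algorithm finds in time $O(n^7)$, with an absolute implied constant, either (a) a Hamilton cycle $H^*$ of $K_n$ with $w(H^*)<dn-k$, or (b) a weighting $w^*:E(K_n)\to\mathbb Z$ and an $\alpha\in\mathbb Z$ such that $w^*(H)=w(H)+\alpha$ for every Hamilton cycle $H$ of $K_n$ and $w^*[K_n]\le 4000kn$, and it reports which of the two it has found. Moreover, all numbers that it writes into memory have $O(\log n+\log(M+1))$ bits, where $M=\max_{e\in E(K_n)}|w(e)|$. -/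

import Mathlib

/-! ## Edge weightings of the complete graph -/

namespace TSP

/-- The complete graph `K_n` on the vertex set `{0, …, n - 1}`. -/
abbrev K (n : ℕ) : SimpleGraph (Fin n) := ⊤

/-- An integer edge weighting `w : E(K_n) → ℤ`. -/
abbrev Weighting (n : ℕ) : Type := (K n).edgeSet → ℤ

open Classical in
/-- `w(G)`, the sum of `w(e)` over the edges `e` of a subgraph `G` of `K_n`. -/
noncomputable def weight {n : ℕ} (w : Weighting n) (G : (K n).Subgraph) : ℤ :=
  ∑ e : (K n).edgeSet, if (e : Sym2 (Fin n)) ∈ G.edgeSet then w e else 0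

/-- `w[G]`, the sum of `|w(e)|` over the edges `e` of a subgraph `G` of `K_n`. -/
noncomputable def absWeight {n : ℕ} (w : Weighting n) (G : (K n).Subgraph) : ℤ :=
  weight (fun e => |w e|) G

/-- The density `d = w(K_n) / (n choose 2)`, the average weight of an edge. -/
noncomputable def density {n : ℕ} (w : Weighting n) : ℚ :=
  (weight w ⊤ : ℚ) / (n.choose 2 : ℚ)

/-- `M = max |w(e)|` over the edges `e` of `K_n`. -/
def maxAbs {n : ℕ} (w : Weighting n) : ℕ :=
  Finset.univ.sup fun e : (K n).edgeSet => (w e).natAbs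

/-! ## Random access machines with unit-cost integer arithmetic

A program is a fixed finite text, independent of the input.  It works on integer registers
and on integer arrays whose cells can be addressed by computed indices. -/

/-- Memory contents: the registers and the arrays (each indexed by the integers). -/
structure Mem where
  reg : ℕ → ℤ
  arr : ℕ → ℤ → ℤ

/-- Arithmetic expressions: integer constants, registers, array cells with a computed index,
and the operations `+`, `-`, `*` and integer division. -/
inductive AExp where
  | const (z : ℤ)
  | reg (x : ℕ)
  | cell (A : ℕ) (i : AExp)
  | add (a b : AExp)
  | sub (a b : AExp)
  | mul (a b : AExp)
  | div (a b : AExp)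

/-- The value of an expression. (Integer division by a positive number rounds down.) -/
def AExp.val (m : Mem) : AExp → ℤ
  | .const z => z
  | .reg x => m.reg x
  | .cell A i => m.arr A (i.val m)
  | .add a b => a.val m + b.val m
  | .sub a b => a.val m - b.val m
  | .mul a b => a.val m * b.val m
  | .div a b => a.val m / b.val m

/-- The time to evaluate an expression: one unit for every memory access, every constant and
every arithmetic operation in it. -/
def AExp.cost : AExp → ℕ
  | .const _ => 1
  | .reg _ => 1
  | .cell _ i => i.cost + 1
  | .add a b => a.cost + b.cost + 1
  | .sub a b => a.cost + b.cost + 1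
  | .mul a b => a.cost + b.cost + 1
  | .div a b => a.cost + b.cost + 1

/-- Programs. Tests ask whether the value of an expression is positive. -/
inductive Prog where
  | skip
  | setReg (x : ℕ) (e : AExp)
  | setCell (A : ℕ) (i e : AExp)
  | seq (p q : Prog)
  | ifPos (e : AExp) (p q : Prog)
  | whilePos (e : AExp) (p : Prog)

/-- Write `v` into register `x`. -/
def Mem.setReg (m : Mem) (x : ℕ) (v : ℤ) : Mem :=
  { m with reg := Function.update m.reg x v }

/-- Write `v` into cell `i` of the array `A`. -/
def Mem.setCell (m : Mem) (A : ℕ) (i v : ℤ) : Mem :=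
  { m with arr := Function.update m.arr A (Function.update (m.arr A) i v) }

/-- `Exec B p m m' t`: started on the memory contents `m`, the program `p` halts after exactly
`t` units of time with the memory contents `m'`, and every number that it writes into the
memory on the way has absolute value at most `B`.

The bound `B` makes unit cost for arithmetic legitimate: no word of memory ever has to hold a
number of more than `log B + O(1)` bits. -/
inductive Exec (B : ℕ) : Prog → Mem → Mem → ℕ → Prop
  | skip (m : Mem) : Exec B .skip m m 1
  | setReg (m : Mem) (x : ℕ) (e : AExp) (h : |e.val m| ≤ (B : ℤ)) :
      Exec B (.setReg x e) m (m.setReg x (e.val m)) (e.cost + 1)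
  | setCell (m : Mem) (A : ℕ) (i e : AExp) (h : |e.val m| ≤ (B : ℤ)) :
      Exec B (.setCell A i e) m (m.setCell A (i.val m) (e.val m)) (i.cost + e.cost + 1)
  | seq {p q : Prog} {m₁ m₂ m₃ : Mem} {s t : ℕ}
      (hp : Exec B p m₁ m₂ s) (hq : Exec B q m₂ m₃ t) : Exec B (.seq p q) m₁ m₃ (s + t)
  | ifTrue {e : AExp} {p q : Prog} {m m' : Mem} {t : ℕ} (he : 0 < e.val m)
      (hp : Exec B p m m' t) : Exec B (.ifPos e p q) m m' (e.cost + 1 + t)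
  | ifFalse {e : AExp} {p q : Prog} {m m' : Mem} {t : ℕ} (he : ¬ 0 < e.val m)
      (hq : Exec B q m m' t) : Exec B (.ifPos e p q) m m' (e.cost + 1 + t)
  | whileTrue {e : AExp} {p : Prog} {m₁ m₂ m₃ : Mem} {s t : ℕ} (he : 0 < e.val m₁)
      (hp : Exec B p m₁ m₂ s) (hw : Exec B (.whilePos e p) m₂ m₃ t) :
      Exec B (.whilePos e p) m₁ m₃ (e.cost + 1 + s + t)
  | whileFalse {e : AExp} {p : Prog} {m : Mem} (he : ¬ 0 < e.val m) :
      Exec B (.whilePos e p) m m (e.cost + 1)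

/-! ## Input and output conventions -/

/-- Array `A` holds the weighting `w` as a matrix, row by row: the weight of the edge `ij` is in
the cells `i * n + j` and `j * n + i`. -/
def Mem.HoldsWeighting {n : ℕ} (m : Mem) (A : ℕ) (w : Weighting n) : Prop :=
  ∀ (i j : Fin n) (h : (K n).Adj i j), m.arr A ((i : ℤ) * (n : ℤ) + (j : ℤ)) = w ⟨s(i, j), h⟩

/-- Array `A` lists, in cells `0, …, n - 1`, the vertices of the closed walk `c` in order. -/
def Mem.HoldsCycle {n : ℕ} (m : Mem) (A : ℕ) {v : Fin n} (c : (K n).Walk v v) : Prop :=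
  ∀ i : ℕ, i < n → m.arr A (i : ℤ) = ((c.getVert i : ℕ) : ℤ)

/-- The memory contents `m` present the input `(n, w, k)`: `n` in register `0`, `k` in
register `1`, and `w` in array `0`. Nothing is assumed about the rest of the memory. -/
def Mem.IsInput {n : ℕ} (m : Mem) (w : Weighting n) (k : ℕ) : Prop :=
  m.reg 0 = (n : ℤ) ∧ m.reg 1 = (k : ℤ) ∧ m.HoldsWeighting 0 w

end TSP

namespace TSP

/-! ## Total correctness triples -/

/-! Let `W` be the symmetric matrix of the weighting, with zero diagonal. Place the vertices in
random cyclic order and cut the positions into blocks of four. In a block `a b c d` the two inner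
vertices may be exchanged, which changes the weight of the cycle by `gap W a b c d = W a c + W b d -
W a b - W c d`. Blocks do not interfere, so exchanging wherever this helps adds the sum of all `min
0 gap`. Exchanging `b` and `c` negates the gap, hence `min 0 gap` has mean `-|gap| / 2`, and the
improved cycle has mean weight `d n` minus `blocks n / 2` times the mean of `|gap|`
(`potential_zero`).

The random order is derandomised by conditional expectations. `potential W j π` is the mean weight
of the improved cycle when the positions below `j` are fixed as in `π`. It is a sum over positions
of averages over quadruples, hence computable. One of the choices for position `j` does not increase
it (`potential_swap_le`). Finding this choice takes `n` candidates times `n` positions times `n ^ 4`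
quadruples, and doing so for all `j` gives `n ^ 7`. The resulting cycle weighs at most the mean.

If this cycle does not beat `d n - k`, then the mean of `|gap|` is `O(k / n)`. For distinct `p, q,
z` subtract `W x p` at every vertex `x ≠ p` and suitable constants, so that the new weighting
vanishes at `p`. Each new weight is a sum of at most two gaps (`abs_shifted_le`). Averaging over `p,
q, z` shows that some choice has total absolute weight `O(k n)` (`mul_le_totalGap`, `spread_le`).
Trying all triples finds the best one. Subtracting numbers at vertices and adding a constant to all
edges changes all Hamilton cycles equally (`weight_shift`), which yields `α`.

The machine part is generic: `Ex` is a small expression language with sums and minimisers, and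
`Ex.compile_spec` gives correctness, running time `coef * n ^ deg` and size bound `X ^ mag` of the
compiled code at once. The algorithm is then a few loops around expressions whose degrees are found
by evaluation. -/

/-- Started on `m`, the program `p` halts within time `T`, writing only numbers of absolute value
at most `B`, with memory contents satisfying `Q`. -/
def Triple (B : ℕ) (p : Prog) (m : Mem) (T : ℕ) (Q : Mem → Prop) : Prop :=
  ∃ (m' : Mem) (t : ℕ), Exec B p m m' t ∧ t ≤ T ∧ Q m'

theorem Triple.mono {B : ℕ} {p : Prog} {m : Mem} {T T' : ℕ} {Q Q' : Mem → Prop}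
    (h : Triple B p m T Q) (hT : T ≤ T') (hQ : ∀ m', Q m' → Q' m') : Triple B p m T' Q' := by
  obtain ⟨m', t, h1, h2, h3⟩ := h
  exact ⟨m', t, h1, h2.trans hT, hQ _ h3⟩

theorem Triple.seq {B : ℕ} {p q : Prog} {m : Mem} {T T' : ℕ} {R Q : Mem → Prop}
    (hp : Triple B p m T R) (hq : ∀ m', R m' → Triple B q m' T' Q) :
    Triple B (.seq p q) m (T + T') Q := by
  obtain ⟨m', t, h1, h2, h3⟩ := hp
  obtain ⟨m'', t', h1', h2', h3'⟩ := hq m' h3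
  exact ⟨m'', t + t', .seq h1 h1', by omega, h3'⟩

theorem Triple.setReg {B : ℕ} {m : Mem} {x : ℕ} {e : AExp} {Q : Mem → Prop}
    (h : |e.val m| ≤ (B : ℤ)) (hQ : Q (m.setReg x (e.val m))) :
    Triple B (.setReg x e) m (e.cost + 1) Q :=
  ⟨_, _, .setReg m x e h, le_rfl, hQ⟩

theorem Triple.setCell {B : ℕ} {m : Mem} {A : ℕ} {i e : AExp} {Q : Mem → Prop}
    (h : |e.val m| ≤ (B : ℤ)) (hQ : Q (m.setCell A (i.val m) (e.val m))) :
    Triple B (.setCell A i e) m (i.cost + e.cost + 1) Q :=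
  ⟨_, _, .setCell m A i e h, le_rfl, hQ⟩

theorem Triple.ifPos {B : ℕ} {m : Mem} {e : AExp} {p q : Prog} {T : ℕ} {Q : Mem → Prop}
    (h1 : 0 < e.val m → Triple B p m T Q) (h2 : ¬ 0 < e.val m → Triple B q m T Q) :
    Triple B (.ifPos e p q) m (e.cost + 1 + T) Q := by
  by_cases h : 0 < e.val m
  · obtain ⟨m', t, a, b, c⟩ := h1 h
    exact ⟨m', _, .ifTrue h a, by omega, c⟩
  · obtain ⟨m', t, a, b, c⟩ := h2 h
    exact ⟨m', _, .ifFalse h a, by omega, c⟩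

/-- `for x = 0, …, n - 1 do p`, where `n` is the content of register `0`. -/
def forProg (x : ℕ) (p : Prog) : Prog :=
  .seq (.setReg x (.const 0))
    (.whilePos (.sub (.reg 0) (.reg x)) (.seq p (.setReg x (.add (.reg x) (.const 1)))))

@[simp] theorem Mem.setReg_arr (m : Mem) (x : ℕ) (v : ℤ) : (m.setReg x v).arr = m.arr := rfl

@[simp] theorem Mem.setReg_reg_self (m : Mem) (x : ℕ) (v : ℤ) : (m.setReg x v).reg x = v := by
  simp [Mem.setReg]

theorem Mem.setReg_reg (m : Mem) (x y : ℕ) (v : ℤ) :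
    (m.setReg x v).reg y = if y = x then v else m.reg y := by
  simp [Mem.setReg, Function.update_apply]

theorem Mem.setReg_reg_of_ne (m : Mem) {x y : ℕ} (v : ℤ) (h : y ≠ x) :
    (m.setReg x v).reg y = m.reg y := by
  simp [Mem.setReg, h]

@[simp] theorem Mem.setCell_reg (m : Mem) (A : ℕ) (i v : ℤ) : (m.setCell A i v).reg = m.reg := rfl

theorem Mem.setCell_arr (m : Mem) (A A' : ℕ) (i i' v : ℤ) :
    (m.setCell A i v).arr A' i' = if A' = A ∧ i' = i then v else m.arr A' i' := by
  by_cases h : A' = A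
  · subst h
    simp [Mem.setCell, Function.update_apply]
  · simp [Mem.setCell, h]

/-- The invariant for `v + 1` is demanded after the increment of the counter. A round costs `T`,
plus 4 for the guard and 4 for the increment; initialisation and the last, failing guard cost 6. The
counter ends at `n`, whence `n ≤ B`. -/
theorem Triple.forProg {B n T x : ℕ} {p : Prog} (I : ℕ → Mem → Prop) (hB : n ≤ B)
    (hI : ∀ v m, I v m → m.reg 0 = n)
    (hbody : ∀ v < n, ∀ m, I v m → m.reg x = v →
      Triple B p m T fun m' => I (v + 1) (m'.setReg x (v + 1)) ∧ m'.reg x = v)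
    {m : Mem} (h0 : I 0 (m.setReg x 0)) :
    Triple B (forProg x p) m (n * (T + 8) + 6) fun m' => I n m' ∧ m'.reg x = n := by
  have key : ∀ r v m, v + r = n → I v m → m.reg x = v →
      Triple B (.whilePos (.sub (.reg 0) (.reg x)) (.seq p (.setReg x (.add (.reg x) (.const 1)))))
        m (r * (T + 8) + 4) fun m' => I n m' ∧ m'.reg x = n := by
    intro r
    induction r with
    | zero =>
      intro v m hv hIv hxv
      obtain rfl : v = n := by omega
      refine ⟨m, _, .whileFalse ?_, ?_, hIv, hxv⟩
      · simp [AExp.val, hI _ _ hIv, hxv]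
      · simp [AExp.cost]
    | succ r ih =>
      intro v m hv hIv hxv
      obtain ⟨m₁, t₁, e₁, ht₁, hI₁, hx₁⟩ := hbody v (by omega) m hIv hxv
      have hI₁' := hI₁
      obtain ⟨m₂, t₂, e₂, ht₂, hQ⟩ := ih (v + 1) (m₁.setReg x (v + 1)) (by omega) hI₁ (by simp)
      refine ⟨m₂, _, .whileTrue (s := t₁ + 4) (m₂ := m₁.setReg x (v + 1)) ?_ ?_ e₂, ?_, hQ⟩
      · simp only [AExp.val, hI _ _ hIv, hxv]
        omega
      · refine .seq e₁ ?_
        have := Exec.setReg (B := B) m₁ x (.add (.reg x) (.const 1)) (by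
          simp only [AExp.val, hx₁]
          rw [abs_of_nonneg (by omega)]
          omega)
        simpa [AExp.val, AExp.cost, hx₁] using this
      · simp only [AExp.cost]
        nlinarith
  unfold TSP.forProg
  refine (Triple.seq (R := fun m' => m' = m.setReg x 0) (T := 2) (T' := n * (T + 8) + 4)
    ?_ ?_).mono (by omega) fun _ h => h
  · exact (Triple.setReg (e := .const 0) (by simp [AExp.val])
      (Q := fun m' => m' = m.setReg x 0) rfl).mono (by simp [AExp.cost]) fun _ h => h
  · rintro _ rfl
    exact key n 0 _ (by omega) h0 (by simp)

/-! ## Expressions with conditionals, bounded sums and minimisation -/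

/-- The first of the numbers `0 ≤ v < r` minimising `f`. -/
def argminBelow (f : ℕ → ℤ) : ℕ → ℕ
  | 0 => 0
  | r + 1 => if f r < f (argminBelow f r) then r else argminBelow f r

theorem argminBelow_le (f : ℕ → ℤ) {r v : ℕ} (hv : v < r) : f (argminBelow f r) ≤ f v := by
  induction r with
  | zero => omega
  | succ r ih =>
    rw [argminBelow]
    rcases Nat.lt_succ_iff_lt_or_eq.1 hv with h | rfl
    · split_ifs with h'
      · exact h'.le.trans (ih h)
      · exact ih h
    · split_ifs with h'
      · exact le_rfl
      · exact not_lt.1 h'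

theorem argminBelow_lt (f : ℕ → ℤ) {r : ℕ} (hr : 0 < r) : argminBelow f r < r := by
  induction r with
  | zero => omega
  | succ r ih =>
    rw [argminBelow]
    split_ifs with h
    · omega
    · rcases Nat.eq_zero_or_pos r with rfl | h0
      · simp [argminBelow]
      · exact (ih h0).trans (Nat.lt_succ_self r)

/-- Expressions extending `AExp` by conditionals (on the positivity of a value), sums
`∑_{0 ≤ x < n}`, minimisers over `0 ≤ x < n` (with `n` in register `0`) and local definitions. -/
inductive Ex where
  | lit (z : ℤ)
  | var (x : ℕ)
  | cell (A : ℕ) (i : Ex)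
  | add (a b : Ex)
  | sub (a b : Ex)
  | mul (a b : Ex)
  | div (a b : Ex)
  | ite (c a b : Ex)
  | sum (x : ℕ) (e : Ex)
  | amin (x : ℕ) (e : Ex)
  | lett (x : ℕ) (a e : Ex)

namespace Ex

/-- The value of an expression. -/
def eval : Ex → Mem → ℤ
  | lit z, _ => z
  | var x, m => m.reg x
  | cell A i, m => m.arr A (i.eval m)
  | add a b, m => a.eval m + b.eval m
  | sub a b, m => a.eval m - b.eval m
  | mul a b, m => a.eval m * b.eval m
  | div a b, m => a.eval m / b.eval m
  | ite c a b, m => if 0 < c.eval m then a.eval m else b.eval m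
  | sum x e, m => ∑ v ∈ Finset.range (m.reg 0).toNat, e.eval (m.setReg x (v : ℤ))
  | amin x e, m => (argminBelow (fun v => e.eval (m.setReg x (v : ℤ))) (m.reg 0).toNat : ℕ)
  | lett x a e, m => e.eval (m.setReg x (a.eval m))

/-- The code evaluating an expression into register `d`, using only registers from `d` on. -/
def compile : Ex → ℕ → Prog
  | lit z, d => .setReg d (.const z)
  | var x, d => .setReg d (.reg x)
  | cell A i, d => .seq (i.compile d) (.setReg d (.cell A (.reg d)))
  | add a b, d => .seq (a.compile d) (.seq (b.compile (d + 1))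
      (.setReg d (.add (.reg d) (.reg (d + 1)))))
  | sub a b, d => .seq (a.compile d) (.seq (b.compile (d + 1))
      (.setReg d (.sub (.reg d) (.reg (d + 1)))))
  | mul a b, d => .seq (a.compile d) (.seq (b.compile (d + 1))
      (.setReg d (.mul (.reg d) (.reg (d + 1)))))
  | div a b, d => .seq (a.compile d) (.seq (b.compile (d + 1))
      (.setReg d (.div (.reg d) (.reg (d + 1)))))
  | ite c a b, d => .seq (c.compile d) (.ifPos (.reg d) (a.compile d) (b.compile d))
  | sum x e, d => .seq (.setReg d (.const 0))
      (forProg x (.seq (e.compile (x + 1)) (.setReg d (.add (.reg d) (.reg (x + 1))))))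
  | amin x e, d => .seq (.setReg d (.const 0)) (.seq (.setReg x (.const 0))
      (.seq (e.compile (x + 1)) (.seq (.setReg (d + 1) (.reg (x + 1)))
      (forProg x (.seq (e.compile (x + 1)) (.ifPos (.sub (.reg (d + 1)) (.reg (x + 1)))
        (.seq (.setReg d (.reg x)) (.setReg (d + 1) (.reg (x + 1)))) .skip))))))
  | lett x a e, d => .seq (a.compile x) (.seq (e.compile (x + 1)) (.setReg d (.reg (x + 1))))

/-- The expression can be compiled with result register `d` if its free variables are in `Γ`. -/
def WF : Ex → List ℕ → ℕ → Bool
  | lit _, _, _ => true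
  | var x, Γ, _ => decide (x ∈ Γ)
  | cell _ i, Γ, d => i.WF Γ d
  | add a b, Γ, d => a.WF Γ d && b.WF Γ (d + 1)
  | sub a b, Γ, d => a.WF Γ d && b.WF Γ (d + 1)
  | mul a b, Γ, d => a.WF Γ d && b.WF Γ (d + 1)
  | div a b, Γ, d => a.WF Γ d && b.WF Γ (d + 1)
  | ite c a b, Γ, d => c.WF Γ d && a.WF Γ d && b.WF Γ d
  | sum x e, Γ, d => decide (d < x) && e.WF (x :: Γ) (x + 1)
  | amin x e, Γ, d => decide (d + 1 < x) && e.WF (x :: Γ) (x + 1)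
  | lett x a e, Γ, d => decide (d < x) && a.WF Γ x && e.WF (x :: Γ) (x + 1)

/-- All numbers read in evaluating the expression are at most `X`. -/
def Safe (X : ℕ) : Ex → Mem → Prop
  | lit _, _ => True
  | var x, m => |m.reg x| ≤ X
  | cell A i, m => i.Safe X m ∧ |m.arr A (i.eval m)| ≤ X
  | add a b, m => a.Safe X m ∧ b.Safe X m
  | sub a b, m => a.Safe X m ∧ b.Safe X m
  | mul a b, m => a.Safe X m ∧ b.Safe X m
  | div a b, m => a.Safe X m ∧ b.Safe X m
  | ite c a b, m => c.Safe X m ∧ (0 < c.eval m → a.Safe X m) ∧ (¬ 0 < c.eval m → b.Safe X m)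
  | sum x e, m => ∀ v : ℕ, v < (m.reg 0).toNat → e.Safe X (m.setReg x v)
  | amin x e, m => ∀ v : ℕ, v < (m.reg 0).toNat → e.Safe X (m.setReg x v)
  | lett x a e, m => a.Safe X m ∧ e.Safe X (m.setReg x (a.eval m))

/-- The values in the evaluation of a safe expression are at most `X ^ mag`. -/
def mag : Ex → ℕ
  | lit z => z.natAbs
  | var _ => 1
  | cell _ i => i.mag + 1
  | add a b => a.mag + b.mag + 1
  | sub a b => a.mag + b.mag + 1
  | mul a b => a.mag + b.mag
  | div a b => a.mag + b.mag
  | ite c a b => c.mag + a.mag + b.mag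
  | sum _ e => e.mag + 1
  | amin _ e => e.mag + 1
  | lett _ a e => a.mag + e.mag

/-- The evaluation takes time `O(n ^ deg)`. -/
def deg : Ex → ℕ
  | lit _ => 0
  | var _ => 0
  | cell _ i => i.deg
  | add a b => max a.deg b.deg
  | sub a b => max a.deg b.deg
  | mul a b => max a.deg b.deg
  | div a b => max a.deg b.deg
  | ite c a b => max c.deg (max a.deg b.deg)
  | sum _ e => e.deg + 1
  | amin _ e => e.deg + 1
  | lett _ a e => max a.deg e.deg

/-- The implied constant in the time bound `O(n ^ deg)`. -/
def coef : Ex → ℕ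
  | lit _ => 2
  | var _ => 2
  | cell _ i => i.coef + 3
  | add a b => a.coef + b.coef + 4
  | sub a b => a.coef + b.coef + 4
  | mul a b => a.coef + b.coef + 4
  | div a b => a.coef + b.coef + 4
  | ite c a b => c.coef + a.coef + b.coef + 2
  | sum _ e => e.coef + 20
  | amin _ e => 2 * e.coef + 30
  | lett _ a e => a.coef + e.coef + 2

/-- Compiled code overwrites registers from its target upwards, so values must not depend on them.
Register `0` is an implicit free variable, being the range of all sums and minimisers. -/
theorem eval_congr {e : Ex} : ∀ {Γ : List ℕ} {d : ℕ} {m m' : Mem}, e.WF Γ d →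
    m.reg 0 = m'.reg 0 → m.arr = m'.arr → (∀ x ∈ Γ, m.reg x = m'.reg x) →
    e.eval m = e.eval m' := by
  have upd : ∀ {Γ : List ℕ} {m m' : Mem} (x : ℕ) (v : ℤ), (∀ x ∈ Γ, m.reg x = m'.reg x) →
      ∀ y ∈ x :: Γ, (m.setReg x v).reg y = (m'.setReg x v).reg y := by
    intro Γ m m' x v h y hy
    rw [Mem.setReg_reg, Mem.setReg_reg]
    split_ifs with hyx
    · rfl
    · exact h y (by simpa [hyx] using hy)
  have upd0 : ∀ {m m' : Mem} (x : ℕ) (v : ℤ), m.reg 0 = m'.reg 0 →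
      (m.setReg x v).reg 0 = (m'.setReg x v).reg 0 := by
    intro m m' x v h
    rw [Mem.setReg_reg, Mem.setReg_reg, h]
  induction e with
  | lit z => intros; rfl
  | var x =>
    intro Γ d m m' hw h0 ha hΓ
    exact hΓ x (by simpa [WF] using hw)
  | cell A i ih =>
    intro Γ d m m' hw h0 ha hΓ
    simp only [eval, ha, ih (by simpa [WF] using hw) h0 ha hΓ]
  | add a b iha ihb | sub a b iha ihb | mul a b iha ihb | div a b iha ihb =>
    intro Γ d m m' hw h0 ha hΓ
    simp only [WF, Bool.and_eq_true] at hw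
    simp only [eval, iha hw.1 h0 ha hΓ, ihb hw.2 h0 ha hΓ]
  | ite c a b ihc iha ihb =>
    intro Γ d m m' hw h0 ha hΓ
    simp only [WF, Bool.and_eq_true] at hw
    simp only [eval, ihc hw.1.1 h0 ha hΓ, iha hw.1.2 h0 ha hΓ, ihb hw.2 h0 ha hΓ]
  | sum x e ih | amin x e ih =>
    intro Γ d m m' hw h0 ha hΓ
    simp only [WF, Bool.and_eq_true] at hw
    have : ∀ v : ℤ, e.eval (m.setReg x v) = e.eval (m'.setReg x v) := fun v =>
      ih hw.2 (upd0 x v h0) (by simpa using ha) (upd x v hΓ)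
    simp only [eval, this, h0]
  | lett x a e iha ihe =>
    intro Γ d m m' hw h0 ha hΓ
    simp only [WF, Bool.and_eq_true] at hw
    simp only [eval, iha hw.1.2 h0 ha hΓ]
    exact ihe hw.2 (upd0 x _ h0) (by simpa using ha) (upd x _ hΓ)

theorem safe_congr {X : ℕ} {e : Ex} : ∀ {Γ : List ℕ} {d : ℕ} {m m' : Mem}, e.WF Γ d →
    m.reg 0 = m'.reg 0 → m.arr = m'.arr → (∀ x ∈ Γ, m.reg x = m'.reg x) →
    e.Safe X m → e.Safe X m' := by
  have upd : ∀ {Γ : List ℕ} {m m' : Mem} (x : ℕ) (v : ℤ), (∀ x ∈ Γ, m.reg x = m'.reg x) →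
      ∀ y ∈ x :: Γ, (m.setReg x v).reg y = (m'.setReg x v).reg y := by
    intro Γ m m' x v h y hy
    rw [Mem.setReg_reg, Mem.setReg_reg]
    split_ifs with hyx
    · rfl
    · exact h y (by simpa [hyx] using hy)
  have upd0 : ∀ {m m' : Mem} (x : ℕ) (v : ℤ), m.reg 0 = m'.reg 0 →
      (m.setReg x v).reg 0 = (m'.setReg x v).reg 0 := by
    intro m m' x v h
    rw [Mem.setReg_reg, Mem.setReg_reg, h]
  induction e with
  | lit z => intros; trivial
  | var x =>
    intro Γ d m m' hw h0 ha hΓ hs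
    simpa only [Safe, hΓ x (by simpa [WF] using hw)] using hs
  | cell A i ih =>
    intro Γ d m m' hw h0 ha hΓ hs
    have hw' : i.WF Γ d := by simpa [WF] using hw
    refine ⟨ih hw' h0 ha hΓ hs.1, ?_⟩
    rw [← ha, ← eval_congr hw' h0 ha hΓ]
    exact hs.2
  | add a b iha ihb | sub a b iha ihb | mul a b iha ihb | div a b iha ihb =>
    intro Γ d m m' hw h0 ha hΓ hs
    simp only [WF, Bool.and_eq_true] at hw
    exact ⟨iha hw.1 h0 ha hΓ hs.1, ihb hw.2 h0 ha hΓ hs.2⟩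
  | ite c a b ihc iha ihb =>
    intro Γ d m m' hw h0 ha hΓ hs
    simp only [WF, Bool.and_eq_true] at hw
    refine ⟨ihc hw.1.1 h0 ha hΓ hs.1, fun h => iha hw.1.2 h0 ha hΓ (hs.2.1 ?_),
      fun h => ihb hw.2 h0 ha hΓ (hs.2.2 ?_)⟩
    · rwa [eval_congr hw.1.1 h0 ha hΓ]
    · rwa [eval_congr hw.1.1 h0 ha hΓ]
  | sum x e ih | amin x e ih =>
    intro Γ d m m' hw h0 ha hΓ hs
    simp only [WF, Bool.and_eq_true] at hw
    intro v hv
    exact ih hw.2 (upd0 x v h0) (by simpa using ha) (upd x v hΓ) (hs v (by rwa [h0]))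
  | lett x a e iha ihe =>
    intro Γ d m m' hw h0 ha hΓ hs
    simp only [WF, Bool.and_eq_true] at hw
    refine ⟨iha hw.1.2 h0 ha hΓ hs.1, ?_⟩
    rw [← eval_congr hw.1.2 h0 ha hΓ]
    exact ihe hw.2 (upd0 x _ h0) (by simpa using ha) (upd x _ hΓ) hs.2

theorem sum_abs_le {X : ℕ} (f : ℕ → ℤ) (r k : ℕ) (hr : r ≤ X)
    (hf : ∀ v < r, |f v| ≤ (X : ℤ) ^ k) : |∑ v ∈ Finset.range r, f v| ≤ (X : ℤ) ^ (k + 1) := by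
  calc |∑ v ∈ Finset.range r, f v| ≤ ∑ v ∈ Finset.range r, |f v| := Finset.abs_sum_le_sum_abs _ _
    _ ≤ ∑ v ∈ Finset.range r, (X : ℤ) ^ k :=
        Finset.sum_le_sum fun v hv => hf v (Finset.mem_range.1 hv)
    _ = r * (X : ℤ) ^ k := by simp
    _ ≤ X * (X : ℤ) ^ k := by gcongr
    _ = (X : ℤ) ^ (k + 1) := by ring

/-- Safety bounds everything read from memory by `X`, so only literals and arithmetic raise the
exponent: a literal `z` is at most `2 ^ |z|`, two summands are absorbed by one more factor `X ≥ 2`,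
a sum has at most `X` terms, and integer division does not increase absolute values. -/
theorem abs_eval_le {X : ℕ} (hX : 2 ≤ X) {e : Ex} : ∀ {Γ : List ℕ} {d : ℕ} {m : Mem},
    e.WF Γ d → m.reg 0 ≤ X → e.Safe X m → |e.eval m| ≤ (X : ℤ) ^ e.mag := by
  have hX' : (2 : ℤ) ≤ X := by exact_mod_cast hX
  have hX1 : (1 : ℤ) ≤ X := by omega
  have mono : ∀ {k l : ℕ}, k ≤ l → (X : ℤ) ^ k ≤ (X : ℤ) ^ l := fun h => pow_le_pow_right₀ hX1 h
  have two : ∀ k l : ℕ, (X : ℤ) ^ k + (X : ℤ) ^ l ≤ (X : ℤ) ^ (k + l + 1) := by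
    intro k l
    have h1 := mono (Nat.le_add_right k l)
    have h2 := mono (Nat.le_add_left l k)
    have h3 : (0 : ℤ) ≤ (X : ℤ) ^ (k + l) := by positivity
    rw [pow_succ]
    nlinarith
  have upd0 : ∀ {m : Mem} {x d : ℕ} (v : ℤ), d < x → m.reg 0 ≤ X →
      (m.setReg x v).reg 0 ≤ X := by
    intro m x d v hx h
    rwa [Mem.setReg_reg_of_ne _ _ (by omega)]
  induction e with
  | lit z =>
    intro _ _ _ _ _ _
    have h1 : z.natAbs < 2 ^ z.natAbs := Nat.lt_two_pow_self
    have h2 : 2 ^ z.natAbs ≤ X ^ z.natAbs := Nat.pow_le_pow_left hX _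
    simp only [eval, mag, Int.abs_eq_natAbs]
    exact_mod_cast h1.le.trans h2
  | var x =>
    intro _ _ _ _ _ hs
    simpa [eval, mag, Safe] using hs
  | cell A i ih =>
    intro _ _ _ _ _ hs
    exact hs.2.trans (by simpa [mag] using mono (show 1 ≤ i.mag + 1 by omega))
  | add a b iha ihb =>
    intro Γ d m hw h0 hs
    simp only [WF, Bool.and_eq_true] at hw
    exact (abs_add_le _ _).trans ((add_le_add (iha hw.1 h0 hs.1) (ihb hw.2 h0 hs.2)).trans
      (two _ _))
  | sub a b iha ihb =>
    intro Γ d m hw h0 hs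
    simp only [WF, Bool.and_eq_true] at hw
    exact (abs_sub _ _).trans ((add_le_add (iha hw.1 h0 hs.1) (ihb hw.2 h0 hs.2)).trans
      (two _ _))
  | mul a b iha ihb =>
    intro Γ d m hw h0 hs
    simp only [WF, Bool.and_eq_true] at hw
    simp only [eval, mag, abs_mul, pow_add]
    exact mul_le_mul (iha hw.1 h0 hs.1) (ihb hw.2 h0 hs.2) (abs_nonneg _) (by positivity)
  | div a b iha ihb =>
    intro Γ d m hw h0 hs
    simp only [WF, Bool.and_eq_true] at hw
    have h := Int.abs_ediv_le_abs (a.eval m) (b.eval m)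
    exact h.trans ((iha hw.1 h0 hs.1).trans (mono (Nat.le_add_right _ _)))
  | ite c a b ihc iha ihb =>
    intro Γ d m hw h0 hs
    simp only [WF, Bool.and_eq_true] at hw
    simp only [eval, mag]
    split_ifs with h
    · exact (iha hw.1.2 h0 (hs.2.1 h)).trans (mono (by omega))
    · exact (ihb hw.2 h0 (hs.2.2 h)).trans (mono (by omega))
  | sum x e ih =>
    intro Γ d m hw h0 hs
    simp only [WF, Bool.and_eq_true, decide_eq_true_eq] at hw
    exact sum_abs_le _ _ _ (by omega) fun v hv => ih hw.2 (upd0 _ hw.1 h0) (hs v hv)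
  | amin x e ih =>
    intro Γ d m hw h0 hs
    have h1 : argminBelow (fun v => e.eval (m.setReg x (v : ℤ))) (m.reg 0).toNat
        ≤ (m.reg 0).toNat := by
      rcases Nat.eq_zero_or_pos (m.reg 0).toNat with h | h
      · rw [h]; exact le_rfl
      · exact (argminBelow_lt _ h).le
    have h2 := mono (show 1 ≤ e.mag + 1 by omega)
    rw [pow_one] at h2
    simp only [eval, mag, Nat.abs_cast]
    omega
  | lett x a e iha ihe =>
    intro Γ d m hw h0 hs
    simp only [WF, Bool.and_eq_true, decide_eq_true_eq] at hw
    exact (ihe hw.2 (upd0 _ hw.1.1 h0) hs.2).trans (mono (Nat.le_add_left _ _))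

/-- `m'` is `m` with the value `v` in register `d`, up to the registers above `d`. -/
def Result (d : ℕ) (v : ℤ) (m m' : Mem) : Prop :=
  m'.reg d = v ∧ (∀ x < d, m'.reg x = m.reg x) ∧ m'.arr = m.arr

theorem triple_binop {B : ℕ} {p q : Prog} {m : Mem} {d S T : ℕ} {a b v : ℤ} {op : AExp}
    (hp : Triple B p m S (Result d a m))
    (hq : ∀ m', Result d a m m' → Triple B q m' T (Result (d + 1) b m'))
    (hop : ∀ m', m'.reg d = a → m'.reg (d + 1) = b → op.val m' = v) (hc : op.cost = 3)
    (hv : |v| ≤ (B : ℤ)) :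
    Triple B (.seq p (.seq q (.setReg d op))) m (S + T + 4) (Result d v m) := by
  refine (hp.seq (T' := T + 4) fun m' hm' =>
    (hq m' hm').seq (T' := 4) fun m'' hm'' => ?_).mono (by omega)
    fun _ h => h
  have hd : m''.reg d = a := by rw [hm''.2.1 d (by omega), hm'.1]
  have hval := hop m'' hd hm''.1
  refine (Triple.setReg (by rwa [hval]) ⟨by simp [hval], fun x hx => ?_, ?_⟩).mono (by omega)
    fun _ h => h
  · rw [Mem.setReg_reg_of_ne _ _ (by omega), hm''.2.1 x (by omega), hm'.2.1 x hx]
  · rw [Mem.setReg_arr, hm''.2.2, hm'.2.2]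

/-- The target `d` acts as a stack pointer: free variables lie below it, and the code keeps all
registers below it and all arrays. Pending partial results therefore survive the evaluation of later
subexpressions. -/
theorem compile_spec {B X n : ℕ} (hn : 1 ≤ n) (hnX : n ≤ X) (hX : 2 ≤ X) {e : Ex} :
    ∀ {Γ : List ℕ} {d : ℕ} {m : Mem}, e.WF Γ d → (∀ x ∈ Γ, x < d) → 0 < d → m.reg 0 = n →
      e.Safe X m → X ^ e.mag ≤ B →
      Triple B (e.compile d) m (e.coef * n ^ e.deg) (Result d (e.eval m) m) := by
  have hX0 : 0 < X := by omega
  have bd : ∀ {e : Ex} {Γ : List ℕ} {d : ℕ} {m : Mem}, e.WF Γ d → m.reg 0 = n → e.Safe X m →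
      X ^ e.mag ≤ B → |e.eval m| ≤ (B : ℤ) := by
    intro e Γ d m hw h0 hs hB
    exact (abs_eval_le hX hw (by omega) hs).trans (by exact_mod_cast hB)
  have le1 : ∀ {k l : ℕ}, k ≤ l → X ^ l ≤ B → X ^ k ≤ B := fun h h' =>
    (Nat.pow_le_pow_right hX0 h).trans h'
  have np : ∀ {k l : ℕ}, k ≤ l → n ^ k ≤ n ^ l := fun h => Nat.pow_le_pow_right hn h
  have n1 : ∀ k : ℕ, 1 ≤ n ^ k := fun k => Nat.one_le_pow _ _ hn
  have wk : ∀ {c k l : ℕ}, k ≤ l → c * n ^ k ≤ c * n ^ l := fun h => Nat.mul_le_mul_left _ (np h)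
  have tr : ∀ {e : Ex} {Γ : List ℕ} {d d' : ℕ} {a : ℤ} {m m' : Mem}, e.WF Γ d' →
      (∀ x ∈ Γ, x < d) → 0 < d → Result d a m m' →
      m'.reg 0 = m.reg 0 ∧ e.eval m' = e.eval m ∧ (e.Safe X m → e.Safe X m') := by
    intro e Γ d d' a m m' hw hΓ hd h
    have h0 := h.2.1 0 hd
    have h1 : ∀ x ∈ Γ, m.reg x = m'.reg x := fun x hx => (h.2.1 x (hΓ x hx)).symm
    exact ⟨h0, (eval_congr hw h0.symm h.2.2.symm h1).symm,
      fun hs => safe_congr hw h0.symm h.2.2.symm h1 hs⟩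
  induction e with
  | lit z =>
    intro Γ d m hw hΓ hd h0 hs hB
    have := bd hw h0 hs hB
    exact (Triple.setReg (e := .const z) this ⟨by simp [AExp.val, eval],
      fun x hx => Mem.setReg_reg_of_ne _ _ (by omega), rfl⟩).mono
      (by simp [AExp.cost, coef, deg]) fun _ h => h
  | var y =>
    intro Γ d m hw hΓ hd h0 hs hB
    have := bd hw h0 hs hB
    exact (Triple.setReg (e := .reg y) this ⟨by simp [AExp.val, eval],
      fun x hx => Mem.setReg_reg_of_ne _ _ (by omega), rfl⟩).mono
      (by simp [AExp.cost, coef, deg]) fun _ h => h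
  | cell A i ih =>
    intro Γ d m hw hΓ hd h0 hs hB
    have hb := bd hw h0 hs hB
    refine ((ih (by simpa [WF] using hw) hΓ hd h0 hs.1 (le1 (by simp [mag]) hB)).seq
      (T' := 3) fun m' hm' => ?_).mono ?_ fun _ h => h
    · have hval : (AExp.cell A (.reg d)).val m' = (cell A i).eval m := by
        simp [AExp.val, eval, hm'.1, hm'.2.2]
      refine (Triple.setReg (e := .cell A (.reg d)) (by rwa [hval])
        ⟨by simp [hval], fun x hx => ?_, ?_⟩).mono (by simp [AExp.cost]) fun _ h => h
      · rw [Mem.setReg_reg_of_ne _ _ (by omega), hm'.2.1 x hx]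
      · rw [Mem.setReg_arr, hm'.2.2]
    · have := n1 i.deg
      simp only [coef, deg]
      nlinarith
  | add a b iha ihb | sub a b iha ihb | mul a b iha ihb | div a b iha ihb =>
    intro Γ d m hw hΓ hd h0 hs hB
    have hb := bd hw h0 hs hB
    simp only [WF, Bool.and_eq_true] at hw
    refine (triple_binop (b := b.eval m) (T := b.coef * n ^ b.deg)
      (iha hw.1 hΓ hd h0 hs.1 (le1 (by simp only [mag]; omega) hB)) (fun m' hm' => ?_)
      (fun m' h1 h2 => ?_) rfl hb).mono ?_ fun _ h => h
    · obtain ⟨h1, h2, h3⟩ := tr hw.2 hΓ hd hm'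
      rw [← h2]
      exact ihb hw.2 (fun x hx => (hΓ x hx).trans (by omega)) (by omega) (by omega) (h3 hs.2)
        (le1 (by simp only [mag]; omega) hB)
    · simp [AExp.val, eval, h1, h2]
    · have h1 := wk (c := a.coef) (le_max_left a.deg b.deg)
      have h2 := wk (c := b.coef) (le_max_right a.deg b.deg)
      have h3 := n1 (max a.deg b.deg)
      simp only [coef, deg]
      nlinarith
  | ite c a b ihc iha ihb =>
    intro Γ d m hw hΓ hd h0 hs hB
    simp only [WF, Bool.and_eq_true] at hw
    refine ((ihc hw.1.1 hΓ hd h0 hs.1 (le1 (by simp only [mag]; omega) hB)).seq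
      (fun m' hm' => (Triple.ifPos (T := a.coef * n ^ a.deg + b.coef * n ^ b.deg)
        (fun h => ?_) (fun h => ?_)))).mono ?_ fun _ h => h
    · simp only [AExp.val, hm'.1] at h
      obtain ⟨h1, h2, h3⟩ := tr hw.1.2 hΓ hd hm'
      refine (iha hw.1.2 hΓ hd (by omega) (h3 (hs.2.1 h))
        (le1 (by simp only [mag]; omega) hB)).mono (by omega) fun m'' hm'' => ⟨?_, ?_, ?_⟩
      · rw [hm''.1, h2]; simp [eval, h]
      · intro x hx; rw [hm''.2.1 x hx, hm'.2.1 x hx]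
      · rw [hm''.2.2, hm'.2.2]
    · simp only [AExp.val, hm'.1] at h
      obtain ⟨h1, h2, h3⟩ := tr hw.2 hΓ hd hm'
      refine (ihb hw.2 hΓ hd (by omega) (h3 (hs.2.2 h))
        (le1 (by simp only [mag]; omega) hB)).mono (by omega) fun m'' hm'' => ⟨?_, ?_, ?_⟩
      · rw [hm''.1, h2]; simp [eval, h]
      · intro x hx; rw [hm''.2.1 x hx, hm'.2.1 x hx]
      · rw [hm''.2.2, hm'.2.2]
    · have h1 := wk (c := c.coef) (le_max_left c.deg (max a.deg b.deg))
      have h2 := wk (c := a.coef) ((le_max_left a.deg b.deg).trans (le_max_right c.deg _))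
      have h3 := wk (c := b.coef) ((le_max_right a.deg b.deg).trans (le_max_right c.deg _))
      have h4 := n1 (max c.deg (max a.deg b.deg))
      simp only [coef, deg, AExp.cost]
      nlinarith
  | sum x e ih =>
    intro Γ d m hw hΓ hd h0 hs hB
    simp only [WF, Bool.and_eq_true, decide_eq_true_eq] at hw
    have hnt : (m.reg 0).toNat = n := by omega
    have hBX : n ≤ B := hnX.trans (by simpa using le1 (show 1 ≤ (sum x e).mag by simp [mag]) hB)
    have hxΓ : ∀ y ∈ Γ, y ≠ x := fun y hy => by have := hΓ y hy; omega
    -- The accumulator is written in every round, so all partial sums must obey the size bound.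
    have hpart : ∀ v ≤ n, |∑ u ∈ Finset.range v, e.eval (m.setReg x (u : ℤ))| ≤ (B : ℤ) := by
      intro v hv
      refine (sum_abs_le (X := X) _ _ e.mag (hv.trans hnX) fun u hu => ?_).trans
        (by exact_mod_cast hB)
      refine abs_eval_le hX hw.2 ?_ (hs u (by omega))
      rw [Mem.setReg_reg_of_ne _ _ (by omega)]
      omega
    refine ((Triple.setReg (e := .const 0) (by simp [AExp.val])
      (Q := fun m' => m' = m.setReg d 0) rfl).seq (fun m' hm' => ?_)
      (T' := n * ((e.coef * n ^ e.deg + 4) + 8) + 6)).mono ?_ fun _ h => h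
    · subst hm'
      refine (Triple.forProg (n := n) (T := e.coef * n ^ e.deg + 4) (fun v m' => m'.reg d =
          ∑ u ∈ Finset.range v, e.eval (m.setReg x (u : ℤ)) ∧
          (∀ y < d, m'.reg y = m.reg y) ∧ m'.arr = m.arr) hBX ?_ ?_ ?_).mono
        le_rfl ?_
      · rintro v m' ⟨h1, h2, h3⟩
        rw [h2 0 hd, h0]
      · rintro v hv m' ⟨h1, h2, h3⟩ hx
        have e1 : e.eval m' = e.eval (m.setReg x v) := by
          refine eval_congr hw.2 ?_ ?_ ?_
          · rw [h2 0 hd, Mem.setReg_reg_of_ne _ _ (by omega)]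
          · simpa using h3
          · intro y hy
            rcases List.mem_cons.1 hy with rfl | hy
            · simp [hx]
            · rw [h2 y (hΓ y hy), Mem.setReg_reg_of_ne _ _ (hxΓ y hy)]
        have s1 : e.Safe X m' := by
          refine safe_congr hw.2 ?_ ?_ ?_ (hs v (by omega))
          · rw [h2 0 hd, Mem.setReg_reg_of_ne _ _ (by omega)]
          · simpa using h3.symm
          · intro y hy
            rcases List.mem_cons.1 hy with rfl | hy
            · simp [hx]
            · rw [h2 y (hΓ y hy), Mem.setReg_reg_of_ne _ _ (hxΓ y hy)]
        refine ((ih hw.2 ?_ (by omega) (by rw [h2 0 hd, h0]) s1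
          (le1 (by simp [mag]) hB)).seq (T' := 4) fun m'' hm'' => ?_).mono le_rfl fun _ h => h
        · intro y hy
          rcases List.mem_cons.1 hy with rfl | hy
          · omega
          · exact (hΓ y hy).trans (by omega)
        · have hval : (AExp.add (.reg d) (.reg (x + 1))).val m'' =
              ∑ u ∈ Finset.range (v + 1), e.eval (m.setReg x (u : ℤ)) := by
            rw [Finset.sum_range_succ, ← e1, ← h1]
            simp only [AExp.val]
            rw [hm''.1, hm''.2.1 d (by omega)]
          refine (Triple.setReg (e := .add (.reg d) (.reg (x + 1))) ?_ ⟨⟨?_, ?_, ?_⟩, ?_⟩).mono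
            (by simp [AExp.cost]) fun _ h => h
          · rw [hval]; exact hpart _ (by omega)
          · rw [Mem.setReg_reg_of_ne _ _ (by omega), Mem.setReg_reg_self, hval]
          · intro y hy
            rw [Mem.setReg_reg_of_ne _ _ (by omega), Mem.setReg_reg_of_ne _ _ (by omega),
              hm''.2.1 y (by omega), h2 y hy]
          · simp [hm''.2.2, h3]
          · rw [Mem.setReg_reg_of_ne _ _ (by omega), hm''.2.1 x (by omega), hx]
      · refine ⟨?_, ?_, rfl⟩
        · rw [Mem.setReg_reg_of_ne _ _ (by omega)]; simp
        · intro y hy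
          rw [Mem.setReg_reg_of_ne _ _ (by omega), Mem.setReg_reg_of_ne _ _ (by omega)]
      · rintro m' ⟨⟨h1, h2, h3⟩, -⟩
        exact ⟨by rw [h1]; simp [eval, hnt], h2, h3⟩
    · have := n1 e.deg
      simp only [coef, deg, pow_succ, AExp.cost]
      nlinarith
  | amin x e ih =>
    intro Γ d m hw hΓ hd h0 hs hB
    simp only [WF, Bool.and_eq_true, decide_eq_true_eq] at hw
    have hnt : (m.reg 0).toNat = n := by omega
    -- `sum x e` and `amin x e` have the same `mag`.
    have hBX : n ≤ B := hnX.trans (by simpa using le1 (show 1 ≤ (sum x e).mag by simp [mag]) hB)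
    have hxΓ : ∀ y ∈ Γ, y ≠ x := fun y hy => by have := hΓ y hy; omega
    set f : ℕ → ℤ := fun v => e.eval (m.setReg x (v : ℤ)) with hf
    have hfB : ∀ v < n, |f v| ≤ (B : ℤ) := fun v hv =>
      bd hw.2 (by rw [Mem.setReg_reg_of_ne _ _ (by omega), h0]) (hs v (by omega))
        (le1 (by simp [mag]) hB)
    have hΓ' : ∀ y ∈ x :: Γ, y < x + 1 := by
      intro y hy
      rcases List.mem_cons.1 hy with rfl | hy
      · omega
      · exact (hΓ y hy).trans (by omega)
    have body : ∀ v < n, ∀ m' : Mem, (∀ y < d, m'.reg y = m.reg y) → m'.arr = m.arr →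
        m'.reg x = v → Triple B (e.compile (x + 1)) m' (e.coef * n ^ e.deg)
          (Result (x + 1) (f v) m') := by
      intro v hv m' h2 h3 hx
      have a1 : m'.reg 0 = (m.setReg x v).reg 0 := by
        rw [h2 0 hd, Mem.setReg_reg_of_ne _ _ (by omega)]
      have a2 : m'.arr = (m.setReg x v).arr := by simpa using h3
      have a3 : ∀ y ∈ x :: Γ, m'.reg y = (m.setReg x v).reg y := by
        intro y hy
        rcases List.mem_cons.1 hy with rfl | hy
        · simp [hx]
        · rw [h2 y (hΓ y hy), Mem.setReg_reg_of_ne _ _ (hxΓ y hy)]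
      have e1 : e.eval m' = f v := eval_congr hw.2 a1 a2 a3
      have s1 : e.Safe X m' := safe_congr hw.2 a1.symm a2.symm (fun y hy => (a3 y hy).symm)
        (hs v (by omega))
      rw [← e1]
      exact ih hw.2 hΓ' (by omega) (by rw [h2 0 hd, h0]) s1 (le1 (by simp [mag]) hB)
    refine ((Triple.setReg (e := .const 0) (by simp [AExp.val])
      (Q := fun m' => m' = m.setReg d 0) rfl).seq (fun m' hm' => ?_)
      (T' := 2 + (e.coef * n ^ e.deg + (2 + (n * ((e.coef * n ^ e.deg + 8) + 8) + 6)))))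
      |>.mono ?_ fun _ h => h
    · subst hm'
      refine ((Triple.setReg (e := .const 0) (by simp [AExp.val])
        (Q := fun m' => m' = (m.setReg d 0).setReg x 0) rfl).seq (fun m' hm' => ?_))
      subst hm'
      -- The record is initialised by the value at `0`, which requires `1 ≤ n` and causes the factor
      -- 2 in `coef`. From here on `d` holds the best index and `d + 1` its value.
      refine (body 0 (by omega) ((m.setReg d 0).setReg x 0) ?_ rfl (by simp)).seq fun m₁ hm₁ => ?_
      · intro y hy
        rw [Mem.setReg_reg_of_ne _ _ (by omega), Mem.setReg_reg_of_ne _ _ (by omega)]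
      refine (Triple.setReg (e := .reg (x + 1)) (by simpa [AExp.val, hm₁.1] using hfB 0 (by omega))
        (Q := fun m' => m' = m₁.setReg (d + 1) (f 0)) (by simp [AExp.val, hm₁.1])).seq
        (fun m₂ hm₂ => ?_)
      subst hm₂
      refine (Triple.forProg (n := n) (T := e.coef * n ^ e.deg + 8) (fun v m' =>
          m'.reg d = argminBelow f v ∧ m'.reg (d + 1) = f (argminBelow f v) ∧
          (∀ y < d, m'.reg y = m.reg y) ∧ m'.arr = m.arr) hBX ?_ ?_ ?_).mono
        le_rfl ?_
      · rintro v m' ⟨-, -, h2, h3⟩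
        rw [h2 0 hd, h0]
      · rintro v hv m' ⟨h1, h1', h2, h3⟩ hx
        refine ((body v hv m' h2 h3 hx).seq (T' := 8) fun m'' hm'' => ?_)
        have g1 : m''.reg d = argminBelow f v := by rw [hm''.2.1 d (by omega), h1]
        have g2 : m''.reg (d + 1) = f (argminBelow f v) := by rw [hm''.2.1 _ (by omega), h1']
        have g3 : m''.reg x = v := by rw [hm''.2.1 _ (by omega), hx]
        have g4 := hm''.1
        have g5 : ∀ y < d, m''.reg y = m.reg y := fun y hy => by
          rw [hm''.2.1 _ (by omega), h2 y hy]
        have g6 : m''.arr = m.arr := by rw [hm''.2.2, h3]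
        refine (Triple.ifPos (T := 4) (fun h => ?_) (fun h => ?_)).mono (by simp [AExp.cost])
          fun _ h => h
        · simp only [AExp.val, g2, g4] at h
          have ha : argminBelow f (v + 1) = v := by
            rw [argminBelow, if_pos (by omega)]
          refine ((Triple.setReg (e := .reg x) (Q := fun m' => m' = m''.setReg d v) ?_ ?_).seq
            (T' := 2) fun m₃ hm₃ => ?_)
          · simp only [AExp.val, g3, Nat.abs_cast]
            omega
          · simp [AExp.val, g3]
          · subst hm₃
            have hval : (AExp.reg (x + 1)).val (m''.setReg d v) = f v := by
              simp only [AExp.val]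
              rw [Mem.setReg_reg_of_ne _ _ (by omega), g4]
            refine (Triple.setReg (by rw [hval]; exact hfB v hv) ⟨⟨?_, ?_, ?_, ?_⟩, ?_⟩)
            · rw [Mem.setReg_reg_of_ne _ _ (by omega), Mem.setReg_reg_of_ne _ _ (by omega), ha]
              simp
            · rw [Mem.setReg_reg_of_ne _ _ (by omega), ha, hval]
              simp
            · intro y hy
              rw [Mem.setReg_reg_of_ne _ _ (by omega), Mem.setReg_reg_of_ne _ _ (by omega),
                Mem.setReg_reg_of_ne _ _ (by omega), g5 y hy]
            · simpa using g6
            · rw [Mem.setReg_reg_of_ne _ _ (by omega), Mem.setReg_reg_of_ne _ _ (by omega), g3]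
        · simp only [AExp.val, g2, g4] at h
          have ha : argminBelow f (v + 1) = argminBelow f v := by
            rw [argminBelow, if_neg (by omega)]
          refine ⟨_, _, .skip _, by omega, ⟨?_, ?_, ?_, ?_⟩, g3⟩
          · rw [Mem.setReg_reg_of_ne _ _ (by omega), ha, g1]
          · rw [Mem.setReg_reg_of_ne _ _ (by omega), ha, g2]
          · intro y hy
            rw [Mem.setReg_reg_of_ne _ _ (by omega), g5 y hy]
          · simpa using g6
      · refine ⟨?_, ?_, ?_, ?_⟩
        · rw [Mem.setReg_reg_of_ne _ _ (by omega), Mem.setReg_reg_of_ne _ _ (by omega),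
            hm₁.2.1 d (by omega), Mem.setReg_reg_of_ne _ _ (by omega)]
          simp [argminBelow]
        · rw [Mem.setReg_reg_of_ne _ _ (by omega)]
          simp [argminBelow]
        · intro y hy
          rw [Mem.setReg_reg_of_ne _ _ (by omega), Mem.setReg_reg_of_ne _ _ (by omega),
            hm₁.2.1 y (by omega), Mem.setReg_reg_of_ne _ _ (by omega),
            Mem.setReg_reg_of_ne _ _ (by omega)]
        · simp [hm₁.2.2]
      · rintro m' ⟨⟨h1, -, h2, h3⟩, -⟩
        exact ⟨by rw [h1]; simp [eval, hnt, hf], h2, h3⟩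
    · have h1 := n1 e.deg
      have h2 : e.coef * n ^ e.deg ≤ e.coef * n ^ e.deg * n := Nat.le_mul_of_pos_right _ hn
      have h3 : n ≤ n ^ e.deg * n := Nat.le_mul_of_pos_left _ h1
      simp only [coef, deg, pow_succ, AExp.cost]
      nlinarith
  | lett x a e iha ihe =>
    intro Γ d m hw hΓ hd h0 hs hB
    have hb := bd hw h0 hs hB
    simp only [WF, Bool.and_eq_true, decide_eq_true_eq] at hw
    refine ((iha hw.1.2 (fun y hy => (hΓ y hy).trans hw.1.1) (by omega) h0 hs.1
      (le1 (by simp only [mag]; omega) hB)).seq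
      (T' := e.coef * n ^ e.deg + 2) fun m' hm' => ?_).mono ?_ fun _ h => h
    · have a1 : m'.reg 0 = (m.setReg x (a.eval m)).reg 0 := by
        rw [hm'.2.1 0 (by omega), Mem.setReg_reg_of_ne _ _ (by omega)]
      have a2 : m'.arr = (m.setReg x (a.eval m)).arr := by simpa using hm'.2.2
      have a3 : ∀ y ∈ x :: Γ, m'.reg y = (m.setReg x (a.eval m)).reg y := by
        intro y hy
        rcases List.mem_cons.1 hy with rfl | hy
        · simp [hm'.1]
        · have := hΓ y hy
          rw [hm'.2.1 y (by omega), Mem.setReg_reg_of_ne _ _ (by omega)]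
      have e1 : e.eval m' = (lett x a e).eval m := eval_congr hw.2 a1 a2 a3
      have s1 : e.Safe X m' := safe_congr hw.2 a1.symm a2.symm (fun y hy => (a3 y hy).symm) hs.2
      have hΓ' : ∀ y ∈ x :: Γ, y < x + 1 := by
        intro y hy
        rcases List.mem_cons.1 hy with rfl | hy
        · omega
        · have := hΓ y hy
          omega
      refine (ihe hw.2 hΓ' (by omega) (by rw [hm'.2.1 0 (by omega), h0]) s1
        (le1 (by simp [mag]) hB)).seq fun m'' hm'' => ?_
      have hval : (AExp.reg (x + 1)).val m'' = (lett x a e).eval m := by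
        simp only [AExp.val]
        rw [hm''.1, e1]
      refine Triple.setReg (by rwa [hval]) ⟨by simp [hval], fun y hy => ?_, ?_⟩
      · rw [Mem.setReg_reg_of_ne _ _ (by omega), hm''.2.1 y (by omega), hm'.2.1 y (by omega)]
      · rw [Mem.setReg_arr, hm''.2.2, hm'.2.2]
    · have h1 := wk (c := a.coef) (le_max_left a.deg e.deg)
      have h2 := wk (c := e.coef) (le_max_right a.deg e.deg)
      have h3 := n1 (max a.deg e.deg)
      simp only [coef, deg]
      nlinarith

end Ex

/-! ## Conditional expectations over random Hamilton cycles -/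

section Tuples

variable {n : ℕ}

/-- The position `i + t`, cyclically. -/
def cyc (i : Fin n) (t : Fin 4) : Fin n := ⟨(i + t) % n, Nat.mod_lt _ (Fin.pos i)⟩

theorem cyc_injective (hn : 4 ≤ n) (i : Fin n) : Function.Injective (cyc i) := by
  intro s t h
  simp only [cyc, Fin.mk.injEq] at h
  have h2 := (Nat.ModEq.add_left_cancel' (i : ℕ) h)
  have := Nat.ModEq.eq_of_lt_of_lt h2 (by omega) (by omega)
  exact Fin.ext this

/-- The places that the four positions from `i` on can take in a permutation of the positions
fixing all positions below `j`. -/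
def tuples (j : ℕ) (i : Fin n) : Finset (Fin 4 → Fin n) :=
  Finset.univ.filter fun q => Function.Injective q ∧
    ∀ t, if j ≤ (cyc i t : ℕ) then j ≤ (q t : ℕ) else q t = cyc i t

theorem cyc_mem_tuples (hn : 4 ≤ n) (j : ℕ) (i : Fin n) : cyc i ∈ tuples j i := by
  simp only [tuples, Finset.mem_filter, Finset.mem_univ, true_and]
  refine ⟨cyc_injective hn i, fun t => ?_⟩
  split_ifs with h
  exact h

theorem card_tuples_pos (hn : 4 ≤ n) (j : ℕ) (i : Fin n) : 0 < (tuples j i).card :=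
  Finset.card_pos.2 ⟨_, cyc_mem_tuples hn j i⟩

theorem tuples_zero (i : Fin n) :
    tuples 0 i = Finset.univ.filter fun q : Fin 4 → Fin n => Function.Injective q := by
  simp [tuples]

theorem tuples_top (hn : 4 ≤ n) (i : Fin n) : tuples n i = {cyc i} := by
  refine Finset.eq_singleton_iff_unique_mem.2 ⟨cyc_mem_tuples hn n i, fun q hq => ?_⟩
  simp only [tuples, Finset.mem_filter, Finset.mem_univ, true_and] at hq
  funext t
  simpa [Nat.not_le.2 (cyc i t).isLt] using hq.2 t

/-- The positions below `j` among the four are frozen; the other `f` embed freely into the `n - j`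
positions from `j` on. The bound `f ≤ n - j` excludes zero factors. -/
theorem card_tuples (hn : 4 ≤ n) (j : ℕ) (i : Fin n) :
    ∃ f, f ≤ 4 ∧ f ≤ n - j ∧ (tuples j i).card = (n - j).descFactorial f := by
  have hcard : Fintype.card {x : Fin n // j ≤ (x : ℕ)} = n - j := by
    rw [Fintype.card_subtype]
    rcases Nat.lt_or_ge j n with h | h
    · have : (Finset.univ.filter fun x : Fin n => j ≤ (x : ℕ)) = Finset.Ici ⟨j, h⟩ := by
        ext x; simp [Fin.le_def]
      rw [this, Fin.card_Ici]
    · rw [Finset.card_eq_zero.2 (Finset.filter_eq_empty_iff.2 fun x _ => by omega)]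
      omega
  refine ⟨Fintype.card {t : Fin 4 // j ≤ (cyc i t : ℕ)}, ?_, ?_, ?_⟩
  · simpa using Fintype.card_subtype_le fun t : Fin 4 => j ≤ (cyc i t : ℕ)
  · rw [← hcard]
    refine Fintype.card_le_of_injective (fun t => ⟨cyc i t.1, t.2⟩) fun s t h => ?_
    exact Subtype.ext (cyc_injective hn i (by simpa using h))
  · rw [← hcard, ← Fintype.card_embedding_eq, ← Fintype.card_coe]
    refine Fintype.card_congr
      { toFun := fun q => ⟨fun t => ⟨q.1 t.1, ?_⟩, ?_⟩
        invFun := fun e => ⟨fun t => if h : j ≤ (cyc i t : ℕ) then (e ⟨t, h⟩).1 else cyc i t, ?_⟩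
        left_inv := ?_
        right_inv := ?_ }
    · have h := q.2
      simp only [tuples, Finset.mem_filter, Finset.mem_univ, true_and] at h
      simpa [t.2] using h.2 t.1
    · have h := q.2
      simp only [tuples, Finset.mem_filter, Finset.mem_univ, true_and] at h
      intro s t hst
      exact Subtype.ext (h.1 (by simpa using hst))
    · simp only [tuples, Finset.mem_filter, Finset.mem_univ, true_and]
      refine ⟨fun s t hst => ?_, fun t => ?_⟩
      · by_cases hs : j ≤ (cyc i s : ℕ) <;> by_cases ht : j ≤ (cyc i t : ℕ)
        · simp only [hs, ht, dite_true] at hst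
          simpa using e.injective (Subtype.ext hst)
        · simp only [hs, ht, dite_true, dite_false] at hst
          exact absurd (hst ▸ (e ⟨s, hs⟩).2) ht
        · simp only [hs, ht, dite_true, dite_false] at hst
          exact absurd (hst ▸ (e ⟨t, ht⟩).2) hs
        · simp only [hs, ht, dite_false] at hst
          exact cyc_injective hn i hst
      · by_cases ht : j ≤ (cyc i t : ℕ)
        · simpa [ht] using (e ⟨t, ht⟩).2
        · simp [ht]
    · intro q
      have h := q.2
      simp only [tuples, Finset.mem_filter, Finset.mem_univ, true_and] at h
      refine Subtype.ext (funext fun t => ?_)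
      have ht' := h.2 t
      by_cases ht : j ≤ (cyc i t : ℕ)
      · simp only [ht, dite_true]
        rfl
      · rw [if_neg ht] at ht'
        simp only [ht, dite_false, ht']
    · intro e
      ext t
      simp [t.2]

/-- A common multiple of the numbers of tuples. -/
def commonMult (r : ℕ) : ℕ := ∏ s ∈ Finset.range 4, max (r - s) 1

/-- The falling factorial is a subproduct of `commonMult`. Multiplying by the latter makes all
averages integers. -/
theorem card_tuples_dvd (hn : 4 ≤ n) (j : ℕ) (i : Fin n) :
    (tuples j i).card ∣ commonMult (n - j) := by
  obtain ⟨f, h4, hf, h⟩ := card_tuples hn j i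
  have : (n - j).descFactorial f = ∏ s ∈ Finset.range f, max (n - j - s) 1 := by
    rw [Nat.descFactorial_eq_prod_range]
    refine Finset.prod_congr rfl fun s hs => ?_
    rw [Finset.mem_range] at hs
    omega
  rw [h, this]
  exact Finset.prod_dvd_prod_of_subset _ _ _ (Finset.range_mono h4)

theorem commonMult_pos (r : ℕ) : 0 < commonMult r :=
  Finset.prod_pos fun _ _ => by positivity

/-- Fixing `j` in addition means that `j` itself, if it is one of the four positions, must be
brought back from `v`, and that no later position of the four may be moved to `j`. -/
theorem swap_comp_mem_tuples (j v : Fin n) (hv : j ≤ v) (i : Fin n) (q : Fin 4 → Fin n) :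
    Equiv.swap j v ∘ q ∈ tuples (j + 1) i ↔ q ∈ tuples j i ∧
      ∀ t, (cyc i t = j → v = q t) ∧ (j < cyc i t → q t ≠ v) := by
  simp only [tuples, Finset.mem_filter, Finset.mem_univ, true_and]
  rw [(Equiv.swap j v).injective.of_comp_iff, and_assoc, ← forall_and]
  refine and_congr_right fun _ => forall_congr' fun t => ?_
  simp only [Function.comp_apply, Equiv.swap_apply_def, Fin.ext_iff, Fin.lt_def, ne_eq]
  rw [Fin.le_def] at hv
  split_ifs <;> omega

/-- If `j` is one of the four positions, its place determines `v`. Otherwise `v` only has to avoid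
the places of those of the four positions that exceed `j`; as `q` is injective, their number does
not depend on `q`. -/
theorem card_swap_mem_tuples (hn : 4 ≤ n) (j i : Fin n) : ∃ K : ℕ, ∀ q ∈ tuples (j : ℕ) i,
    ((Finset.Ici j).filter fun v => Equiv.swap j v ∘ q ∈ tuples (j + 1) i).card = K := by
  by_cases h : ∃ s, cyc i s = j
  · obtain ⟨s, hs⟩ := h
    refine ⟨1, fun q hq => Finset.card_eq_one.2 ⟨q s, ?_⟩⟩
    ext v
    have hq' := hq
    simp only [tuples, Finset.mem_filter, Finset.mem_univ, true_and] at hq'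
    have hqs : j ≤ q s := by simpa [hs] using hq'.2 s
    simp only [Finset.mem_filter, Finset.mem_Ici, Finset.mem_singleton]
    constructor
    · rintro ⟨hv, h⟩
      exact ((swap_comp_mem_tuples j v hv i q).1 h).2 s |>.1 hs
    · rintro rfl
      refine ⟨hqs, (swap_comp_mem_tuples j _ hqs i q).2 ⟨hq, fun t => ⟨fun ht => ?_, ?_⟩⟩⟩
      · rw [cyc_injective hn i (hs.trans ht.symm)]
      · intro ht hts
        rw [hq'.1 hts, hs] at ht
        exact lt_irrefl _ ht
  · push Not at h
    refine ⟨(Finset.Ici j).card -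
      (Finset.univ.filter fun t => j < cyc i t).card, fun q hq => ?_⟩
    have hq' := hq
    simp only [tuples, Finset.mem_filter, Finset.mem_univ, true_and] at hq'
    rw [← Finset.card_image_of_injective _ hq'.1, ← Finset.card_sdiff_of_subset]
    · congr 1
      ext v
      simp only [Finset.mem_filter, Finset.mem_Ici, Finset.mem_sdiff, Finset.mem_image,
        Finset.mem_univ, true_and, not_exists, not_and]
      refine and_congr_right fun hv => ?_
      rw [swap_comp_mem_tuples j v hv i q]
      exact ⟨fun h' t => (h'.2 t).2, fun h' => ⟨hq, fun t => ⟨fun ht => absurd ht (h t), h' t⟩⟩⟩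
    · intro v hv
      simp only [Finset.mem_image, Finset.mem_filter, Finset.mem_univ, true_and] at hv
      obtain ⟨t, ht, rfl⟩ := hv
      have := hq'.2 t
      rw [if_pos (Fin.le_def.1 ht.le)] at this
      exact Finset.mem_Ici.2 (Fin.le_def.2 this)

/-- A random `v ≥ j` followed by a random tuple fixing `j` is equidistributed on the tuples not
fixing `j`: each of them arises `K` times. -/
theorem sum_swap_tuples (hn : 4 ≤ n) (j i : Fin n) : ∃ K : ℕ, ∀ G : (Fin 4 → Fin n) → ℚ,
    ∑ v ∈ Finset.Ici j, ∑ q ∈ tuples (j + 1) i, G (Equiv.swap j v ∘ q) =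
      K * ∑ q ∈ tuples (j : ℕ) i, G q := by
  obtain ⟨K, hK⟩ := card_swap_mem_tuples hn j i
  refine ⟨K, fun G => ?_⟩
  have h1 : ∀ v, ∑ q ∈ tuples (j + 1) i, G (Equiv.swap j v ∘ q) =
      ∑ q, if Equiv.swap j v ∘ q ∈ tuples (j + 1) i then G q else 0 := by
    intro v
    rw [← Finset.sum_filter]
    refine Finset.sum_bij' (fun q _ => Equiv.swap j v ∘ q) (fun q _ => Equiv.swap j v ∘ q)
      ?_ ?_ ?_ ?_ ?_
    · intro q hq
      simpa [← Function.comp_assoc, ← Equiv.coe_trans] using hq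
    · intro q hq
      simpa using hq
    · intro q _
      simp [← Function.comp_assoc, ← Equiv.coe_trans]
    · intro q _
      simp [← Function.comp_assoc, ← Equiv.coe_trans]
    · intro q _
      rfl
  simp_rw [h1]
  rw [Finset.sum_comm, Finset.mul_sum, ← Finset.sum_subset (Finset.subset_univ (tuples j i))]
  · refine Finset.sum_congr rfl fun q hq => ?_
    rw [← Finset.sum_filter, Finset.sum_const, hK q hq, nsmul_eq_mul]
  · intro q _ hq
    refine Finset.sum_eq_zero fun v hv => if_neg fun h => hq ?_
    exact ((swap_comp_mem_tuples j v (Finset.mem_Ici.1 hv) i q).1 h).1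

/-- The average of `G` over the tuples. -/
noncomputable def avg (j : ℕ) (i : Fin n) (G : (Fin 4 → Fin n) → ℚ) : ℚ :=
  (∑ q ∈ tuples j i, G q) / (tuples j i).card

/-- The tower law of conditional expectations, with `v` uniform on the positions from `j` on. -/
theorem sum_avg_swap (hn : 4 ≤ n) (j i : Fin n) (G : (Fin 4 → Fin n) → ℚ) :
    ∑ v ∈ Finset.Ici j, avg (j + 1) i (fun q => G (Equiv.swap j v ∘ q)) =
      (Finset.Ici j).card * avg (j : ℕ) i G := by
  obtain ⟨K, hK⟩ := sum_swap_tuples hn j i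
  have h1 := hK G
  -- The constant function determines `K` in terms of the cardinalities, so that `K` cancels.
  have h2 := hK fun _ => 1
  have c1 : (0 : ℚ) < (tuples (j : ℕ) i).card := by exact_mod_cast card_tuples_pos hn j i
  have c2 : (0 : ℚ) < (tuples (j + 1 : ℕ) i).card := by
    exact_mod_cast card_tuples_pos hn (j + 1) i
  simp only [avg]
  rw [← Finset.sum_div, h1]
  simp only [Finset.sum_const, nsmul_eq_mul, mul_one] at h2
  field_simp
  linear_combination (-(∑ q ∈ tuples (j : ℕ) i, G q)) * h2

end Tuples

/-! ### The mean weight of the improved cycle -/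

section Potential

variable {n : ℕ}

theorem sum_fin_four {α M : Type*} [Fintype α] [AddCommMonoid M] (F : (Fin 4 → α) → M) :
    ∑ q, F q = ∑ a, ∑ b, ∑ c, ∑ d, F ![a, b, c, d] := by
  rw [← (Fin.consEquiv fun _ => α).sum_comp, Fintype.sum_prod_type]
  refine Finset.sum_congr rfl fun a _ => ?_
  rw [← (Fin.consEquiv fun _ => α).sum_comp, Fintype.sum_prod_type]
  refine Finset.sum_congr rfl fun b _ => ?_
  rw [← (Fin.consEquiv fun _ => α).sum_comp, Fintype.sum_prod_type]
  refine Finset.sum_congr rfl fun c _ => ?_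
  rw [← (Fin.consEquiv fun _ => α).sum_comp, Fintype.sum_prod_type]
  refine Finset.sum_congr rfl fun d _ => ?_
  rw [Fintype.sum_unique]
  congr 1

theorem injective_vec_four {α : Type*} {a b c d : α} : Function.Injective ![a, b, c, d] ↔
    (a ≠ b ∧ a ≠ c ∧ a ≠ d) ∧ (b ≠ c ∧ b ≠ d) ∧ c ≠ d := by
  rw [← List.nodup_ofFn]
  simp [List.ofFn_succ]

/-- The change of weight when the path `a b c d` is replaced by `a c b d`. -/
def gap (W : Fin n → Fin n → ℤ) (a b c d : Fin n) : ℤ := W a c + W b d - W a b - W c d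

/-- The contribution of the positions `i, …, i + 3` to the weight of the cycle obtained by
improving every block, given the vertices in these positions. -/
def term (W : Fin n → Fin n → ℤ) (i : Fin n) (x : Fin 4 → Fin n) : ℤ :=
  W (x 0) (x 1) +
    if 4 ∣ (i : ℕ) ∧ (i : ℕ) + 3 < n then min 0 (gap W (x 0) (x 1) (x 2) (x 3)) else 0

/-- The average weight of the improved cycle over all permutations of the positions from `j` on. -/
noncomputable def potential (W : Fin n → Fin n → ℤ) (j : ℕ) (π : Equiv.Perm (Fin n)) : ℚ :=
  ∑ i, avg j i fun q => (term W i (π ∘ q) : ℚ)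

/-- The potential at `j` is the mean over `v ≥ j` of the potentials with position `j` decided, and a
minimum is at most the mean. -/
theorem potential_swap_le (hn : 4 ≤ n) (W : Fin n → Fin n → ℤ) (j v₀ : Fin n)
    (π : Equiv.Perm (Fin n))
    (hmin : ∀ v, j ≤ v → potential W (j + 1) (π * Equiv.swap j v₀) ≤
      potential W (j + 1) (π * Equiv.swap j v)) :
    potential W (j + 1) (π * Equiv.swap j v₀) ≤ potential W j π := by
  have h1 : ∑ v ∈ Finset.Ici j, potential W (j + 1) (π * Equiv.swap j v) =
      (Finset.Ici j).card * potential W j π := by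
    simp only [potential]
    rw [Finset.sum_comm, Finset.mul_sum]
    refine Finset.sum_congr rfl fun i _ => ?_
    rw [← sum_avg_swap hn j i]
    rfl
  have h2 : (Finset.Ici j).card * potential W (j + 1) (π * Equiv.swap j v₀) ≤
      ∑ v ∈ Finset.Ici j, potential W (j + 1) (π * Equiv.swap j v) := by
    rw [← nsmul_eq_mul]
    exact Finset.card_nsmul_le_sum _ _ _ fun v hv => hmin v (Finset.mem_Ici.1 hv)
  rw [h1] at h2
  refine le_of_mul_le_mul_left h2 ?_
  exact_mod_cast Finset.card_pos.2 ⟨j, Finset.mem_Ici.2 le_rfl⟩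

theorem potential_top (hn : 4 ≤ n) (W : Fin n → Fin n → ℤ) (π : Equiv.Perm (Fin n)) :
    potential W n π = ((∑ i, term W i (π ∘ cyc i) : ℤ) : ℚ) := by
  simp [potential, avg, tuples_top hn]

/-- The total of the absolute changes over all injective tuples. -/
def totalGap (W : Fin n → Fin n → ℤ) : ℤ :=
  ∑ q : Fin 4 → Fin n, if Function.Injective q then |gap W (q 0) (q 1) (q 2) (q 3)| else 0

/-- The number of blocks. -/
def blocks (n : ℕ) : ℕ :=
  (Finset.univ.filter fun i : Fin n => 4 ∣ (i : ℕ) ∧ (i : ℕ) + 3 < n).card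

theorem le_blocks (hn : 4 ≤ n) : n ≤ 8 * blocks n := by
  have : n / 4 ≤ blocks n := by
    rw [blocks, ← Fintype.card_subtype]
    conv_lhs => rw [← Fintype.card_fin (n / 4)]
    refine Fintype.card_le_of_injective
      (fun s => ⟨⟨4 * s, by omega⟩, by simp, by have := s.isLt; simp only; omega⟩) fun s t h => ?_
    simp only [Subtype.mk.injEq, Fin.mk.injEq] at h
    omega
  omega

/-- Exchanging the two inner vertices permutes the injective quadruples and negates the gap, and
`min 0 x + min 0 (-x) = -|x|`. -/
theorem sum_min_gap (W : Fin n → Fin n → ℤ) :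
    2 * ∑ q : Fin 4 → Fin n, (if Function.Injective q then
      min 0 (gap W (q 0) (q 1) (q 2) (q 3)) else 0) = - totalGap W := by
  have h : ∑ q : Fin 4 → Fin n, (if Function.Injective q then
      min 0 (gap W (q 0) (q 1) (q 2) (q 3)) else 0) = ∑ q : Fin 4 → Fin n,
      (if Function.Injective q then min 0 (- gap W (q 0) (q 1) (q 2) (q 3)) else 0) := by
    rw [← ((Equiv.swap (1 : Fin 4) 2).arrowCongr (Equiv.refl (Fin n))).sum_comp]
    refine Finset.sum_congr rfl fun q _ => ?_
    have e0 : Equiv.swap (1 : Fin 4) 2 0 = 0 := by decide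
    have e1 : Equiv.swap (1 : Fin 4) 2 1 = 2 := by decide
    have e2 : Equiv.swap (1 : Fin 4) 2 2 = 1 := by decide
    have e3 : Equiv.swap (1 : Fin 4) 2 3 = 3 := by decide
    have hi : Function.Injective (((Equiv.swap (1 : Fin 4) 2).arrowCongr (Equiv.refl (Fin n))) q) ↔
        Function.Injective q := by
      simp [Equiv.arrowCongr]
    simp only [hi]
    simp only [Equiv.arrowCongr, Equiv.coe_fn_mk, Equiv.coe_refl, Equiv.symm_swap,
      Function.comp_apply, id, e0, e1, e2, e3]
    congr 2
    simp only [gap]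
    ring
  rw [two_mul]
  nth_rewrite 2 [h]
  rw [totalGap, ← Finset.sum_add_distrib, ← Finset.sum_neg_distrib]
  refine Finset.sum_congr rfl fun q _ => ?_
  split_ifs
  · rcases le_total 0 (gap W (q 0) (q 1) (q 2) (q 3)) with h | h
    · rw [min_eq_left h, min_eq_right (by omega), abs_of_nonneg h]; ring
    · rw [min_eq_right h, min_eq_left (by omega), abs_of_nonpos h]; ring
  · simp

theorem sum_ite_ne_two {a b : Fin n} (hab : a ≠ b) (x : ℤ) :
    (∑ c, if a ≠ c ∧ b ≠ c then x else 0) = (n - 2) * x := by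
  rw [← Finset.sum_filter, Finset.sum_const, nsmul_eq_mul]
  have : (Finset.univ.filter fun c => a ≠ c ∧ b ≠ c) = ({a, b} : Finset (Fin n))ᶜ := by
    ext c; simp [eq_comm]
  have h2 : ({a, b} : Finset (Fin n)).card = 2 := Finset.card_pair hab
  have h3 := Finset.card_le_univ ({a, b} : Finset (Fin n))
  rw [this, Finset.card_compl, h2, Fintype.card_fin]
  rw [h2, Fintype.card_fin] at h3
  push_cast [h3]
  rfl

theorem sum_ite_ne_three {a b c : Fin n} (hab : a ≠ b) (hac : a ≠ c) (hbc : b ≠ c) (x : ℤ) :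
    (∑ d, if a ≠ d ∧ b ≠ d ∧ c ≠ d then x else 0) = (n - 3) * x := by
  rw [← Finset.sum_filter, Finset.sum_const, nsmul_eq_mul]
  have : (Finset.univ.filter fun d => a ≠ d ∧ b ≠ d ∧ c ≠ d) = ({a, b, c} : Finset (Fin n))ᶜ := by
    ext c; simp [eq_comm]
  have h2 : ({a, b, c} : Finset (Fin n)).card = 3 := Finset.card_eq_three.2
    ⟨a, b, c, hab, hac, hbc, rfl⟩
  have h3 := Finset.card_le_univ ({a, b, c} : Finset (Fin n))
  rw [this, Finset.card_compl, h2, Fintype.card_fin]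
  rw [h2, Fintype.card_fin] at h3
  push_cast [h3]
  rfl

/-- A pair of distinct vertices extends to an injective quadruple in `(n - 2) * (n - 3)` ways. -/
theorem sum_injective_pair (f : Fin n → Fin n → ℤ) :
    (∑ q : Fin 4 → Fin n, if Function.Injective q then f (q 0) (q 1) else 0) =
      (n - 2) * (n - 3) * ∑ a, ∑ b, if a ≠ b then f a b else 0 := by
  rw [sum_fin_four, Finset.mul_sum]
  refine Finset.sum_congr rfl fun a _ => ?_
  rw [Finset.mul_sum]
  refine Finset.sum_congr rfl fun b _ => ?_
  simp only [injective_vec_four]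
  by_cases hab : a = b
  · simp [hab]
  · rw [if_pos hab]
    have : ∀ c, (∑ d, if (a ≠ b ∧ a ≠ c ∧ a ≠ d) ∧ (b ≠ c ∧ b ≠ d) ∧ c ≠ d then
        f (![a, b, c, d] 0) (![a, b, c, d] 1) else 0) =
        if a ≠ c ∧ b ≠ c then (n - 3) * f a b else 0 := by
      intro c
      split_ifs with h
      · rw [← sum_ite_ne_three hab h.1 h.2]
        refine Finset.sum_congr rfl fun d _ => ?_
        have : ((a ≠ b ∧ a ≠ c ∧ a ≠ d) ∧ (b ≠ c ∧ b ≠ d) ∧ c ≠ d) ↔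
          (a ≠ d ∧ b ≠ d ∧ c ≠ d) := by tauto
        simp only [this]
        rfl
      · exact Finset.sum_eq_zero fun d _ => if_neg (by tauto)
    rw [Finset.sum_congr rfl fun c _ => this c, sum_ite_ne_two hab]
    ring

/-- The sum of the weights of all ordered pairs. -/
def total (W : Fin n → Fin n → ℤ) : ℤ := ∑ a, ∑ b, W a b

theorem card_injective : ((Finset.univ.filter fun q : Fin 4 → Fin n =>
    Function.Injective q).card : ℤ) = n * (n - 1) * (n - 2) * (n - 3) := by
  have h := sum_injective_pair (n := n) fun _ _ => 1
  rw [← Finset.sum_filter] at h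
  simp only [Finset.sum_const, nsmul_eq_mul, mul_one] at h
  rw [h]
  have : ∀ a : Fin n, (∑ b, if a ≠ b then (1 : ℤ) else 0) = n - 1 := by
    intro a
    rw [Finset.sum_ite, Finset.sum_const_zero, add_zero, Finset.sum_const, nsmul_eq_mul, mul_one,
      Finset.filter_ne, Finset.card_erase_of_mem (Finset.mem_univ a), Finset.card_univ,
      Fintype.card_fin, Nat.cast_sub (Fin.pos a)]
    rfl
  simp only [this, Finset.sum_const, nsmul_eq_mul, Finset.card_univ, Fintype.card_fin]
  ring

/-- With nothing fixed, each of the `n` edges of the cycle has mean `total W / (n * (n - 1))`, and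
each block contributes half the mean of `|gap|`. Since `total W` counts every edge twice, the first
summand is `d n`. -/
theorem potential_zero (hn : 4 ≤ n) (W : Fin n → Fin n → ℤ)
    (hW0 : ∀ a, W a a = 0) (π : Equiv.Perm (Fin n)) :
    potential W 0 π = (total W : ℚ) / (n - 1) -
      blocks n * totalGap W / (2 * (n * (n - 1) * (n - 2) * (n - 3))) := by
  have hn' : (4 : ℚ) ≤ n := by exact_mod_cast hn
  have c : ((Finset.univ.filter fun q : Fin 4 → Fin n => Function.Injective q).card : ℚ) =
      n * (n - 1) * (n - 2) * (n - 3) := by exact_mod_cast card_injective (n := n)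
  -- Composition with `π` permutes the injective quadruples, so the average does not depend on `π`.
  have h1 : ∀ i : Fin n, (∑ q ∈ tuples 0 i, (term W i (π ∘ q) : ℚ)) =
      ((∑ q : Fin 4 → Fin n, if Function.Injective q then term W i q else 0 : ℤ) : ℚ) := by
    intro i
    rw [tuples_zero, Finset.sum_filter, ← ((Equiv.refl (Fin 4)).arrowCongr π).sum_comp
      (fun q => if Function.Injective q then term W i q else 0)]
    push_cast
    refine Finset.sum_congr rfl fun q _ => ?_
    have : ((Equiv.refl (Fin 4)).arrowCongr π) q = π ∘ q := rfl
    simp only [this, π.injective.of_comp_iff]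
  have hs := sum_min_gap W
  have hp := sum_injective_pair W
  have ht : (∑ a, ∑ b, if a ≠ b then W a b else 0) = total W := by
    refine Finset.sum_congr rfl fun a _ => Finset.sum_congr rfl fun b _ => ?_
    split_ifs with h
    · rfl
    · push Not at h
      rw [h, hW0]
  rw [ht] at hp
  have h2 : ∀ i : Fin n, (∑ q ∈ tuples 0 i, (term W i (π ∘ q) : ℚ)) =
      (n - 2) * (n - 3) * total W +
        if 4 ∣ (i : ℕ) ∧ (i : ℕ) + 3 < n then - (totalGap W : ℚ) / 2 else 0 := by
    intro i
    rw [h1]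
    have : (∑ q : Fin 4 → Fin n, if Function.Injective q then term W i q else 0) =
        (∑ q : Fin 4 → Fin n, if Function.Injective q then W (q 0) (q 1) else 0) +
        if 4 ∣ (i : ℕ) ∧ (i : ℕ) + 3 < n then ∑ q : Fin 4 → Fin n, (if Function.Injective q then
          min 0 (gap W (q 0) (q 1) (q 2) (q 3)) else 0) else 0 := by
      split_ifs with h
      · rw [← Finset.sum_add_distrib]
        refine Finset.sum_congr rfl fun q _ => ?_
        simp only [term, if_pos h]
        split_ifs <;> simp
      · simp [term, if_neg h]
    rw [this, hp]
    split_ifs with h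
    · have hs' : (2 : ℚ) * ((∑ q : Fin 4 → Fin n, (if Function.Injective q then
          min 0 (gap W (q 0) (q 1) (q 2) (q 3)) else 0) : ℤ) : ℚ) = - (totalGap W : ℚ) := by
        exact_mod_cast hs
      rw [Int.cast_add, ← hs']
      push_cast
      ring
    · push_cast
      ring
  have h3 : potential W 0 π = (∑ i : Fin n, ((n - 2) * (n - 3) * (total W : ℚ) +
        if 4 ∣ (i : ℕ) ∧ (i : ℕ) + 3 < n then - (totalGap W : ℚ) / 2 else 0)) /
        (n * (n - 1) * (n - 2) * (n - 3)) := by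
    rw [Finset.sum_div, potential]
    refine Finset.sum_congr rfl fun i _ => ?_
    rw [avg, h2, ← c, tuples_zero]
  rw [h3, Finset.sum_add_distrib, ← Finset.sum_filter]
  simp only [Finset.sum_const, nsmul_eq_mul, Finset.card_univ, Fintype.card_fin]
  rw [← blocks]
  have e0 : (n : ℚ) ≠ 0 := by positivity
  have e1 : (n : ℚ) - 1 ≠ 0 := by linarith
  have e2 : (n : ℚ) - 2 ≠ 0 := by linarith
  have e3 : (n : ℚ) - 3 ≠ 0 := by linarith
  field_simp
  ring

/-! ### Small shifted weightings from small gaps -/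

/-- The weighting `W` shifted at the vertices so as to become zero at `p`. -/
def shifted (W : Fin n → Fin n → ℤ) (p : Fin n) (c : ℤ) (a b : Fin n) : ℤ :=
  if a = b then 0 else
    W a b - (if a = p then c else W a p) - (if b = p then c else W b p) + c

/-- The total absolute value of the shifted weighting (over ordered pairs), with the constant
determined by `p`, `q` and `z`. -/
def spread (W : Fin n → Fin n → ℤ) (p q z : Fin n) : ℤ :=
  ∑ a, ∑ b, |shifted W p (W p q + W z p - W z q) a b|

/-- The absolute change of weight for distinct vertices. -/
def absGap (W : Fin n → Fin n → ℤ) (a b c d : Fin n) : ℤ :=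
  if Function.Injective ![a, b, c, d] then |gap W a b c d| else 0

theorem absGap_nonneg (W : Fin n → Fin n → ℤ) (a b c d : Fin n) : 0 ≤ absGap W a b c d := by
  rw [absGap]
  split_ifs
  · exact abs_nonneg _
  · exact le_rfl

theorem totalGap_eq (W : Fin n → Fin n → ℤ) :
    totalGap W = ∑ a, ∑ b, ∑ c, ∑ d, absGap W a b c d := by
  rw [totalGap, sum_fin_four]
  rfl

theorem absGap_eq (W : Fin n → Fin n → ℤ) {a b c d : Fin n} (h1 : a ≠ b) (h2 : a ≠ c)
    (h3 : a ≠ d) (h4 : b ≠ c) (h5 : b ≠ d) (h6 : c ≠ d) :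
    absGap W a b c d = |gap W a b c d| :=
  if_pos (injective_vec_four.2 ⟨⟨h1, h2, h3⟩, ⟨h4, h5⟩, h6⟩)

/-- For `x, y ≠ p` the shifted weight telescopes into `gap W x p y q + gap W y p q z`. If `y = z` or
`x = q`, one of these quadruples is not injective, but the other gap alone is the shifted weight. If
`y = q`, neither need count and `gap W x p q z` takes over. In the remaining coincidences the
shifted weight is zero. -/
theorem abs_shifted_le (W : Fin n → Fin n → ℤ) (hW : ∀ a b, W a b = W b a) {p q z : Fin n}
    (hpq : p ≠ q) (hpz : p ≠ z) (hqz : q ≠ z) (x y : Fin n) :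
    |shifted W p (W p q + W z p - W z q) x y| ≤
      absGap W x p y q + absGap W y p q z + if y = q then absGap W x p q z else 0 := by
  have n1 := absGap_nonneg W x p y q
  have n2 := absGap_nonneg W y p q z
  have n3 : 0 ≤ if y = q then absGap W x p q z else 0 := by
    split_ifs
    · exact absGap_nonneg _ _ _ _ _
    · exact le_rfl
  have z0 : shifted W p (W p q + W z p - W z q) x y = 0 →
    |shifted W p (W p q + W z p - W z q) x y| ≤
      absGap W x p y q + absGap W y p q z + if y = q then absGap W x p q z else 0 := by
    intro h
    rw [h, abs_zero]
    omega
  by_cases hxy : x = y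
  · exact z0 (by simp [shifted, hxy])
  by_cases hx : x = p
  · subst hx
    refine z0 ?_
    simp only [shifted, if_neg hxy, if_true, if_neg (Ne.symm hxy), hW y x]
    ring
  by_cases hy : y = p
  · subst hy
    refine z0 ?_
    simp only [shifted, if_neg hxy, if_true]
    ring
  have hs : shifted W p (W p q + W z p - W z q) x y =
      W x y - W x p - W y p + (W p q + W z p - W z q) := by
    simp only [shifted, if_neg hxy, if_neg hx, if_neg hy]
  by_cases hyq : y = q
  · subst hyq
    by_cases hxz : x = z
    · subst hxz
      refine z0 ?_
      rw [hs, hW y p]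
      ring
    · rw [if_pos rfl, absGap_eq W hx hxy hxz hpq hpz hqz] at *
      have : shifted W p (W p y + W z p - W z y) x y = gap W x p y z := by
        rw [hs, gap, hW y p, hW z p, hW z y]
        ring
      rw [this]
      omega
  · rw [if_neg hyq] at n3 ⊢
    by_cases hyz : y = z
    · subst hyz
      by_cases hxq : x = q
      · subst hxq
        have h0 : shifted W p (W p x + W y p - W y x) x y = 0 := by
          rw [hs, hW x y, hW x p]
          ring
        rw [h0, abs_zero]
        omega
      · rw [absGap_eq W hx hxy hxq (Ne.symm hy) hpq hyq] at *
        have : shifted W p (W p q + W y p - W y q) x y = gap W x p y q := by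
          rw [hs, gap]
          ring
        rw [this]
        omega
    · rw [absGap_eq W hy hyq hyz hpq hpz hqz] at *
      by_cases hxq : x = q
      · subst hxq
        have : shifted W p (W p x + W z p - W z x) x y = gap W y p x z := by
          rw [hs, gap, hW x y, hW x p, hW z p, hW z x]
          ring
        rw [this]
        omega
      · rw [absGap_eq W hx hxy hxq (Ne.symm hy) hpq hyq] at *
        have : shifted W p (W p q + W z p - W z q) x y = gap W x p y q + gap W y p q z := by
          rw [hs, gap, gap, hW z p, hW z q]
          ring
        rw [this]
        have := abs_add_le (gap W x p y q) (gap W y p q z)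
        omega

theorem sum_last_to_first {M : Type*} [AddCommMonoid M] (f : Fin n → Fin n → Fin n → Fin n → M) :
    ∑ p, ∑ q, ∑ z, ∑ y, f y p q z = ∑ y, ∑ p, ∑ q, ∑ z, f y p q z := by
  have h1 : ∀ p q, ∑ z, ∑ y, f y p q z = ∑ y, ∑ z, f y p q z := fun p q => Finset.sum_comm
  have h2 : ∀ p, ∑ q, ∑ y, ∑ z, f y p q z = ∑ y, ∑ q, ∑ z, f y p q z := fun p => Finset.sum_comm
  simp_rw [h1, h2]
  exact Finset.sum_comm

/-- Sum the previous bound over `x, y` and over all distinct `p, q, z`. The first term does not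
involve `z` and the second not `x`, so each gives `n * totalGap W`; the third has `y = q` and gives
`totalGap W`. Nonnegativity permits summing the right side over all triples. -/
theorem mul_le_totalGap (W : Fin n → Fin n → ℤ) (hW : ∀ a b, W a b = W b a) {s : ℤ}
    (hs : ∀ p q z, s ≤ spread W p q z) :
    n * (n - 1) * (n - 2) * s ≤ (2 * n + 1) * totalGap W := by
  have h1 : (∑ p : Fin n, ∑ q, ∑ z, if p ≠ q then if p ≠ z ∧ q ≠ z then s else 0 else 0) =
      n * (n - 1) * (n - 2) * s := by
    have e1 : ∀ p q : Fin n, (∑ z, if p ≠ q then if p ≠ z ∧ q ≠ z then s else 0 else 0) =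
        if p ≠ q then (n - 2) * s else 0 := by
      intro p q
      split_ifs with h
      · rw [sum_ite_ne_two h]
      · simp
    have e2 : ∀ p : Fin n, (∑ q, if p ≠ q then (n - 2) * s else 0) = (n - 1) * ((n - 2) * s) := by
      intro p
      rw [Finset.sum_ite, Finset.sum_const_zero, add_zero, Finset.sum_const, nsmul_eq_mul,
        Finset.filter_ne, Finset.card_erase_of_mem (Finset.mem_univ p), Finset.card_univ,
        Fintype.card_fin, Nat.cast_sub (Fin.pos p)]
      rfl
    simp only [e1, e2, Finset.sum_const, nsmul_eq_mul, Finset.card_univ, Fintype.card_fin]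
    ring
  have h2 : (∑ p : Fin n, ∑ q, ∑ _z : Fin n, ∑ x, ∑ y, absGap W x p y q) = n * totalGap W := by
    have e1 : ∀ p q : Fin n, ∑ x : Fin n, ∑ y : Fin n, absGap W x p y q =
        ∑ y : Fin n, ∑ x : Fin n, absGap W x p y q :=
      fun p q => Finset.sum_comm
    have e2 : ∀ p : Fin n, ∑ q : Fin n, ∑ y : Fin n, ∑ x : Fin n, absGap W x p y q =
        ∑ y : Fin n, ∑ q : Fin n, ∑ x : Fin n, absGap W x p y q :=
      fun p => Finset.sum_comm
    simp only [Finset.sum_const, nsmul_eq_mul, Finset.card_univ, Fintype.card_fin,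
      ← Finset.mul_sum, e1, e2]
    rw [sum_last_to_first fun x p y q => absGap W x p y q, totalGap_eq]
  have h3 : (∑ p : Fin n, ∑ q, ∑ z, ∑ _x : Fin n, ∑ y, absGap W y p q z) = n * totalGap W := by
    simp only [Finset.sum_const, nsmul_eq_mul, Finset.card_univ, Fintype.card_fin,
      ← Finset.mul_sum]
    rw [sum_last_to_first (absGap W), totalGap_eq]
  have h4 : (∑ p : Fin n, ∑ q, ∑ z, ∑ x, ∑ y, if y = q then absGap W x p q z else 0) =
      totalGap W := by
    simp only [Finset.sum_ite_eq', Finset.mem_univ, if_true]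
    rw [sum_last_to_first (absGap W), totalGap_eq]
  have h5 : (2 * n + 1) * totalGap W = n * totalGap W + n * totalGap W + totalGap W := by ring
  rw [h5, ← h1]
  nth_rewrite 1 [← h2]
  rw [← h3, ← h4]
  simp only [← Finset.sum_add_distrib]
  refine Finset.sum_le_sum fun p _ => Finset.sum_le_sum fun q _ => Finset.sum_le_sum fun z _ => ?_
  have hnn : 0 ≤ ∑ x, ∑ y, (absGap W x p y q + absGap W y p q z +
      if y = q then absGap W x p q z else 0) := by
    refine Finset.sum_nonneg fun x _ => Finset.sum_nonneg fun y _ => ?_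
    have n1 := absGap_nonneg W x p y q
    have n2 := absGap_nonneg W y p q z
    have n3 := absGap_nonneg W x p q z
    split_ifs <;> omega
  split_ifs with h h'
  · exact (hs p q z).trans (Finset.sum_le_sum fun x _ => Finset.sum_le_sum fun y _ =>
      abs_shifted_le W hW h h'.1 h'.2 x y)
  · exact hnn
  · exact hnn

/-- If the improved cycle does not beat the average by more than `k`, then the smallest shifted
weighting is small. -/
theorem spread_le (hn : 4 ≤ n) (W : Fin n → Fin n → ℤ) (hW : ∀ a b, W a b = W b a)
    (hW0 : ∀ a, W a a = 0) {k : ℕ} {h : ℤ} {π : Equiv.Perm (Fin n)}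
    (hh : (h : ℚ) ≤ potential W 0 π) (hk : total W ≤ (h + k) * (n - 1)) {s : ℤ}
    (hs : ∀ p q z, s ≤ spread W p q z) : s ≤ 8000 * k * n := by
  have hm := mul_le_totalGap W hW hs
  have hB := le_blocks hn
  rw [potential_zero hn W hW0] at hh
  have hn' : (4 : ℚ) ≤ n := by exact_mod_cast hn
  have hk' : (total W : ℚ) / (n - 1) ≤ h + k := by
    rw [div_le_iff₀ (by linarith)]
    exact_mod_cast hk
  have hP : (0 : ℚ) < n * (n - 1) * (n - 2) :=
    mul_pos (mul_pos (by linarith) (by linarith)) (by linarith)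
  -- The mean `d n` is at most `h + k` while `h` is at most the potential, so the gain term of the
  -- potential is at most `k`.
  have h1 : (blocks n : ℚ) * totalGap W ≤ 2 * (n * (n - 1) * (n - 2) * (n - 3)) * k := by
    have : (blocks n : ℚ) * totalGap W / (2 * (n * (n - 1) * (n - 2) * (n - 3))) ≤ k := by
      linarith
    rw [div_le_iff₀ (by have : (0 : ℚ) < n - 3 := by linarith
                        positivity)] at this
    linarith
  have hm' : (n * (n - 1) * (n - 2) : ℚ) * s ≤ (2 * n + 1) * totalGap W := by exact_mod_cast hm
  have hB' : (n : ℚ) ≤ 8 * blocks n := by exact_mod_cast hB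
  have hk0 : (0 : ℚ) ≤ k := by positivity
  have h2 : (blocks n : ℚ) * s ≤ (2 * n + 1) * (2 * (n - 3) * k) := by
    refine le_of_mul_le_mul_left ?_ hP
    calc (n * (n - 1) * (n - 2) : ℚ) * (blocks n * s)
        = blocks n * ((n * (n - 1) * (n - 2) : ℚ) * s) := by ring
      _ ≤ blocks n * ((2 * n + 1) * totalGap W) := by gcongr
      _ = (2 * n + 1) * (blocks n * totalGap W) := by ring
      _ ≤ (2 * n + 1) * (2 * (n * (n - 1) * (n - 2) * (n - 3)) * k) := by gcongr
      _ = _ := by ring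
  -- Only the case `s > 0` matters, and there `n ≤ 8 * blocks n` may be multiplied by `s`. The
  -- estimates would even give `s ≤ 32 * k * n`.
  by_contra hcon
  push Not at hcon
  have hcon' : (8000 * k * n : ℚ) < s := by exact_mod_cast hcon
  have hs0 : (0 : ℚ) < s := lt_of_le_of_lt (by positivity) hcon'
  have h3 : (n : ℚ) * s ≤ 8 * ((2 * n + 1) * (2 * (n - 3) * k)) := by nlinarith
  have h4 : (n : ℚ) * s ≤ n * (8000 * k * n) := by
    have : (0 : ℚ) ≤ k * n := by positivity
    have : (0 : ℚ) ≤ k * n * n := by positivity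
    nlinarith
  have := le_of_mul_le_mul_left h4 (by linarith)
  linarith

end Potential

section Cycles

variable {n : ℕ}

/-! ## Weights of Hamilton cycles -/

/-- The weight of the pair `a b`, which is zero if `a = b`. -/
def pairWeight (w : Weighting n) (a b : Fin n) : ℤ :=
  if h : a ≠ b then w ⟨s(a, b), by simpa using h⟩ else 0

theorem pairWeight_comm (w : Weighting n) (a b : Fin n) : pairWeight w a b = pairWeight w b a := by
  by_cases h : a = b
  · rw [h]
  · have h' : b ≠ a := Ne.symm h
    simp only [pairWeight, ne_eq, h, h', not_false_eq_true, dite_true]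
    congr 1
    exact Subtype.ext Sym2.eq_swap

theorem pairWeight_self (w : Weighting n) (a : Fin n) : pairWeight w a a = 0 := by
  simp [pairWeight]

theorem pairWeight_of_ne (w : Weighting n) {a b : Fin n} (h : (K n).Adj a b) :
    pairWeight w a b = w ⟨s(a, b), h⟩ :=
  dif_pos (by simpa using h)

theorem abs_pairWeight_le (w : Weighting n) (a b : Fin n) : |pairWeight w a b| ≤ maxAbs w := by
  rw [pairWeight]
  split_ifs
  · rw [Int.abs_eq_natAbs]
    exact_mod_cast Finset.le_sup (f := fun e : (K n).edgeSet => (w e).natAbs) (Finset.mem_univ _)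
  · simp

theorem sum_darts {V M : Type*} [AddCommMonoid M] {G : SimpleGraph V} (f : V → V → M) {u v : V}
    (c : G.Walk u v) : (c.darts.map fun d => f d.fst d.snd).sum =
      ∑ i ∈ Finset.range c.length, f (c.getVert i) (c.getVert (i + 1)) := by
  induction c with
  | nil => simp
  | cons h c ih =>
    rw [SimpleGraph.Walk.darts_cons, List.map_cons, List.sum_cons, ih,
      SimpleGraph.Walk.length_cons, Finset.sum_range_succ', add_comm]
    simp

/-- A subgraph counts an edge once, a walk as often as it is traversed; on a trail the two agree. -/
theorem weight_toSubgraph (w : Weighting n) {v : Fin n} (c : (K n).Walk v v) (hc : c.IsTrail) :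
    weight w c.toSubgraph =
      ∑ i ∈ Finset.range c.length, pairWeight w (c.getVert i) (c.getVert (i + 1)) := by
  classical
  rw [← sum_darts]
  set g : Sym2 (Fin n) → ℤ := fun e => if h : e ∈ (K n).edgeSet then w ⟨e, h⟩ else 0 with hg
  have h1 : (c.darts.map fun d => pairWeight w d.fst d.snd) = c.edges.map g := by
    rw [SimpleGraph.Walk.edges, List.map_map]
    refine List.map_congr_left fun d _ => ?_
    rw [pairWeight_of_ne w d.adj, Function.comp_apply, hg]
    simp only
    rw [dif_pos d.edge_mem]
    rfl
  rw [h1, ← List.sum_toFinset g hc.edges_nodup, weight]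
  have h2 : ∀ e : (K n).edgeSet, (if (e : Sym2 (Fin n)) ∈ c.toSubgraph.edgeSet then w e else 0) =
      if (e : Sym2 (Fin n)) ∈ c.edges.toFinset then g e else 0 := by
    intro e
    simp only [SimpleGraph.Walk.mem_edges_toSubgraph, List.mem_toFinset, hg]
    rw [dif_pos e.2]
  rw [Finset.sum_congr rfl fun e _ => h2 e, ← Finset.sum_filter]
  refine Finset.sum_nbij (fun e => (e : Sym2 (Fin n))) ?_ ?_ ?_ fun _ _ => rfl
  · intro e he
    exact (Finset.mem_filter.1 he).2
  · intro e _ e' _ h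
    exact Subtype.ext h
  · intro e he
    have he' : e ∈ c.edges := by simpa using he
    exact ⟨⟨e, c.edges_subset_edgeSet he'⟩, by simpa using he', rfl⟩

/-- Each edge is the image of two ordered pairs, and the diagonal contributes zero. -/
theorem two_mul_weight_top (w : Weighting n) : 2 * weight w ⊤ = total (pairWeight w) := by
  classical
  set g : Sym2 (Fin n) → ℤ := fun e => if h : e ∈ (K n).edgeSet then w ⟨e, h⟩ else 0 with hg
  have hpw : ∀ a b, pairWeight w a b = g s(a, b) := by
    intro a b
    by_cases h : a = b
    · simp [pairWeight, hg, h]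
    · have h' : (K n).Adj a b := by simpa using h
      rw [pairWeight_of_ne w h', hg]
      simp only
      rw [dif_pos (show s(a, b) ∈ (K n).edgeSet from h')]
  have h1 : weight w ⊤ = ∑ e, g e := by
    rw [weight, ← Finset.sum_subset (Finset.subset_univ
      (Finset.univ.filter fun e : Sym2 (Fin n) => e ∈ (K n).edgeSet))]
    · refine Finset.sum_nbij (fun e => (e : Sym2 (Fin n))) ?_ ?_ ?_ ?_
      · intro e _
        simpa using e.2
      · intro e _ e' _ h
        exact Subtype.ext h
      · intro e he
        exact ⟨⟨e, by simpa using he⟩, by simp, rfl⟩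
      · intro e _
        rw [if_pos (by
          rw [SimpleGraph.Subgraph.edgeSet_top]
          exact e.2), hg]
        simp only
        rw [dif_pos e.2]
    · intro e _ he
      rw [hg]
      simp only
      rw [dif_neg (by simpa using he)]
  rw [total, ← Fintype.sum_prod_type', ← Finset.sum_fiberwise (g := fun p => s(p.1, p.2)), h1,
    Finset.mul_sum]
  refine Finset.sum_congr rfl fun e _ => ?_
  induction e using Sym2.inductionOn with
  | _ x y =>
    by_cases hxy : x = y
    · subst hxy
      have : g s(x, x) = 0 := by rw [← hpw, pairWeight_self]
      rw [this, Finset.sum_eq_zero]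
      · rfl
      · intro p hp
        rw [hpw, (Finset.mem_filter.1 hp).2, this]
    · have : (Finset.univ.filter fun p : Fin n × Fin n => s(p.1, p.2) = s(x, y)) =
          {(x, y), (y, x)} := by
        ext ⟨a, b⟩
        simp [Prod.ext_iff]
      rw [this, Finset.sum_pair (by simp [hxy]), hpw, hpw, Sym2.eq_swap (a := y)]
      ring

theorem pairWeight_abs (w : Weighting n) (a b : Fin n) :
    pairWeight (fun e => |w e|) a b = |pairWeight w a b| := by
  simp only [pairWeight]
  split_ifs
  · rfl
  · simp

/-- The steps `1, …, n` of a Hamilton cycle visit each vertex exactly once; step `0` repeats step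
`n`. -/
theorem sum_getVert_succ {v : Fin n} {c : (K n).Walk v v} (hc : c.IsHamiltonianCycle)
    (F : Fin n → ℤ) : ∑ i ∈ Finset.range c.length, F (c.getVert (i + 1)) = ∑ a, F a := by
  have hl : c.length = n := by simpa using hc.length_eq
  have hinj : Set.InjOn (fun i => c.getVert (i + 1)) (Finset.range c.length) := by
    intro i hi j hj h
    rw [Finset.coe_range, Set.mem_Iio] at hi hj
    have := hc.isCycle.getVert_injOn (show i + 1 ∈ {i | 1 ≤ i ∧ i ≤ c.length} from by
      constructor <;> omega) (show j + 1 ∈ {i | 1 ≤ i ∧ i ≤ c.length} from by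
      constructor <;> omega) h
    omega
  have himg : (Finset.range c.length).image (fun i => c.getVert (i + 1)) = Finset.univ := by
    rw [← Finset.card_eq_iff_eq_univ, Finset.card_image_of_injOn hinj, Finset.card_range, hl,
      Fintype.card_fin]
  rw [← himg, Finset.sum_image hinj]

theorem sum_getVert {v : Fin n} {c : (K n).Walk v v} (hc : c.IsHamiltonianCycle)
    (F : Fin n → ℤ) : ∑ i ∈ Finset.range c.length, F (c.getVert i) = ∑ a, F a := by
  have h := Finset.sum_range_succ' (fun i => F (c.getVert i)) c.length
  rw [Finset.sum_range_succ, sum_getVert_succ hc] at h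
  simpa using h

/-- A Hamilton cycle has `n` edges, and every vertex lies on exactly two of them. -/
theorem weight_shift (w w' : Weighting n) (F : Fin n → ℤ) (c₀ : ℤ)
    (h : ∀ a b, a ≠ b → pairWeight w' a b = pairWeight w a b - F a - F b + c₀) {v : Fin n}
    {c : (K n).Walk v v} (hc : c.IsHamiltonianCycle) :
    weight w' c.toSubgraph = weight w c.toSubgraph + (n * c₀ - 2 * ∑ a, F a) := by
  have hl : c.length = n := by simpa using hc.length_eq
  rw [weight_toSubgraph w' c hc.isCycle.isTrail, weight_toSubgraph w c hc.isCycle.isTrail]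
  have h1 : ∀ i ∈ Finset.range c.length, pairWeight w' (c.getVert i) (c.getVert (i + 1)) =
      pairWeight w (c.getVert i) (c.getVert (i + 1)) - F (c.getVert i) - F (c.getVert (i + 1)) +
        c₀ := by
    intro i hi
    exact h _ _ (c.adj_getVert_succ (Finset.mem_range.1 hi)).ne
  rw [Finset.sum_congr rfl h1, Finset.sum_add_distrib, Finset.sum_sub_distrib,
    Finset.sum_sub_distrib, sum_getVert hc, sum_getVert_succ hc, Finset.sum_const,
    Finset.card_range, hl, nsmul_eq_mul]
  ring

/-- The weight of the cycle visiting the vertices in the order `π`. -/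
def cycleWeight (W : Fin n → Fin n → ℤ) (π : Equiv.Perm (Fin n)) : ℤ :=
  ∑ i, W (π i) (π (cyc i 1))

theorem exists_hamiltonianCycle (hn : 3 ≤ n) (w : Weighting n) (π : Equiv.Perm (Fin n)) :
    ∃ (v : Fin n) (c : (K n).Walk v v), c.IsHamiltonianCycle ∧
      (∀ i : Fin n, c.getVert i = π i) ∧ weight w c.toSubgraph = cycleWeight (pairWeight w) π := by
  obtain ⟨m, rfl⟩ : ∃ m, n = m + 3 := ⟨n - 3, by omega⟩
  -- The standard cycle of `cycleGraph` runs through the vertices downwards from `0`; negation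
  -- reverses it.
  let f : Fin (m + 3) ≃ Fin (m + 3) := (Equiv.neg _).trans π
  let φ : SimpleGraph.cycleGraph (m + 3) →g K (m + 3) :=
    ⟨f, fun h => by simpa using fun h' => h.ne (f.injective h')⟩
  set c := (SimpleGraph.cycleGraph.cycle m).map φ with hc
  have hham : c.IsHamiltonianCycle := by
    refine SimpleGraph.Walk.IsHamiltonianCycle.map f.bijective ?_
    rw [SimpleGraph.Walk.isHamiltonianCycle_iff_isCycle_and_length_eq]
    exact ⟨SimpleGraph.cycleGraph.isCycle_cycle, by simp [SimpleGraph.cycleGraph.length_cycle]⟩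
  have hv : ∀ i ≤ m + 3, c.getVert i = π ⟨i % (m + 3), Nat.mod_lt _ (by omega)⟩ := by
    intro i hi
    rw [hc, SimpleGraph.Walk.getVert_map, SimpleGraph.cycleGraph.getVert_cycle hi]
    change π (- _) = _
    congr 1
    ext
    rw [Fin.val_neg']
    simp only
    rcases Nat.eq_zero_or_pos i with rfl | h0
    · simp
    · rcases Nat.lt_or_ge i (m + 3) with h | h
      · rw [Nat.mod_eq_of_lt (show m + 3 - i < m + 3 by omega), Nat.mod_eq_of_lt h,
          Nat.mod_eq_of_lt (by omega)]
        omega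
      · obtain rfl : i = m + 3 := by omega
        simp
  refine ⟨_, c, hham, fun i => ?_, ?_⟩
  · rw [hv i (by omega)]
    congr 1
    exact Fin.ext (Nat.mod_eq_of_lt i.isLt)
  · rw [weight_toSubgraph w c hham.isCycle.isTrail, cycleWeight,
      show c.length = m + 3 by simpa using hham.length_eq, Finset.sum_range]
    refine Finset.sum_congr rfl fun i _ => ?_
    rw [hv i (by omega), hv (i + 1) (by omega)]
    congr 2
    exact Fin.ext (Nat.mod_eq_of_lt i.isLt)

/-! ## Improving the blocks -/

theorem cyc_zero (i : Fin n) : cyc i 0 = i := Fin.ext (Nat.mod_eq_of_lt i.isLt)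

theorem cyc_cyc (i : Fin n) (s t u : Fin 4) (h : (s : ℕ) + t = u) : cyc (cyc i s) t = cyc i u := by
  ext
  simp only [cyc, Nat.mod_add_mod, ← h, add_assoc]

theorem cyc_left_injective (t : Fin 4) : Function.Injective fun i : Fin n => cyc i t := by
  intro i j h
  simp only [cyc, Fin.mk.injEq] at h
  exact Fin.ext (Nat.ModEq.eq_of_lt_of_lt (Nat.ModEq.add_right_cancel' (t : ℕ) h) i.isLt j.isLt)

/-- Only the edges leaving positions `i`, `i + 1` and `i + 2` are affected, and by symmetry of `W`
the middle one keeps its weight. -/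
theorem cycleWeight_swap (hn : 4 ≤ n) (W : Fin n → Fin n → ℤ) (hW : ∀ a b, W a b = W b a)
    (π : Equiv.Perm (Fin n)) (i : Fin n) :
    cycleWeight W (π * Equiv.swap (cyc i 1) (cyc i 2)) =
      cycleWeight W π + gap W (π i) (π (cyc i 1)) (π (cyc i 2)) (π (cyc i 3)) := by
  have d : ∀ {s t : Fin 4}, s ≠ t → cyc i s ≠ cyc i t := fun h h' => h (cyc_injective hn i h')
  have d01 := d (s := 0) (t := 1) (by decide)
  have d02 := d (s := 0) (t := 2) (by decide)
  have d12 := d (s := 1) (t := 2) (by decide)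
  have d13 := d (s := 1) (t := 3) (by decide)
  have d23 := d (s := 2) (t := 3) (by decide)
  rw [cyc_zero] at d01 d02
  have s1 : cyc (cyc i 1) 1 = cyc i 2 := cyc_cyc i 1 1 2 rfl
  have s2 : cyc (cyc i 2) 1 = cyc i 3 := cyc_cyc i 2 1 3 rfl
  set f : Fin n → ℤ := fun x => W ((π * Equiv.swap (cyc i 1) (cyc i 2)) x)
    ((π * Equiv.swap (cyc i 1) (cyc i 2)) (cyc x 1)) - W (π x) (π (cyc x 1)) with hf
  have hsum : cycleWeight W (π * Equiv.swap (cyc i 1) (cyc i 2)) - cycleWeight W π =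
      ∑ x ∈ ({i, cyc i 1, cyc i 2} : Finset (Fin n)), f x := by
    rw [cycleWeight, cycleWeight, ← Finset.sum_sub_distrib]
    refine (Finset.sum_subset (Finset.subset_univ _) fun x _ hx => ?_).symm
    simp only [Finset.mem_insert, Finset.mem_singleton, not_or] at hx
    have n1 : cyc x 1 ≠ cyc i 1 := fun h => hx.1 (cyc_left_injective 1 h)
    have n2 : cyc x 1 ≠ cyc i 2 := fun h => hx.2.1 (cyc_left_injective 1 (h.trans s1.symm))
    simp only [Equiv.Perm.mul_apply]
    rw [Equiv.swap_apply_of_ne_of_ne hx.2.1 hx.2.2, Equiv.swap_apply_of_ne_of_ne n1 n2, sub_self]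
  rw [Finset.sum_insert (by simp [d01, d02]), Finset.sum_pair d12] at hsum
  simp only [hf, Equiv.Perm.mul_apply, s1, s2, Equiv.swap_apply_left, Equiv.swap_apply_right,
    Equiv.swap_apply_of_ne_of_ne d01 d02, Equiv.swap_apply_of_ne_of_ne d13.symm d23.symm] at hsum
  rw [gap]
  have := hW (π (cyc i 1)) (π (cyc i 2))
  linarith

/-- The gain at the block starting in position `i`. -/
def blockGain (W : Fin n → Fin n → ℤ) (π : Equiv.Perm (Fin n)) (i : Fin n) : ℤ :=
  if 4 ∣ (i : ℕ) ∧ (i : ℕ) + 3 < n then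
    min 0 (gap W (π i) (π (cyc i 1)) (π (cyc i 2)) (π (cyc i 3))) else 0

theorem sum_term (W : Fin n → Fin n → ℤ) (π : Equiv.Perm (Fin n)) :
    ∑ i, term W i (π ∘ cyc i) = cycleWeight W π + ∑ i, blockGain W π i := by
  rw [cycleWeight, ← Finset.sum_add_distrib]
  refine Finset.sum_congr rfl fun i _ => ?_
  simp only [term, blockGain, Function.comp_apply, cyc_zero]

/-- `σ` arises from `π` by improving the blocks that start in positions below `v`. -/
def ImprovedUpTo (W : Fin n → Fin n → ℤ) (π : Equiv.Perm (Fin n)) (v : ℕ)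
    (σ : Equiv.Perm (Fin n)) : Prop :=
  -- `4 * (p / 4)` is the start of the block of `p`: blocks starting at `v` or later are still
  -- untouched.
  (∀ p : Fin n, v ≤ 4 * ((p : ℕ) / 4) → σ p = π p) ∧
    cycleWeight W σ = cycleWeight W π +
      ∑ i : Fin n, if (i : ℕ) < v then blockGain W π i else 0

theorem ImprovedUpTo.zero (W : Fin n → Fin n → ℤ) (π : Equiv.Perm (Fin n)) :
    ImprovedUpTo W π 0 π := by
  simp [ImprovedUpTo]

theorem sum_ite_lt_succ (f : Fin n → ℤ) (v : Fin n) :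
    (∑ i : Fin n, if (i : ℕ) < v + 1 then f i else 0) =
      (∑ i : Fin n, if (i : ℕ) < v then f i else 0) + f v := by
  have : f v = ∑ i : Fin n, if i = v then f i else 0 := by simp
  rw [this, ← Finset.sum_add_distrib]
  refine Finset.sum_congr rfl fun i _ => ?_
  rcases lt_trichotomy (i : ℕ) v with h | h | h
  · have : i ≠ v := fun h' => by simp [h'] at h
    simp [h, this, Nat.lt_succ_of_lt h]
  · have := Fin.ext h
    subst this
    simp
  · have : i ≠ v := fun h' => by simp [h'] at h
    rw [if_neg (by omega), if_neg (by omega), if_neg this, add_zero]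

/-- The block at `v` still looks as in `π`, so the gap computed from `σ` is the one from `π`. The
exchange moves only the positions `v + 1` and `v + 2`, leaving later blocks alone. -/
theorem ImprovedUpTo.succ (hn : 4 ≤ n) {W : Fin n → Fin n → ℤ} (hW : ∀ a b, W a b = W b a)
    {π σ : Equiv.Perm (Fin n)} {v : Fin n} (h : ImprovedUpTo W π v σ) :
    ImprovedUpTo W π (v + 1)
      (if (4 ∣ (v : ℕ) ∧ (v : ℕ) + 3 < n) ∧
          gap W (σ v) (σ (cyc v 1)) (σ (cyc v 2)) (σ (cyc v 3)) < 0 then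
        σ * Equiv.swap (cyc v 1) (cyc v 2) else σ) := by
  obtain ⟨h1, h2⟩ := h
  by_cases hb : 4 ∣ (v : ℕ) ∧ (v : ℕ) + 3 < n
  · have hc : ∀ t : Fin 4, (cyc v t : ℕ) = v + t := fun t => Nat.mod_eq_of_lt (by omega)
    have e : ∀ t : Fin 4, σ (cyc v t) = π (cyc v t) := fun t => h1 _ (by rw [hc]; omega)
    have e0 := e 0
    rw [cyc_zero] at e0
    have hg : blockGain W π v =
        min 0 (gap W (σ v) (σ (cyc v 1)) (σ (cyc v 2)) (σ (cyc v 3))) := by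
      rw [blockGain, if_pos hb, e, e, e, e0]
    by_cases hgap : gap W (σ v) (σ (cyc v 1)) (σ (cyc v 2)) (σ (cyc v 3)) < 0
    · rw [if_pos ⟨hb, hgap⟩]
      refine ⟨fun p hp => ?_, ?_⟩
      · have c1 := hc 1
        have c2 := hc 2
        rw [Equiv.Perm.mul_apply, Equiv.swap_apply_of_ne_of_ne]
        · exact h1 p (by omega)
        · intro h
          rw [h, c1] at hp
          simp only [Fin.val_one] at hp
          omega
        · intro h
          rw [h, c2] at hp
          simp only [Fin.val_two] at hp
          omega
      · rw [cycleWeight_swap hn W hW, h2, sum_ite_lt_succ, hg, min_eq_right hgap.le]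
        ring
    · rw [if_neg fun h => hgap h.2]
      refine ⟨fun p hp => h1 p (by omega), ?_⟩
      rw [h2, sum_ite_lt_succ, hg, min_eq_left (not_lt.1 hgap), add_zero]
  · rw [if_neg fun h => hb h.1]
    refine ⟨fun p hp => h1 p (by omega), ?_⟩
    rw [h2, sum_ite_lt_succ, blockGain, if_neg hb, add_zero]

theorem ImprovedUpTo.cycleWeight_eq (hn : 4 ≤ n) {W : Fin n → Fin n → ℤ}
    {π σ : Equiv.Perm (Fin n)} (h : ImprovedUpTo W π n σ) :
    (cycleWeight W σ : ℚ) = potential W n π := by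
  rw [potential_top hn, sum_term, h.2]
  simp

end Cycles

open Ex

/-! ## Evaluation of expressions on memories holding the input -/

section Values

variable {n X : ℕ} {m : Mem}

/-- The expression `e` safely evaluates to `v`. -/
def Ex.Val (X : ℕ) (e : Ex) (m : Mem) (v : ℤ) : Prop := e.Safe X m ∧ e.eval m = v

/-- The expression `e` safely tests for `P`. -/
def Ex.Tests (X : ℕ) (e : Ex) (m : Mem) (P : Prop) : Prop := e.Safe X m ∧ (0 < e.eval m ↔ P)

theorem val_lit (z : ℤ) : (lit z).Val X m z := ⟨trivial, rfl⟩

theorem val_var {x : ℕ} {v : ℤ} (h : m.reg x = v) (hv : |v| ≤ X) : (var x).Val X m v :=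
  ⟨by simpa [Safe, h] using hv, h⟩

theorem val_var_nat {x v : ℕ} (h : m.reg x = v) (hv : v ≤ X) : (var x).Val X m v :=
  val_var h (by simpa using hv)

theorem val_cell {A : ℕ} {i : Ex} {a v : ℤ} (hi : i.Val X m a) (h : m.arr A a = v)
    (hv : |v| ≤ X) : (cell A i).Val X m v := by
  refine ⟨⟨hi.1, ?_⟩, ?_⟩
  · rwa [hi.2, h]
  · rw [eval, hi.2, h]

theorem val_add {a b : Ex} {u v : ℤ} (ha : a.Val X m u) (hb : b.Val X m v) :
    (add a b).Val X m (u + v) := ⟨⟨ha.1, hb.1⟩, by rw [eval, ha.2, hb.2]⟩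

theorem val_sub {a b : Ex} {u v : ℤ} (ha : a.Val X m u) (hb : b.Val X m v) :
    (sub a b).Val X m (u - v) := ⟨⟨ha.1, hb.1⟩, by rw [eval, ha.2, hb.2]⟩

theorem val_mul {a b : Ex} {u v : ℤ} (ha : a.Val X m u) (hb : b.Val X m v) :
    (mul a b).Val X m (u * v) := ⟨⟨ha.1, hb.1⟩, by rw [eval, ha.2, hb.2]⟩

theorem val_div {a b : Ex} {u v : ℤ} (ha : a.Val X m u) (hb : b.Val X m v) :
    (div a b).Val X m (u / v) := ⟨⟨ha.1, hb.1⟩, by rw [eval, ha.2, hb.2]⟩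

theorem val_ite {c a b : Ex} {P : Prop} [Decidable P] {u v : ℤ} (hc : c.Tests X m P)
    (ha : P → a.Val X m u) (hb : ¬ P → b.Val X m v) :
    (ite c a b).Val X m (if P then u else v) := by
  refine ⟨⟨hc.1, fun h => (ha (hc.2.1 h)).1, fun h => (hb fun hP => h (hc.2.2 hP)).1⟩, ?_⟩
  rw [eval]
  by_cases h : P
  · rw [if_pos h, if_pos (hc.2.2 h), (ha h).2]
  · rw [if_neg h, if_neg fun h' => h (hc.2.1 h'), (hb h).2]

theorem val_sum {x : ℕ} {e : Ex} {f : Fin n → ℤ} (h0 : m.reg 0 = n)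
    (h : ∀ v : Fin n, e.Val X (m.setReg x (v : ℕ)) (f v)) :
    (sum x e).Val X m (∑ v, f v) := by
  refine ⟨fun v hv => (h ⟨v, by omega⟩).1, ?_⟩
  rw [eval, show (m.reg 0).toNat = n by omega, Finset.sum_range]
  exact Finset.sum_congr rfl fun v _ => (h v).2

theorem val_amin {x : ℕ} {e : Ex} {f : Fin n → ℤ} (hn : 0 < n) (h0 : m.reg 0 = n)
    (h : ∀ v : Fin n, e.Val X (m.setReg x (v : ℕ)) (f v)) :
    ∃ u : Fin n, (amin x e).Val X m (u : ℕ) ∧ ∀ v, f u ≤ f v := by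
  have hr : (m.reg 0).toNat = n := by omega
  refine ⟨⟨argminBelow (fun v => e.eval (m.setReg x (v : ℤ))) n, argminBelow_lt _ hn⟩,
    ⟨fun v hv => (h ⟨v, by omega⟩).1, by rw [eval, hr]⟩, fun v => ?_⟩
  rw [← (h _).2, ← (h v).2]
  exact argminBelow_le (fun v : ℕ => e.eval (m.setReg x (v : ℤ))) v.isLt

theorem val_lett {x : ℕ} {a e : Ex} {u v : ℤ} (ha : a.Val X m u)
    (he : e.Val X (m.setReg x u) v) : (lett x a e).Val X m v := by
  refine ⟨⟨ha.1, ?_⟩, ?_⟩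
  · rw [ha.2]; exact he.1
  · rw [eval, ha.2]; exact he.2

/-- The test `a < b`. -/
def ltE (a b : Ex) : Ex := sub b a

/-- The test `a ≠ b`. -/
def neE (a b : Ex) : Ex := mul (sub a b) (sub a b)

/-- The test `a = b`. -/
def eqE (a b : Ex) : Ex := sub (lit 1) (neE a b)

/-- The conjunction of two tests. -/
def andE (c d : Ex) : Ex := ite c d (lit 0)

/-- The maximum. -/
def maxE (a b : Ex) : Ex := ite (ltE a b) b a

/-- The absolute value. -/
def absE (a : Ex) : Ex := ite a a (sub (lit 0) a)

theorem tests_lt {a b : Ex} {u v : ℤ} (ha : a.Val X m u) (hb : b.Val X m v) :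
    (ltE a b).Tests X m (u < v) := by
  have := val_sub hb ha
  exact ⟨this.1, by rw [ltE, this.2]; omega⟩

theorem tests_ne {a b : Ex} {u v : ℤ} (ha : a.Val X m u) (hb : b.Val X m v) :
    (neE a b).Tests X m (u ≠ v) := by
  have := val_mul (val_sub ha hb) (val_sub ha hb)
  refine ⟨this.1, ?_⟩
  rw [neE, this.2, ← sub_ne_zero]
  exact mul_self_pos

theorem tests_eq {a b : Ex} {u v : ℤ} (ha : a.Val X m u) (hb : b.Val X m v) :
    (eqE a b).Tests X m (u = v) := by
  have := val_sub (val_lit 1) (val_mul (val_sub ha hb) (val_sub ha hb))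
  refine ⟨this.1, ?_⟩
  rw [eqE, neE, this.2]
  constructor
  · intro h
    by_contra h'
    have := mul_self_pos.2 (sub_ne_zero.2 h')
    omega
  · rintro rfl
    simp

theorem Ex.Tests.congr {e : Ex} {P Q : Prop} (h : e.Tests X m P) (hPQ : P ↔ Q) :
    e.Tests X m Q := ⟨h.1, h.2.trans hPQ⟩

theorem tests_and {c d : Ex} {P Q : Prop} (hc : c.Tests X m P) (hd : d.Tests X m Q) :
    (andE c d).Tests X m (P ∧ Q) := by
  refine ⟨⟨hc.1, fun _ => hd.1, fun _ => trivial⟩, ?_⟩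
  rw [andE, eval, ← hc.2, ← hd.2]
  split_ifs with h <;> simp [h, eval]

theorem tests_ite {c a b : Ex} {P Q R : Prop} [Decidable P] (hc : c.Tests X m P)
    (ha : a.Tests X m Q) (hb : b.Tests X m R) :
    (ite c a b).Tests X m (if P then Q else R) := by
  refine ⟨⟨hc.1, fun _ => ha.1, fun _ => hb.1⟩, ?_⟩
  rw [eval]
  by_cases h : P
  · rw [if_pos h, if_pos (hc.2.2 h), ha.2]
  · rw [if_neg h, if_neg fun h' => h (hc.2.1 h'), hb.2]

theorem val_max {a b : Ex} {u v : ℤ} (ha : a.Val X m u) (hb : b.Val X m v) :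
    (maxE a b).Val X m (max u v) := by
  have := val_ite (tests_lt ha hb) (fun _ => hb) (fun _ => ha)
  refine ⟨this.1, this.2.trans ?_⟩
  split_ifs with h
  · rw [max_eq_right h.le]
  · rw [max_eq_left (not_lt.1 h)]

theorem val_abs {a : Ex} {u : ℤ} (ha : a.Val X m u) : (absE a).Val X m |u| := by
  have := val_ite (P := 0 < u) ⟨ha.1, by rw [ha.2]⟩ (fun _ => ha)
    (fun _ => val_sub (val_lit 0) ha)
  refine ⟨this.1, this.2.trans ?_⟩
  split_ifs with h
  · rw [abs_of_pos h]
  · rw [abs_of_nonpos (not_lt.1 h), zero_sub]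

/-- The weight of a pair of vertices. -/
def wE (a b : Ex) : Ex := ite (neE a b) (cell 0 (add (mul a (var 0)) b)) (lit 0)

/-- The memory contents `m` hold `n` and the weighting `w`, and `X` bounds all numbers involved. -/
structure Holds (X : ℕ) (w : Weighting n) (m : Mem) : Prop where
  reg_zero : m.reg 0 = n
  weights : m.HoldsWeighting 0 w
  four_le : 4 ≤ n
  le_bound : n ≤ X
  maxAbs_le : maxAbs w ≤ X

variable {w : Weighting n}

theorem Holds.setReg (h : Holds X w m) {x : ℕ} (hx : x ≠ 0) (v : ℤ) : Holds X w (m.setReg x v) :=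
  { h with
    reg_zero := by rw [Mem.setReg_reg_of_ne _ _ hx.symm, h.reg_zero]
    weights := h.weights }

theorem Holds.val_n (h : Holds X w m) : (var 0).Val X m n := val_var_nat h.reg_zero h.le_bound

theorem Holds.val_fin (h : Holds X w m) {x : ℕ} {v : Fin n} (hx : m.reg x = (v : ℕ)) :
    (var x).Val X m (v : ℕ) := val_var_nat hx (v.isLt.le.trans h.le_bound)

/-- Diagonal cells of the input array are arbitrary and possibly huge. The conditional avoids
reading them, and safety of `ite` concerns only the branch taken. -/
theorem Holds.val_w (h : Holds X w m) {a b : Ex} {x y : Fin n} (ha : a.Val X m (x : ℕ))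
    (hb : b.Val X m (y : ℕ)) : (wE a b).Val X m (pairWeight w x y) := by
  have := val_ite (tests_ne ha hb) (u := pairWeight w x y) (v := 0)
    (fun hne => val_cell (val_add (val_mul ha h.val_n) hb) (A := 0) ?_ ?_) fun _ => val_lit 0
  · refine ⟨this.1, this.2.trans ?_⟩
    split_ifs with hxy
    · rfl
    · have : x = y := Fin.ext (by omega)
      rw [this, pairWeight_self]
  · have hadj : (K n).Adj x y := fun h' => hne (by rw [h'])
    rw [h.weights x y hadj, pairWeight_of_ne w hadj]
  · exact (abs_pairWeight_le w x y).trans (by exact_mod_cast h.maxAbs_le)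

/-- The position `i + t`, cyclically. -/
def posE (i : Ex) (t : ℤ) : Ex :=
  ite (ltE (add i (lit t)) (var 0)) (add i (lit t)) (sub (add i (lit t)) (var 0))

/-- As `t < 4 ≤ n`, reduction modulo `n` takes at most one subtraction. -/
theorem Holds.val_pos (h : Holds X w m) {a : Ex} {i : Fin n} (ha : a.Val X m (i : ℕ))
    (t : Fin 4) : (posE a (t : ℕ)).Val X m (cyc i t : ℕ) := by
  have := val_ite (tests_lt (val_add ha (val_lit (t : ℕ))) h.val_n)
    (fun _ => val_add ha (val_lit (t : ℕ)))
    (fun _ => val_sub (val_add ha (val_lit (t : ℕ))) h.val_n)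
  refine ⟨this.1, this.2.trans ?_⟩
  have h4 := h.four_le
  have hi := i.isLt
  have ht := t.isLt
  simp only [cyc]
  split_ifs with hlt
  · rw [Nat.mod_eq_of_lt (by omega)]
    push_cast
    rfl
  · rw [Nat.mod_eq_sub_mod (by omega), Nat.mod_eq_of_lt (by omega)]
    omega

/-- The gain from reordering a path `a b c d`. -/
def gapE (a b c d : Ex) : Ex := sub (sub (add (wE a c) (wE b d)) (wE a b)) (wE c d)

theorem Holds.val_gap (h : Holds X w m) {a b c d : Ex} {x y z u : Fin n}
    (ha : a.Val X m (x : ℕ)) (hb : b.Val X m (y : ℕ)) (hc : c.Val X m (z : ℕ))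
    (hd : d.Val X m (u : ℕ)) : (gapE a b c d).Val X m (gap (pairWeight w) x y z u) :=
  val_sub (val_sub (val_add (h.val_w ha hc) (h.val_w hb hd)) (h.val_w ha hb)) (h.val_w hc hd)

/-- The test whether a block starts in position `i`. -/
def blockE (i : Ex) : Ex :=
  andE (eqE (mul (div i (lit 4)) (lit 4)) i) (ltE (add i (lit 3)) (var 0))

theorem Holds.tests_block (h : Holds X w m) {a : Ex} {i : Fin n} (ha : a.Val X m (i : ℕ)) :
    (blockE a).Tests X m (4 ∣ (i : ℕ) ∧ (i : ℕ) + 3 < n) := by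
  refine (tests_and (tests_eq (val_mul (val_div ha (val_lit 4)) (val_lit 4)) ha)
    (tests_lt (val_add ha (val_lit 3)) h.val_n)).congr ?_
  constructor <;> rintro ⟨h1, h2⟩ <;> constructor <;> omega

/-- The contribution of a position and the three following ones to the weight of the cycle. -/
def termE (i a b c d : Ex) : Ex :=
  add (wE a b) (ite (blockE i) (ite (ltE (gapE a b c d) (lit 0)) (gapE a b c d) (lit 0)) (lit 0))

theorem Holds.val_term (h : Holds X w m) {e a b c d : Ex} {i : Fin n} {x : Fin 4 → Fin n}
    (he : e.Val X m (i : ℕ)) (ha : a.Val X m (x 0 : ℕ)) (hb : b.Val X m (x 1 : ℕ))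
    (hc : c.Val X m (x 2 : ℕ)) (hd : d.Val X m (x 3 : ℕ)) :
    (termE e a b c d).Val X m (term (pairWeight w) i x) := by
  have hg := h.val_gap ha hb hc hd
  have := val_add (h.val_w ha hb) (val_ite (h.tests_block he)
    (fun _ => val_ite (tests_lt hg (val_lit 0)) (fun _ => hg) (fun _ => val_lit 0))
    (fun _ => val_lit 0))
  refine ⟨this.1, this.2.trans ?_⟩
  rw [term]
  congr 2
  split_ifs with hlt
  · rw [min_eq_right hlt.le]
  · rw [min_eq_left (not_lt.1 hlt)]

/-- The test whether the position `q` may take the place of the position `p`, when the positions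
up to `j` are fixed. -/
def fixedE (j p q : Ex) : Ex := ite (ltE j p) (ltE j q) (eqE q p)

theorem tests_fixed {a b c : Ex} {j p q : Fin n} (ha : a.Val X m (j : ℕ)) (hb : b.Val X m (p : ℕ))
    (hc : c.Val X m (q : ℕ)) :
    (fixedE a b c).Tests X m (if (j : ℕ) + 1 ≤ p then (j : ℕ) + 1 ≤ q else q = p) := by
  refine (tests_ite (tests_lt ha hb) (tests_lt ha hc) (tests_eq hc hb)).congr ?_
  split_ifs <;> (try rw [Fin.ext_iff]) <;> omega

/-- The test for membership in `tuples (j + 1) i`. -/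
def tupleE (j i a b c d : Ex) : Ex :=
  andE (andE (andE (neE a b) (andE (neE a c) (neE a d)))
      (andE (andE (neE b c) (neE b d)) (neE c d)))
    (andE (fixedE j (posE i 0) a) (andE (fixedE j (posE i 1) b)
      (andE (fixedE j (posE i 2) c) (fixedE j (posE i 3) d))))

theorem Holds.tests_tuple (h : Holds X w m) {f e a b c d : Ex} {j i x y z u : Fin n}
    (hf : f.Val X m (j : ℕ)) (he : e.Val X m (i : ℕ)) (ha : a.Val X m (x : ℕ))
    (hb : b.Val X m (y : ℕ)) (hc : c.Val X m (z : ℕ)) (hd : d.Val X m (u : ℕ)) :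
    (tupleE f e a b c d).Tests X m (![x, y, z, u] ∈ tuples ((j : ℕ) + 1) i) := by
  refine (tests_and (tests_and (tests_and (tests_ne ha hb) (tests_and (tests_ne ha hc)
    (tests_ne ha hd))) (tests_and (tests_and (tests_ne hb hc) (tests_ne hb hd))
    (tests_ne hc hd))) (tests_and (tests_fixed hf (h.val_pos he 0) ha)
    (tests_and (tests_fixed hf (h.val_pos he 1) hb) (tests_and (tests_fixed hf (h.val_pos he 2) hc)
    (tests_fixed hf (h.val_pos he 3) hd))))).congr ?_
  have hne : ∀ s t : Fin n, ((s : ℕ) : ℤ) ≠ (t : ℕ) ↔ s ≠ t := fun s t => by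
    rw [ne_eq, ne_eq, Fin.ext_iff, Nat.cast_inj]
  simp only [tuples, Finset.mem_filter, Finset.mem_univ, true_and, injective_vec_four, hne]
  rw [Fin.forall_fin_succ, Fin.forall_fin_succ, Fin.forall_fin_succ, Fin.forall_fin_succ]
  simp only [IsEmpty.forall_iff, and_true]
  rfl

/-- The position `q` after the positions `j` and `v` are swapped. -/
def swapE (j v q : Ex) : Ex := ite (eqE q j) v (ite (eqE q v) j q)

theorem val_swap {a b c : Ex} {j v q : Fin n} (ha : a.Val X m (j : ℕ)) (hb : b.Val X m (v : ℕ))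
    (hc : c.Val X m (q : ℕ)) : (swapE a b c).Val X m (Equiv.swap j v q : ℕ) := by
  have := val_ite (tests_eq hc ha) (fun _ => hb)
    (fun _ => val_ite (tests_eq hc hb) (fun _ => ha) (fun _ => hc))
  refine ⟨this.1, this.2.trans ?_⟩
  rw [Equiv.swap_apply_def]
  simp only [Fin.ext_iff, Nat.cast_inj]
  split_ifs <;> rfl

/-- Array `1` holds the permutation `π`. -/
def HoldsPerm (m : Mem) (π : Equiv.Perm (Fin n)) : Prop :=
  ∀ p : Fin n, m.arr 1 (p : ℕ) = (π p : ℕ)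

theorem Holds.val_perm (h : Holds X w m) {π : Equiv.Perm (Fin n)} (hπ : HoldsPerm m π) {a : Ex}
    {p : Fin n} (ha : a.Val X m (p : ℕ)) : (cell 1 a).Val X m (π p : ℕ) :=
  val_cell ha (hπ p) (by
    rw [Nat.abs_cast]
    exact_mod_cast (π p).isLt.le.trans h.le_bound)

/-- The common multiple of the numbers of tuples. -/
def multE (r : Ex) : Ex :=
  mul (mul (mul (maxE r (lit 1)) (maxE (sub r (lit 1)) (lit 1))) (maxE (sub r (lit 2)) (lit 1)))
    (maxE (sub r (lit 3)) (lit 1))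

theorem val_mult {a : Ex} {r : ℕ} (ha : a.Val X m r) : (multE a).Val X m (commonMult r : ℕ) := by
  have := val_mul (val_mul (val_mul (val_max ha (val_lit 1))
    (val_max (val_sub ha (val_lit 1)) (val_lit 1))) (val_max (val_sub ha (val_lit 2)) (val_lit 1)))
    (val_max (val_sub ha (val_lit 3)) (val_lit 1))
  refine ⟨this.1, this.2.trans ?_⟩
  have e : ∀ s : ℕ, max ((r : ℤ) - s) 1 = (max (r - s) 1 : ℕ) := fun s => by omega
  have e0 := e 0
  have e1 := e 1
  have e2 := e 2
  have e3 := e 3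
  push_cast at e0 e1 e2 e3
  rw [sub_zero] at e0
  rw [commonMult, Finset.prod_range_succ, Finset.prod_range_succ, Finset.prod_range_succ,
    Finset.prod_range_succ, Finset.prod_range_zero]
  push_cast
  rw [e0, e1, e2, e3]
  ring

/-- The sum of an expression in four positions over `tuples (j + 1) i`, where `j` is in register
`2` and `i` in register `30`. -/
def tupleSumE (e : Ex) : Ex :=
  sum 40 (sum 50 (sum 60 (sum 70
    (ite (tupleE (var 2) (var 30) (var 40) (var 50) (var 60) (var 70)) e (lit 0)))))

theorem setReg_reg_ne (m : Mem) {x y : ℕ} {v u : ℤ} (h : m.reg y = u) (hxy : y ≠ x) :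
    (m.setReg x v).reg y = u := by rw [Mem.setReg_reg_of_ne _ _ hxy, h]

/-- The four coordinates run in registers `40`, `50`, `60`, `70`; the spaces between them hold
partial results pending during the inner loops. -/
theorem Holds.val_tupleSum (h : Holds X w m) {e : Ex} {j i : Fin n}
    (hj : m.reg 2 = (j : ℕ)) (hi : m.reg 30 = (i : ℕ)) {f : (Fin 4 → Fin n) → ℤ}
    (he : ∀ a b c d : Fin n, e.Val X ((((m.setReg 40 (a : ℕ)).setReg 50 (b : ℕ)).setReg 60
      (c : ℕ)).setReg 70 (d : ℕ)) (f ![a, b, c, d])) :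
    (tupleSumE e).Val X m (∑ q ∈ tuples ((j : ℕ) + 1) i, f q) := by
  have hsum : ∑ q ∈ tuples ((j : ℕ) + 1) i, f q = ∑ a, ∑ b, ∑ c, ∑ d,
      if ![a, b, c, d] ∈ tuples ((j : ℕ) + 1) i then f ![a, b, c, d] else 0 := by
    rw [← sum_fin_four (fun q => if q ∈ tuples ((j : ℕ) + 1) i then f q else 0),
      ← Finset.sum_filter]
    congr 1
    ext q
    simp
  rw [hsum]
  refine val_sum h.reg_zero fun a => ?_
  have h1 := h.setReg (x := 40) (by decide) (a : ℕ)
  refine val_sum h1.reg_zero fun b => ?_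
  have h2 := h1.setReg (x := 50) (by decide) (b : ℕ)
  refine val_sum h2.reg_zero fun c => ?_
  have h3 := h2.setReg (x := 60) (by decide) (c : ℕ)
  refine val_sum h3.reg_zero fun d => ?_
  have h4 := h3.setReg (x := 70) (by decide) (d : ℕ)
  refine val_ite (h4.tests_tuple (h4.val_fin ?_) (h4.val_fin ?_) (h4.val_fin ?_) (h4.val_fin ?_)
    (h4.val_fin ?_) (h4.val_fin ?_)) (fun _ => he a b c d) (fun _ => val_lit 0) <;>
  simp [Mem.setReg_reg, hj, hi]

/-- The vertex in position `q` after the positions in register `2` and `v` are swapped. -/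
def vertexE (v : Ex) (q : ℕ) : Ex := cell 1 (swapE (var 2) v (var q))

/-- The candidate for the next swap. -/
def candE (u : ℕ) : Ex := maxE (var u) (var 2)

/-- The potential after a swap, scaled to be an integer. -/
def potentialE (u : ℕ) : Ex :=
  sum 30 (mul (div (multE (sub (sub (var 0) (lit 1)) (var 2))) (tupleSumE (lit 1)))
    (tupleSumE (termE (var 30) (vertexE (candE u) 40) (vertexE (candE u) 50)
      (vertexE (candE u) 60) (vertexE (candE u) 70))))

theorem Holds.val_cand (h : Holds X w m) {j u : Fin n} {x : ℕ} (hj : m.reg 2 = (j : ℕ))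
    (hu : m.reg x = (u : ℕ)) : (candE x).Val X m (max u j : Fin n) := by
  have := val_max (h.val_fin hu) (h.val_fin hj)
  refine ⟨this.1, this.2.trans ?_⟩
  rcases le_total u j with h | h
  · rw [max_eq_right h, max_eq_right (by exact_mod_cast h)]
  · rw [max_eq_left h, max_eq_left (by exact_mod_cast h)]

/-- The scaling factor is positive and independent of the candidate `u`, so the integer `s` and the
potential have the same minimisers. -/
theorem Holds.val_potential (h : Holds X w m) {π : Equiv.Perm (Fin n)} (hπ : HoldsPerm m π)
    {j u : Fin n} (hj : m.reg 2 = (j : ℕ)) (hu : m.reg 20 = (u : ℕ)) :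
    ∃ s : ℤ, (potentialE 20).Val X m s ∧ (s : ℚ) = commonMult (n - (j + 1)) *
      potential (pairWeight w) (j + 1) (π * Equiv.swap j (max u j)) := by
  refine ⟨_, val_sum h.reg_zero (f := fun i => (commonMult (n - (j + 1)) : ℤ) /
    (∑ q ∈ tuples ((j : ℕ) + 1) i, 1) * ∑ q ∈ tuples ((j : ℕ) + 1) i,
    term (pairWeight w) i ((π * Equiv.swap j (max u j) : Equiv.Perm (Fin n)) ∘ q)) fun i => ?_, ?_⟩
  · have h1 := h.setReg (x := 30) (by decide) (i : ℕ)
    have hj1 : (m.setReg 30 (i : ℕ)).reg 2 = (j : ℕ) := setReg_reg_ne m hj (by decide)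
    have hu1 : (m.setReg 30 (i : ℕ)).reg 20 = (u : ℕ) := setReg_reg_ne m hu (by decide)
    refine val_mul (val_div (val_mult ?_) (h1.val_tupleSum hj1 (by simp) fun _ _ _ _ => val_lit 1))
      (h1.val_tupleSum hj1 (by simp) fun a b c d => ?_)
    · have := val_sub (val_sub h1.val_n (val_lit 1)) (h1.val_fin hj1)
      refine ⟨this.1, this.2.trans ?_⟩
      have := j.isLt
      omega
    · have h2 := (((h1.setReg (x := 40) (by decide) (a : ℕ)).setReg (x := 50) (by decide)
        (b : ℕ)).setReg (x := 60) (by decide) (c : ℕ)).setReg (x := 70) (by decide) (d : ℕ)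
      set m' := ((((m.setReg 30 (i : ℕ)).setReg 40 (a : ℕ)).setReg 50 (b : ℕ)).setReg 60
        (c : ℕ)).setReg 70 (d : ℕ) with hm'
      have hj2 : m'.reg 2 = (j : ℕ) := by simp [hm', Mem.setReg_reg, hj]
      have hu2 : m'.reg 20 = (u : ℕ) := by simp [hm', Mem.setReg_reg, hu]
      have hπ2 : HoldsPerm m' π := hπ
      have hv : ∀ {x : ℕ} {q : Fin n}, m'.reg x = (q : ℕ) →
          (vertexE (candE 20) x).Val X m' (π (Equiv.swap j (max u j) q) : ℕ) := fun hx =>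
        h2.val_perm hπ2 (val_swap (h2.val_fin hj2) (h2.val_cand hj2 hu2) (h2.val_fin hx))
      refine h2.val_term (x := (π * Equiv.swap j (max u j) : Equiv.Perm (Fin n)) ∘ ![a, b, c, d])
        (h2.val_fin ?_) (hv ?_) (hv ?_) (hv ?_) (hv ?_) <;> simp [hm', Mem.setReg_reg]
  · rw [potential, Finset.mul_sum]
    push_cast
    refine Finset.sum_congr rfl fun i _ => ?_
    -- Divisibility makes the rounding division of the machine exact.
    have hdvd : ((tuples ((j : ℕ) + 1) i).card : ℤ) ∣ (commonMult (n - (j + 1)) : ℤ) := by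
      exact_mod_cast card_tuples_dvd h.four_le (j + 1) i
    have hpos : ((tuples ((j : ℕ) + 1) i).card : ℚ) ≠ 0 := by
      exact_mod_cast (card_tuples_pos h.four_le (j + 1) i).ne'
    rw [Finset.sum_const, nsmul_eq_mul, mul_one, Int.cast_div hdvd (by exact_mod_cast hpos), avg]
    push_cast
    ring

end Values

open Ex

/-! ### Expressions minimising the spread -/

section Spread

variable {n X : ℕ} {m : Mem} {w : Weighting n}

/-- The shift at the vertex `a`. -/
def shiftE (p c a : Ex) : Ex := ite (eqE a p) c (wE a p)

/-- The shifted weighting. -/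
def shiftedE (p c a b : Ex) : Ex :=
  ite (neE a b) (add (sub (sub (wE a b) (shiftE p c a)) (shiftE p c b)) c) (lit 0)

/-- The constant determined by `p`, `q` and `z`. -/
def constE (p q z : Ex) : Ex := sub (add (wE p q) (wE z p)) (wE z q)

theorem Holds.val_shift (h : Holds X w m) {e f a : Ex} {p x : Fin n} {c : ℤ}
    (he : e.Val X m (p : ℕ)) (hf : f.Val X m c) (ha : a.Val X m (x : ℕ)) :
    (shiftE e f a).Val X m (if x = p then c else pairWeight w x p) := by
  have := val_ite (tests_eq ha he) (fun _ => hf) (fun _ => h.val_w ha he)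
  refine ⟨this.1, this.2.trans ?_⟩
  simp only [Fin.ext_iff, Nat.cast_inj]

theorem Holds.val_shifted (h : Holds X w m) {e f a b : Ex} {p x y : Fin n} {c : ℤ}
    (he : e.Val X m (p : ℕ)) (hf : f.Val X m c) (ha : a.Val X m (x : ℕ))
    (hb : b.Val X m (y : ℕ)) : (shiftedE e f a b).Val X m (shifted (pairWeight w) p c x y) := by
  have := val_ite (tests_ne ha hb) (fun _ => val_add (val_sub (val_sub (h.val_w ha hb)
    (h.val_shift he hf ha)) (h.val_shift he hf hb)) hf) (fun _ => val_lit 0)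
  refine ⟨this.1, this.2.trans ?_⟩
  rw [shifted]
  simp only [ne_eq, ite_not, Nat.cast_inj, Fin.ext_iff]

theorem Holds.val_const (h : Holds X w m) {e f g : Ex} {p q z : Fin n} (he : e.Val X m (p : ℕ))
    (hf : f.Val X m (q : ℕ)) (hg : g.Val X m (z : ℕ)) : (constE e f g).Val X m
      (pairWeight w p q + pairWeight w z p - pairWeight w z q) :=
  val_sub (val_add (h.val_w he hf) (h.val_w hg he)) (h.val_w hg hf)

/-- The total absolute value of the shifted weighting determined by three registers. -/
def spreadE (p q z : ℕ) : Ex :=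
  sum 70 (sum 80 (absE (shiftedE (var p) (constE (var p) (var q) (var z)) (var 70) (var 80))))

theorem Holds.val_spread (h : Holds X w m) {a b c : ℕ} {p q z : Fin n} (ha : a < 70)
    (hb : b < 70) (hc : c < 70) (hp : m.reg a = (p : ℕ)) (hq : m.reg b = (q : ℕ))
    (hz : m.reg c = (z : ℕ)) : (spreadE a b c).Val X m (spread (pairWeight w) p q z) := by
  refine val_sum h.reg_zero fun x => ?_
  have h1 := h.setReg (x := 70) (by decide) (x : ℕ)
  refine val_sum h1.reg_zero fun y => val_abs ?_
  have h2 := h1.setReg (x := 80) (by decide) (y : ℕ)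
  have e : ∀ {d : ℕ} {v : Fin n}, d < 70 → m.reg d = (v : ℕ) →
      (var d).Val X ((m.setReg 70 (x : ℕ)).setReg 80 (y : ℕ)) (v : ℕ) := by
    intro d v hd hv
    exact h2.val_fin (setReg_reg_ne _ (setReg_reg_ne _ hv (by omega)) (by omega))
  exact h2.val_shifted (e ha hp) (h2.val_const (e ha hp) (e hb hq) (e hc hz))
    (h2.val_fin (by simp [Mem.setReg_reg])) (h2.val_fin (by simp))

/-- The minimum of the spread over the last parameter. -/
def minSpreadE (p q : ℕ) : Ex := lett 50 (amin 60 (spreadE p q 60)) (spreadE p q 50)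

/-- `amin` yields a minimiser rather than the minimum, so the spread is evaluated once more at the
register bound by `lett`. -/
theorem Holds.val_minSpread (h : Holds X w m) {a b : ℕ} {p q : Fin n} (ha : a < 50)
    (hb : b < 50) (hp : m.reg a = (p : ℕ)) (hq : m.reg b = (q : ℕ)) :
    ∃ z, (minSpreadE a b).Val X m (spread (pairWeight w) p q z) ∧
      ∀ z', spread (pairWeight w) p q z ≤ spread (pairWeight w) p q z' := by
  obtain ⟨z, hz, hmin⟩ := val_amin (x := 60) (e := spreadE a b 60)
    (f := spread (pairWeight w) p q) (Fin.pos p) h.reg_zero fun v =>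
    (h.setReg (x := 60) (by decide) (v : ℕ)).val_spread (by omega) (by omega) (by omega)
      (setReg_reg_ne m hp (by omega)) (setReg_reg_ne m hq (by omega)) (by simp)
  refine ⟨z, val_lett hz ?_, hmin⟩
  exact (h.setReg (x := 50) (by decide) (z : ℕ)).val_spread (by omega) (by omega) (by omega)
    (setReg_reg_ne m hp (by omega)) (setReg_reg_ne m hq (by omega)) (by simp)

/-- The minimum of the spread over the last two parameters. -/
def minMinSpreadE (p : ℕ) : Ex := lett 30 (amin 40 (minSpreadE p 40)) (minSpreadE p 30)

theorem Holds.val_minMinSpread (h : Holds X w m) {a : ℕ} {p : Fin n} (ha : a < 30)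
    (hp : m.reg a = (p : ℕ)) :
    ∃ q z, (minMinSpreadE a).Val X m (spread (pairWeight w) p q z) ∧
      ∀ q' z', spread (pairWeight w) p q z ≤ spread (pairWeight w) p q' z' := by
  have h1 : ∀ q : Fin n, ∃ z, (minSpreadE a 40).Val X (m.setReg 40 (q : ℕ))
      (spread (pairWeight w) p q z) ∧
      ∀ z', spread (pairWeight w) p q z ≤ spread (pairWeight w) p q z' := fun q =>
    (h.setReg (x := 40) (by decide) (q : ℕ)).val_minSpread (by omega) (by omega)
      (setReg_reg_ne m hp (by omega)) (by simp)
  choose f hf hmin using h1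
  obtain ⟨q, hq, hqmin⟩ := val_amin (Fin.pos p) h.reg_zero hf
  obtain ⟨z, hz, hzmin⟩ := (h.setReg (x := 30) (by decide) (q : ℕ)).val_minSpread
    (a := a) (b := 30) (p := p) (q := q) (by omega) (by omega) (setReg_reg_ne m hp (by omega))
    (by simp)
  exact ⟨q, z, val_lett hq hz, fun q' z' =>
    (hzmin (f q)).trans ((hqmin q').trans (hmin q' z'))⟩

end Spread

/-! ## Statements -/

section Statements

variable {n X B : ℕ} {m : Mem} {w : Weighting n}

/-- `m'` agrees with `m` in the registers below `12` and in the arrays. -/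
def Agree (m m' : Mem) : Prop := (∀ x < 12, m'.reg x = m.reg x) ∧ m'.arr = m.arr

theorem Agree.reg {m' : Mem} (h : Agree m m') {x : ℕ} (hx : x < 12) : m'.reg x = m.reg x :=
  h.1 x hx

theorem Agree.holds {m' : Mem} (h : Agree m m') (hm : Holds X w m) : Holds X w m' :=
  { hm with
    reg_zero := by rw [h.reg (by decide), hm.reg_zero]
    weights := fun i j hij => by rw [h.2]; exact hm.weights i j hij }

theorem Agree.holdsPerm {m' : Mem} (h : Agree m m') {π : Equiv.Perm (Fin n)}
    (hm : HoldsPerm m π) : HoldsPerm m' π := fun p => by rw [h.2]; exact hm p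

/-- Evaluate `e` into register `x`. -/
def assign (x : ℕ) (e : Ex) : Prog := .seq (e.compile 12) (.setReg x (.reg 12))

/-- Store the value of `e` in the cell of the array `A` addressed by `i`. -/
def store (A : ℕ) (i e : Ex) : Prog :=
  .seq (i.compile 12) (.seq (e.compile 13) (.setCell A (.reg 12) (.reg 13)))

/-- Branch on the positivity of `c`. -/
def branch (c : Ex) (p q : Prog) : Prog := .seq (c.compile 12) (.ifPos (.reg 12) p q)

theorem Holds.one_le (h : Holds X w m) : 1 ≤ n := by have := h.four_le; omega

theorem Holds.two_le (h : Holds X w m) : 2 ≤ X := by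
  have := h.four_le; have := h.le_bound; omega

theorem Holds.abs_le (h : Holds X w m) {e : Ex} {v : ℤ} {Γ : List ℕ} {d : ℕ} (hw : e.WF Γ d)
    (he : e.Val X m v) (hB : X ^ e.mag ≤ B) : |v| ≤ (B : ℤ) := by
  rw [← he.2]
  refine (abs_eval_le h.two_le hw ?_ he.1).trans (by exact_mod_cast hB)
  rw [h.reg_zero]
  exact_mod_cast h.le_bound

/-- Registers below `12` are the variables of the program; those from `12` on are scratch space for
evaluation. -/
theorem Holds.assign (h : Holds X w m) {x : ℕ} {e : Ex} {v : ℤ}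
    (hw : e.WF (List.range 12) 12) (he : e.Val X m v) (hB : X ^ e.mag ≤ B) :
    Triple B (assign x e) m (e.coef * n ^ e.deg + 2) (Agree (m.setReg x v)) := by
  refine (compile_spec h.one_le h.le_bound h.two_le hw (by simp) (by decide) h.reg_zero he.1
    hB).seq fun m' hm' => ?_
  have hval : (AExp.reg 12).val m' = v := by rw [AExp.val, hm'.1, he.2]
  refine Triple.setReg (by rw [hval]; exact h.abs_le hw he hB) ⟨fun y hy => ?_, ?_⟩
  · rw [hval, Mem.setReg_reg, Mem.setReg_reg, hm'.2.1 y hy]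
  · simpa using hm'.2.2

theorem Holds.store (h : Holds X w m) {A : ℕ} {i e : Ex} {a v : ℤ}
    (hwi : i.WF (List.range 12) 12) (hw : e.WF (List.range 12) 13) (hi : i.Val X m a)
    (he : e.Val X m v) (hBi : X ^ i.mag ≤ B) (hB : X ^ e.mag ≤ B) :
    Triple B (store A i e) m (i.coef * n ^ i.deg + (e.coef * n ^ e.deg + 3))
      (Agree (m.setCell A a v)) := by
  refine (compile_spec h.one_le h.le_bound h.two_le hwi (by simp) (by decide) h.reg_zero hi.1
    hBi).seq fun m₁ hm₁ => ?_
  have hr : ∀ x ∈ List.range 12, m.reg x = m₁.reg x := fun x hx =>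
    (hm₁.2.1 x (List.mem_range.1 hx)).symm
  have h0 : m.reg 0 = m₁.reg 0 := hr 0 (by decide)
  have he' : e.Val X m₁ v := ⟨safe_congr hw h0 hm₁.2.2.symm hr he.1,
    (eval_congr hw h0 hm₁.2.2.symm hr).symm.trans he.2⟩
  refine (compile_spec h.one_le h.le_bound h.two_le hw (fun x hx => ?_) (by decide)
    (h0.symm.trans h.reg_zero) he'.1 hB).seq fun m₂ hm₂ => ?_
  · exact (List.mem_range.1 hx).trans (by decide)
  have hv1 : (AExp.reg 12).val m₂ = a := by
    rw [AExp.val, hm₂.2.1 12 (by decide), hm₁.1, hi.2]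
  have hv2 : (AExp.reg 13).val m₂ = v := by rw [AExp.val, hm₂.1, he'.2]
  refine Triple.setCell (i := .reg 12) (e := .reg 13) (by rw [hv2]; exact h.abs_le hw he hB)
    ⟨fun y hy => ?_, ?_⟩
  · rw [Mem.setCell_reg, Mem.setCell_reg, hm₂.2.1 y (by omega), hm₁.2.1 y hy]
  · rw [hv1, hv2]
    simp only [Mem.setCell, hm₂.2.2, hm₁.2.2]

theorem Holds.branch (h : Holds X w m) {c : Ex} {p q : Prog} {P : Prop} {T : ℕ}
    {Q : Mem → Prop} (hw : c.WF (List.range 12) 12) (hc : c.Tests X m P) (hB : X ^ c.mag ≤ B)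
    (hp : P → ∀ m', Agree m m' → Triple B p m' T Q)
    (hq : ¬ P → ∀ m', Agree m m' → Triple B q m' T Q) :
    Triple B (branch c p q) m (c.coef * n ^ c.deg + (2 + T)) Q := by
  refine (compile_spec h.one_le h.le_bound h.two_le hw (by simp) (by decide) h.reg_zero hc.1
    hB).seq fun m' hm' => ?_
  have ha : Agree m m' := ⟨fun x hx => hm'.2.1 x hx, hm'.2.2⟩
  refine (Triple.ifPos (e := .reg 12) (T := T) (fun h' => ?_) (fun h' => ?_)).mono
    (by simp [AExp.cost]) fun _ h => h
  · rw [AExp.val, hm'.1] at h'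
    exact hp (hc.2.1 h') m' ha
  · rw [AExp.val, hm'.1] at h'
    exact hq (fun hP => h' (hc.2.2 hP)) m' ha

end Statements

open Ex

/-! ### The programs constructing the cycle -/

section Program

variable {n X B k : ℕ} {m : Mem} {w : Weighting n}

theorem Holds.setCell (h : Holds X w m) (i v : ℤ) : Holds X w (m.setCell 1 i v) :=
  { h with
    reg_zero := h.reg_zero
    weights := fun a b hab => by
      rw [Mem.setCell_arr, if_neg fun h => absurd h.1 (by decide)]
      exact h.weights a b hab }

theorem Holds.pow_le (h : Holds X w m) {j l : ℕ} (hjl : j ≤ l) (hB : X ^ l ≤ B) : X ^ j ≤ B :=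
  (Nat.pow_le_pow_right (by have := h.two_le; omega) hjl).trans hB

theorem Holds.le_max (h : Holds X w m) {l : ℕ} (hl : 1 ≤ l) (hB : X ^ l ≤ B) : n ≤ B :=
  h.le_bound.trans (by simpa using h.pow_le hl hB)

theorem mul_pow_le {c d e : ℕ} (hn : 1 ≤ n) (h : d ≤ e) : c * n ^ d ≤ c * n ^ e :=
  Nat.mul_le_mul_left _ (Nat.pow_le_pow_right hn h)

theorem const_le {c : ℕ} (hn : 1 ≤ n) (e : ℕ) : c ≤ c * n ^ e :=
  Nat.le_mul_of_pos_right _ (Nat.one_le_pow _ _ hn)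

theorem loop_le {a d T : ℕ} (hn : 1 ≤ n) (h : T ≤ a * n ^ d) :
    n * (T + 8) + 6 ≤ (a + 14) * n ^ (d + 1) := by
  have h1 := const_le (c := 8) hn d
  have h2 := const_le (c := 6) hn (d + 1)
  calc n * (T + 8) + 6 ≤ n * (a * n ^ d + 8 * n ^ d) + 6 * n ^ (d + 1) := by gcongr
    _ = (a + 14) * n ^ (d + 1) := by ring

/-- Exchange the entries of array `1` in the cells addressed by two registers. -/
def swapProg (a b : ℕ) : Prog :=
  .seq (assign 5 (cell 1 (var a))) (.seq (store 1 (var a) (cell 1 (var b)))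
    (store 1 (var b) (var 5)))

theorem Holds.swapProg (h : Holds X w m) {π : Equiv.Perm (Fin n)} (hπ : HoldsPerm m π) {a b : ℕ}
    {x y : Fin n} (ha : a < 5) (hb : b < 5) (hx : m.reg a = (x : ℕ)) (hy : m.reg b = (y : ℕ))
    (hB : X ^ 2 ≤ B) :
    Triple B (swapProg a b) m 40 fun m' => Holds X w m' ∧ HoldsPerm m' (π * Equiv.swap x y) ∧
      ∀ r < 5, m'.reg r = m.reg r := by
  have hπX : ∀ p, (π p : ℕ) ≤ X := fun p => (π p).isLt.le.trans h.le_bound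
  refine (Triple.seq (h.assign (x := 5) ?_ (h.val_perm hπ (h.val_fin hx))
    (h.pow_le (by simp [mag]) hB)) fun m₁ h₁ => ?_ : Triple B _ m (7 + (10 + 7)) _).mono
    (by omega) fun _ h => h
  · simp [WF]; omega
  have H₁ : Holds X w m₁ := h₁.holds (h.setReg (by decide) _)
  have P₁ : HoldsPerm m₁ π := h₁.holdsPerm hπ
  have r₁ : ∀ r < 5, m₁.reg r = m.reg r := fun r hr => by
    rw [h₁.reg (by omega), Mem.setReg_reg_of_ne _ _ (by omega)]
  have t₁ : m₁.reg 5 = (π x : ℕ) := by rw [h₁.reg (by omega), Mem.setReg_reg_self]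
  refine Triple.seq (H₁.store (A := 1) (i := var a) (e := cell 1 (var b)) ?_ ?_
    (H₁.val_fin ((r₁ a ha).trans hx)) (H₁.val_perm P₁ (H₁.val_fin ((r₁ b hb).trans hy)))
    (h.pow_le (by simp [mag]) hB) (h.pow_le (by simp [mag]) hB)) fun m₂ h₂ => ?_
  · simp [WF]; omega
  · simp [WF]; omega
  have H₂ : Holds X w m₂ := h₂.holds (H₁.setCell _ _)
  have r₂ : ∀ r < 5, m₂.reg r = m.reg r := fun r hr => by
    rw [h₂.reg (by omega), Mem.setCell_reg, r₁ r hr]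
  have t₂ : m₂.reg 5 = (π x : ℕ) := by rw [h₂.reg (by omega), Mem.setCell_reg, t₁]
  refine (H₂.store (A := 1) (i := var b) (e := var 5) ?_ ?_ (H₂.val_fin ((r₂ b hb).trans hy))
    (val_var_nat t₂ (hπX x)) (h.pow_le (by simp [mag]) hB) (h.pow_le (by simp [mag]) hB)).mono
    (by simp [coef, deg]) fun m₃ h₃ => ⟨h₃.holds (H₂.setCell _ _), fun p => ?_, fun r hr => ?_⟩
  · simp [WF]; omega
  · simp [WF]
  · rw [h₃.2, Mem.setCell_arr, h₂.2, Mem.setCell_arr, P₁ p, Equiv.Perm.mul_apply,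
      Equiv.swap_apply_def]
    simp only [true_and, Nat.cast_inj, ← Fin.ext_iff]
    -- The case `x = y` is allowed: it occurs when a position keeps its vertex.
    by_cases h1 : p = y <;> by_cases h2 : p = x <;> simp_all
  · rw [h₃.reg (by omega), Mem.setCell_reg, r₂ r hr]

/-- Store the identity permutation. -/
def initProg : Prog := forProg 2 (store 1 (var 2) (var 2))

theorem Holds.initProg (h : Holds X w m) (hk : m.reg 1 = k) (hB : X ^ 1 ≤ B) :
    Triple B initProg m (21 * n ^ 1) fun m' =>
      Holds X w m' ∧ m'.reg 1 = k ∧ HoldsPerm m' (1 : Equiv.Perm (Fin n)) := by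
  refine (Triple.forProg (n := n) (T := 7) (fun v m' => Holds X w m' ∧ m'.reg 1 = k ∧
    ∀ p : Fin n, (p : ℕ) < v → m'.arr 1 (p : ℕ) = (p : ℕ)) (h.le_max le_rfl hB)
    (fun v m' h' => h'.1.reg_zero) ?_ ?_).mono ?_ ?_
  · rintro v hv m' ⟨H, hk', hp⟩ hx
    have hval : (var 2).Val X m' v := H.val_fin (v := ⟨v, hv⟩) hx
    refine (H.store (A := 1) (i := var 2) (e := var 2) (by decide) (by decide) hval hval
      (by simpa [mag] using hB) (by simpa [mag] using hB)).mono (by simp [coef, deg])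
      fun m'' h'' => ⟨⟨(h''.holds (H.setCell _ _)).setReg (by decide) _, ?_, ?_⟩, ?_⟩
    · rw [Mem.setReg_reg_of_ne _ _ (by decide), h''.reg (by decide), Mem.setCell_reg, hk']
    · intro p hpv
      rw [Mem.setReg_arr, h''.2, Mem.setCell_arr]
      split_ifs with hc
      · exact hc.2.symm
      · exact hp p (by
          have : (p : ℕ) ≠ v := fun h => hc ⟨rfl, by rw [h]⟩
          omega)
    · rw [h''.reg (by decide), Mem.setCell_reg, hx]
  · exact ⟨h.setReg (by decide) _, by rw [Mem.setReg_reg_of_ne _ _ (by decide), hk],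
      fun p hp => absurd hp (by omega)⟩
  · exact loop_le h.one_le (a := 7) (by simp)
  · rintro m' ⟨⟨H, hk', hp⟩, -⟩
    exact ⟨H, hk', fun p => hp p p.isLt⟩

/-- The next swap to be carried out. -/
def selectE : Ex := amin 20 (potentialE 20)

/-- Fix the permutation position by position, never increasing the potential. -/
def selectProg : Prog :=
  forProg 2 (.seq (assign 3 selectE) (.seq (assign 3 (candE 3)) (swapProg 2 3)))

theorem Holds.val_select (h : Holds X w m) {π : Equiv.Perm (Fin n)} (hπ : HoldsPerm m π)
    {j : Fin n} (hj : m.reg 2 = (j : ℕ)) : ∃ u : Fin n, selectE.Val X m (u : ℕ) ∧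
      potential (pairWeight w) (j + 1) (π * Equiv.swap j (max u j)) ≤
        potential (pairWeight w) j π := by
  have h1 := fun u : Fin n => (h.setReg (x := 20) (by decide) (u : ℕ)).val_potential (π := π)
    hπ (j := j) (u := u) (setReg_reg_ne m hj (by decide)) (by simp)
  choose f hf hfp using h1
  obtain ⟨u, hu, hmin⟩ := val_amin (Fin.pos j) h.reg_zero hf
  -- The minimiser ranges over all `u`, but `max u j` takes exactly the values `v ≥ j`, with `u = v`
  -- giving `v`.
  refine ⟨u, hu, potential_swap_le h.four_le _ _ _ _ fun v hv => ?_⟩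
  have h2 : (f u : ℚ) ≤ f v := by exact_mod_cast hmin v
  rw [hfp, hfp, max_eq_left hv] at h2
  exact le_of_mul_le_mul_left h2 (by exact_mod_cast commonMult_pos _)

/-- This stage dominates the running time. The degree 6 of `selectE` comes from the candidate, the
position and the four coordinates of a tuple; the loop over `j` adds one. -/
theorem Holds.selectProg (h : Holds X w m) (hk : m.reg 1 = k)
    (hπ : HoldsPerm m (1 : Equiv.Perm (Fin n)))
    (hB : X ^ (selectE.mag + (candE 3).mag + 2) ≤ B) :
    Triple B selectProg m ((selectE.coef + (candE 3).coef + 58) * n ^ 7) fun m' =>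
      Holds X w m' ∧ m'.reg 1 = k ∧ ∃ π : Equiv.Perm (Fin n), HoldsPerm m' π ∧
        potential (pairWeight w) n π ≤ potential (pairWeight w) 0 1 := by
  have hn := h.one_le
  refine (Triple.forProg (n := n) (T := (selectE.coef * n ^ selectE.deg + 2) +
    (((candE 3).coef * n ^ (candE 3).deg + 2) + 40)) (fun v m' => Holds X w m' ∧ m'.reg 1 = k ∧
    ∃ π : Equiv.Perm (Fin n), HoldsPerm m' π ∧
      potential (pairWeight w) v π ≤ potential (pairWeight w) 0 1) (h.le_max (by omega) hB)
    (fun v m' h' => h'.1.reg_zero) ?_ ?_).mono ?_ ?_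
  · rintro v hv m' ⟨H, hk', π, hπ', hle⟩ hx
    obtain ⟨u, hu, hpot⟩ := H.val_select hπ' (j := ⟨v, hv⟩) hx
    refine (H.assign (x := 3) (by decide) hu (h.pow_le (by omega) hB)).seq fun m₁ h₁ => ?_
    have H₁ : Holds X w m₁ := h₁.holds (H.setReg (by decide) _)
    have j₁ : m₁.reg 2 = ((⟨v, hv⟩ : Fin n) : ℕ) := by
      rw [h₁.reg (by decide), Mem.setReg_reg_of_ne _ _ (by decide), hx]
    have u₁ : m₁.reg 3 = (u : ℕ) := by rw [h₁.reg (by decide), Mem.setReg_reg_self]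
    refine (H₁.assign (x := 3) (by decide) (H₁.val_cand j₁ u₁) (h.pow_le (by omega) hB)).seq
      fun m₂ h₂ => ?_
    have H₂ : Holds X w m₂ := h₂.holds (H₁.setReg (by decide) _)
    have j₂ : m₂.reg 2 = ((⟨v, hv⟩ : Fin n) : ℕ) := by
      rw [h₂.reg (by decide), Mem.setReg_reg_of_ne _ _ (by decide), j₁]
    have u₂ : m₂.reg 3 = ((max u ⟨v, hv⟩ : Fin n) : ℕ) := by
      rw [h₂.reg (by decide), Mem.setReg_reg_self]
    have P₂ : HoldsPerm m₂ π := h₂.holdsPerm (h₁.holdsPerm (m := m'.setReg 3 _) hπ')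
    refine (H₂.swapProg P₂ (by decide) (by decide) j₂ u₂ (h.pow_le (by omega) hB)).mono le_rfl
      fun m₃ h₃ => ⟨⟨h₃.1.setReg (by decide) _, ?_, _, h₃.2.1, hpot.trans hle⟩, ?_⟩
    · rw [Mem.setReg_reg_of_ne _ _ (by decide), h₃.2.2 1 (by decide), h₂.reg (by decide),
        Mem.setReg_reg_of_ne _ _ (by decide), h₁.reg (by decide),
        Mem.setReg_reg_of_ne _ _ (by decide), hk']
    · rw [h₃.2.2 2 (by decide), j₂]
  · exact ⟨h.setReg (by decide) _, by rw [Mem.setReg_reg_of_ne _ _ (by decide), hk], 1, hπ, le_rfl⟩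
  · have h1 : selectE.deg ≤ 6 := by decide
    have h2 : (candE 3).deg ≤ 6 := by decide
    have h3 := mul_pow_le (c := selectE.coef) hn h1
    have h4 := mul_pow_le (c := (candE 3).coef) hn h2
    have h5 := const_le (c := 44) hn 6
    exact loop_le hn (a := selectE.coef + (candE 3).coef + 44) (d := 6) (by
      rw [add_mul, add_mul]; omega)
  · rintro m' ⟨hm', -⟩
    exact ⟨hm'.1, hm'.2⟩

/-- The test whether the block starting at the position in register `2` is to be improved. -/
def improveE : Ex :=
  andE (blockE (var 2)) (ltE (gapE (cell 1 (var 2)) (cell 1 (posE (var 2) 1))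
    (cell 1 (posE (var 2) 2)) (cell 1 (posE (var 2) 3))) (lit 0))

/-- Improve the blocks. -/
def improveProg : Prog :=
  forProg 2 (branch improveE (.seq (assign 3 (posE (var 2) 1)) (.seq (assign 4 (posE (var 2) 2))
    (swapProg 3 4))) .skip)

theorem Holds.improveProg (h : Holds X w m) (hk : m.reg 1 = k) {π : Equiv.Perm (Fin n)}
    (hπ : HoldsPerm m π)
    (hB : X ^ (improveE.mag + (posE (var 2) 1).mag + (posE (var 2) 2).mag + 2) ≤ B) :
    Triple B improveProg m
      ((improveE.coef + (posE (var 2) 1).coef + (posE (var 2) 2).coef + 60) * n ^ 7) fun m' =>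
      Holds X w m' ∧ m'.reg 1 = k ∧ ∃ σ : Equiv.Perm (Fin n), HoldsPerm m' σ ∧
        ImprovedUpTo (pairWeight w) π n σ := by
  have hn := h.one_le
  refine (Triple.forProg (n := n) (T := improveE.coef * n ^ improveE.deg + (2 +
    (((posE (var 2) 1).coef * n ^ (posE (var 2) 1).deg + 2) +
    (((posE (var 2) 2).coef * n ^ (posE (var 2) 2).deg + 2) + 40)))) (fun v m' => Holds X w m' ∧
    m'.reg 1 = k ∧ ∃ σ : Equiv.Perm (Fin n), HoldsPerm m' σ ∧ ImprovedUpTo (pairWeight w) π v σ)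
    (h.le_max (by omega) hB) (fun v m' h' => h'.1.reg_zero) ?_ ?_).mono ?_ ?_
  · rintro v hv m' ⟨H, hk', σ, hσ, himp⟩ hx
    have hi := H.val_fin (v := ⟨v, hv⟩) hx
    have hp := fun t => H.val_perm hσ (H.val_pos hi t)
    have himp' := ImprovedUpTo.succ H.four_le (pairWeight_comm w) (v := ⟨v, hv⟩) himp
    refine H.branch (by decide) (tests_and (H.tests_block hi) (tests_lt
      (H.val_gap (H.val_perm hσ hi) (hp 1) (hp 2) (hp 3)) (val_lit 0)))
      (h.pow_le (by rw [improveE]; omega) hB) (fun hc m₁ h₁ => ?_) (fun hc m₁ h₁ => ?_)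
    · rw [if_pos hc] at himp'
      have H₁ := h₁.holds H
      have i₁ := H₁.val_fin (v := ⟨v, hv⟩) ((h₁.reg (x := 2) (by decide)).trans hx)
      refine (H₁.assign (x := 3) (e := posE (var 2) 1) (by decide) (H₁.val_pos i₁ 1)
        (h.pow_le (by omega) hB)).seq fun m₂ h₂ => ?_
      have H₂ := h₂.holds (H₁.setReg (by decide) _)
      have x₂ : m₂.reg 2 = ((⟨v, hv⟩ : Fin n) : ℕ) := by
        rw [h₂.reg (by decide), Mem.setReg_reg_of_ne _ _ (by decide), h₁.reg (by decide), hx]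
      refine (H₂.assign (x := 4) (e := posE (var 2) 2) (by decide) (H₂.val_pos (H₂.val_fin x₂) 2)
        (h.pow_le (by omega) hB)).seq fun m₃ h₃ => ?_
      have H₃ := h₃.holds (H₂.setReg (by decide) _)
      have x₃ : m₃.reg 2 = v := by
        rw [h₃.reg (by decide), Mem.setReg_reg_of_ne _ _ (by decide), x₂]
      have a₃ : m₃.reg 3 = (cyc (⟨v, hv⟩ : Fin n) 1 : ℕ) := by
        rw [h₃.reg (by decide), Mem.setReg_reg_of_ne _ _ (by decide), h₂.reg (by decide),
          Mem.setReg_reg_self]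
      have b₃ : m₃.reg 4 = (cyc (⟨v, hv⟩ : Fin n) 2 : ℕ) := by
        rw [h₃.reg (by decide), Mem.setReg_reg_self]
      have k₃ : m₃.reg 1 = k := by
        rw [h₃.reg (by decide), Mem.setReg_reg_of_ne _ _ (by decide), h₂.reg (by decide),
          Mem.setReg_reg_of_ne _ _ (by decide), h₁.reg (by decide), hk']
      have P₃ : HoldsPerm m₃ σ := fun p => by
        rw [h₃.2, Mem.setReg_arr, h₂.2, Mem.setReg_arr, h₁.2, hσ p]
      refine (H₃.swapProg P₃ (by decide) (by decide) a₃ b₃ (h.pow_le (by omega) hB)).mono le_rfl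
        fun m₄ h₄ => ⟨⟨h₄.1.setReg (by decide) _, ?_, _, h₄.2.1, himp'⟩, ?_⟩
      · rw [Mem.setReg_reg_of_ne _ _ (by decide), h₄.2.2 1 (by decide), k₃]
      · rw [h₄.2.2 2 (by decide), x₃]
    · rw [if_neg hc] at himp'
      refine ⟨_, _, .skip _, by omega, ⟨(h₁.holds H).setReg (by decide) _, ?_, σ,
        h₁.holdsPerm hσ, himp'⟩, ?_⟩
      · rw [Mem.setReg_reg_of_ne _ _ (by decide), h₁.reg (by decide), hk']
      · rw [h₁.reg (by decide), hx]
  · exact ⟨h.setReg (by decide) _, by rw [Mem.setReg_reg_of_ne _ _ (by decide), hk], π, hπ,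
      ImprovedUpTo.zero _ _⟩
  · have h1 := mul_pow_le (c := improveE.coef) hn (show improveE.deg ≤ 6 by decide)
    have h2 := mul_pow_le (c := (posE (var 2) 1).coef) hn
      (show (posE (var 2) 1).deg ≤ 6 by decide)
    have h3 := mul_pow_le (c := (posE (var 2) 2).coef) hn
      (show (posE (var 2) 2).deg ≤ 6 by decide)
    have h5 := const_le (c := 46) hn 6
    exact loop_le hn (a := improveE.coef + (posE (var 2) 1).coef + (posE (var 2) 2).coef + 46)
      (d := 6) (by rw [add_mul, add_mul, add_mul]; omega)
  · rintro m' ⟨hm', -⟩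
    exact ⟨hm'.1, hm'.2⟩

end Program

open Ex

/-! ### The final test, the shifted weighting and the algorithm -/

section Main

variable {n X B k : ℕ} {m : Mem} {w : Weighting n}

/-- The weight of the cycle in array `1`. -/
def cycleE : Ex := sum 30 (wE (cell 1 (var 30)) (cell 1 (posE (var 30) 1)))

/-- The weight of all ordered pairs. -/
def totalE : Ex := sum 30 (sum 40 (wE (var 30) (var 40)))

/-- The test whether the cycle in array `1` beats the average by more than `k`. -/
def testE : Ex := ltE (mul (add cycleE (var 1)) (sub (var 0) (lit 1))) totalE

/-- The inequality `h < d n - k`, multiplied by `n - 1` to avoid fractions; note `d n = total / (n -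
1)`. -/
theorem Holds.tests_test (h : Holds X w m) {σ : Equiv.Perm (Fin n)} (hσ : HoldsPerm m σ)
    (hk : m.reg 1 = k) (hkX : k ≤ X) : testE.Tests X m
      ((cycleWeight (pairWeight w) σ + k) * (n - 1) < total (pairWeight w)) := by
  refine tests_lt (val_mul (val_add (val_sum h.reg_zero fun i => ?_) (val_var_nat hk hkX))
    (val_sub h.val_n (val_lit 1))) (val_sum h.reg_zero fun a => ?_)
  · have H := h.setReg (x := 30) (by decide) (i : ℕ)
    have hi := H.val_fin (x := 30) (v := i) (by simp)
    exact H.val_w (H.val_perm hσ hi) (H.val_perm hσ (H.val_pos hi 1))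
  · have H := h.setReg (x := 30) (by decide) (a : ℕ)
    refine val_sum H.reg_zero fun b => ?_
    exact (H.setReg (x := 40) (by decide) (b : ℕ)).val_w
      ((H.setReg (by decide) _).val_fin (by simp [Mem.setReg_reg]))
      ((H.setReg (by decide) _).val_fin (by simp))

/-- The shift of the weight of all Hamilton cycles. -/
def alphaE : Ex :=
  sub (mul (var 0) (var 8)) (mul (lit 2) (sum 30 (shiftE (var 5) (var 8) (var 30))))

/-- The shift at a vertex of the weighting `shifted W p c`. -/
def vertexShift (W : Fin n → Fin n → ℤ) (p : Fin n) (c : ℤ) (a : Fin n) : ℤ :=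
  if a = p then c else W a p

theorem Holds.val_alpha (h : Holds X w m) {p : Fin n} {c : ℤ} (hp : m.reg 5 = (p : ℕ))
    (hc : m.reg 8 = c) (hcX : |c| ≤ X) :
    alphaE.Val X m (n * c - 2 * ∑ a, vertexShift (pairWeight w) p c a) := by
  refine val_sub (val_mul h.val_n (val_var hc hcX)) (val_mul (val_lit 2)
    (val_sum h.reg_zero fun a => ?_))
  have H := h.setReg (x := 30) (by decide) (a : ℕ)
  exact H.val_shift (H.val_fin (setReg_reg_ne m hp (by decide)))
    (val_var (setReg_reg_ne m hc (by decide)) hcX) (H.val_fin (by simp))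

/-- The index of the cell for the pair in registers `9` and `10`. -/
def indexE : Ex := add (mul (var 9) (var 0)) (var 10)

/-- The shifted weight of the pair in registers `9` and `10`. -/
def entryE : Ex := shiftedE (var 5) (var 8) (var 9) (var 10)

/-- Store the shifted weighting. -/
def writeProg : Prog := forProg 9 (forProg 10 (store 1 indexE entryE))

theorem cell_index_inj {a b u v : Fin n}
    (h : ((a : ℕ) : ℤ) * n + (b : ℕ) = ((u : ℕ) : ℤ) * n + (v : ℕ)) : a = u ∧ b = v := by
  have h' : (b : ℕ) + n * a = v + n * u := by
    zify
    linarith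
  have h1 := congrArg (· / n) h'
  have h2 := congrArg (· % n) h'
  simp only [Nat.add_mul_div_left _ _ (Fin.pos a), Nat.div_eq_of_lt b.isLt,
    Nat.div_eq_of_lt v.isLt, zero_add] at h1
  simp only [Nat.add_mul_mod_self_left, Nat.mod_eq_of_lt b.isLt, Nat.mod_eq_of_lt v.isLt] at h2
  exact ⟨Fin.ext h1, Fin.ext h2⟩

/-- The matrix replaces the permutation in array `1`, no longer needed. Different pairs have
different cells, so entries written earlier persist. -/
theorem Holds.writeProg (h : Holds X w m) {p : Fin n} {c α : ℤ} (hp : m.reg 5 = (p : ℕ))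
    (hc : m.reg 8 = c) (hcX : |c| ≤ X) (hα : m.reg 1 = α)
    (hB : X ^ (indexE.mag + entryE.mag + 1) ≤ B) :
    Triple B writeProg m ((indexE.coef + entryE.coef + 31) * n ^ 2) fun m' =>
      Holds X w m' ∧ m'.reg 1 = α ∧ ∀ a b : Fin n, m'.arr 1 ((a : ℕ) * n + (b : ℕ)) =
        shifted (pairWeight w) p c a b := by
  have hn := h.one_le
  let I : Mem → Prop := fun m' => Holds X w m' ∧ m'.reg 1 = α ∧ m'.reg 5 = (p : ℕ) ∧ m'.reg 8 = c
  have hI : ∀ {m' x v}, I m' → x = 9 ∨ x = 10 → I (m'.setReg x v) := by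
    rintro m' x v ⟨H, h1, h5, h8⟩ (rfl | rfl) <;>
    exact ⟨H.setReg (by decide) _, setReg_reg_ne _ h1 (by decide), setReg_reg_ne _ h5 (by decide),
      setReg_reg_ne _ h8 (by decide)⟩
  let done : Mem → Fin n → Fin n → Prop := fun m' a b =>
    m'.arr 1 ((a : ℕ) * n + (b : ℕ)) = shifted (pairWeight w) p c a b
  have step : ∀ {m'} (a b : Fin n), I m' → m'.reg 9 = (a : ℕ) → m'.reg 10 = (b : ℕ) →
      Triple B (TSP.store 1 indexE entryE) m' (indexE.coef + entryE.coef + 3) fun m'' => I m'' ∧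
        m''.reg 9 = (a : ℕ) ∧ m''.reg 10 = (b : ℕ) ∧
        ∀ a' b', ((a' = a ∧ b' = b) ∨ done m' a' b') → done m'' a' b' := by
    rintro m' a b ⟨H, h1, h5, h8⟩ h9 h10
    refine (H.store (A := 1) (i := indexE) (e := entryE) (by decide) (by decide)
      (val_add (val_mul (H.val_fin h9) H.val_n) (H.val_fin h10)) (H.val_shifted (H.val_fin h5)
      (val_var h8 hcX) (H.val_fin h9) (H.val_fin h10)) (h.pow_le (by omega) hB)
      (h.pow_le (by omega) hB)).mono ?_ fun m'' h'' => ?_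
    · rw [show indexE.deg = 0 by decide, show entryE.deg = 0 by decide, pow_zero]
      omega
    · refine ⟨⟨h''.holds (H.setCell _ _), ?_, ?_, ?_⟩, ?_, ?_, fun a' b' hd => ?_⟩
      · rw [h''.reg (by decide), Mem.setCell_reg, h1]
      · rw [h''.reg (by decide), Mem.setCell_reg, h5]
      · rw [h''.reg (by decide), Mem.setCell_reg, h8]
      · rw [h''.reg (by decide), Mem.setCell_reg, h9]
      · rw [h''.reg (by decide), Mem.setCell_reg, h10]
      · show m''.arr 1 _ = _
        rw [h''.2, Mem.setCell_arr]
        split_ifs with hcell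
        · obtain ⟨rfl, rfl⟩ := cell_index_inj hcell.2
          rfl
        · rcases hd with ⟨rfl, rfl⟩ | hd
          · exact absurd ⟨rfl, rfl⟩ hcell
          · exact hd
  have row : ∀ {m'} (a : Fin n), I m' → m'.reg 9 = (a : ℕ) → (∀ a' b' : Fin n, a' < a →
      done m' a' b') → Triple B (forProg 10 (TSP.store 1 indexE entryE)) m'
      ((indexE.coef + entryE.coef + 17) * n ^ 1) fun m'' => I m'' ∧ m''.reg 9 = (a : ℕ) ∧
        ∀ a' b' : Fin n, a' ≤ a → done m'' a' b' := by
    intro m' a H h9 hd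
    refine (Triple.forProg (n := n) (T := indexE.coef + entryE.coef + 3) (fun v m'' => I m'' ∧
      m''.reg 9 = (a : ℕ) ∧ (∀ a' b' : Fin n, a' < a → done m'' a' b') ∧
      ∀ b' : Fin n, (b' : ℕ) < v → done m'' a b') (h.le_max (by omega) hB)
      (fun v m'' h' => h'.1.1.reg_zero) ?_ ?_).mono ?_ ?_
    · rintro v hv m₁ ⟨H₁, h₁9, hd₁, hd₁'⟩ hx
      refine (step a ⟨v, hv⟩ H₁ h₁9 hx).mono le_rfl fun m₂ h₂ => ⟨⟨hI h₂.1 (Or.inr rfl),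
        setReg_reg_ne _ h₂.2.1 (by decide),
        fun a' b' ha' => h₂.2.2.2 a' b' (Or.inr (hd₁ a' b' ha')),
        fun b' hb' => h₂.2.2.2 a b' ?_⟩, h₂.2.2.1⟩
      rcases Nat.lt_succ_iff_lt_or_eq.1 hb' with hlt | heq
      · exact Or.inr (hd₁' b' hlt)
      · exact Or.inl ⟨rfl, Fin.ext heq⟩
    · exact ⟨hI H (Or.inr rfl), setReg_reg_ne _ h9 (by decide), hd, fun b' hb' =>
        absurd hb' (by omega)⟩
    · exact loop_le hn (a := indexE.coef + entryE.coef + 3) (d := 0) (by simp)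
    · rintro m'' ⟨⟨H', h9', hd1, hd2⟩, -⟩
      refine ⟨H', h9', fun a' b' ha' => ?_⟩
      rcases ha'.lt_or_eq with hlt | rfl
      · exact hd1 a' b' hlt
      · exact hd2 b' b'.isLt
  refine (Triple.forProg (n := n) (T := (indexE.coef + entryE.coef + 17) * n ^ 1) (fun v m' =>
    I m' ∧ ∀ a' b' : Fin n, (a' : ℕ) < v → done m' a' b') (h.le_max (by omega) hB)
    (fun v m'' h' => h'.1.1.reg_zero) ?_ ?_).mono ?_ ?_
  · rintro v hv m₁ ⟨H₁, hd₁⟩ hx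
    refine (row ⟨v, hv⟩ H₁ hx fun a' b' ha' => hd₁ a' b' ha').mono le_rfl fun m₂ h₂ =>
      ⟨⟨hI h₂.1 (Or.inl rfl), fun a' b' ha' => h₂.2.2 a' b' (Nat.lt_succ_iff.1 ha')⟩, h₂.2.1⟩
  · exact ⟨hI ⟨h, hα, hp, hc⟩ (Or.inl rfl), fun a' b' ha' => absurd ha' (by omega)⟩
  · exact loop_le hn (d := 1) le_rfl
  · rintro m' ⟨⟨H, hd⟩, -⟩
    exact ⟨H.1, H.2.1, fun a b => hd a b a.isLt⟩

/-- The first vertex determining the shift. -/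
def firstE : Ex := amin 20 (minMinSpreadE 20)

/-- The second vertex determining the shift. -/
def secondE : Ex := amin 40 (minSpreadE 5 40)

/-- The third vertex determining the shift. -/
def thirdE : Ex := amin 60 (spreadE 5 6 60)

/-- The constant determining the shift. -/
def shiftConstE : Ex := constE (var 5) (var 6) (var 7)

/-- Find and store a shifted weighting of minimal total absolute weight. -/
def shiftProg : Prog :=
  .seq (assign 5 firstE) (.seq (assign 6 secondE) (.seq (assign 7 thirdE)
    (.seq (assign 8 shiftConstE) (.seq (assign 1 alphaE)
    (.seq writeProg (assign 0 (lit 1)))))))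

/-- The three vertices are found one at a time, each with its predecessors fixed. Since `n` is
needed throughout, the verdict enters register `0` last. The hypothesis `hX` bounds the constant
`c`, a sum of three weights up to sign. -/
theorem Holds.shiftProg (h : Holds X w m) (hX : 3 * maxAbs w ≤ X)
    (hB : X ^ (firstE.mag + secondE.mag + thirdE.mag + shiftConstE.mag + alphaE.mag +
      (indexE.mag + entryE.mag + 1)) ≤ B) :
    Triple B shiftProg m ((firstE.coef + secondE.coef + thirdE.coef + shiftConstE.coef +
        alphaE.coef + (indexE.coef + entryE.coef + 31) + 14) * n ^ 7) fun m' =>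
      m'.reg 0 = 1 ∧ ∃ p q z : Fin n, ∃ c, c = pairWeight w p q + pairWeight w z p -
          pairWeight w z q ∧
        (∀ p' q' z', spread (pairWeight w) p q z ≤ spread (pairWeight w) p' q' z') ∧
        m'.reg 1 = n * c - 2 * ∑ a, vertexShift (pairWeight w) p c a ∧
        ∀ a b : Fin n, m'.arr 1 ((a : ℕ) * n + (b : ℕ)) = shifted (pairWeight w) p c a b := by
  have hn := h.one_le
  have n0 : 0 < n := hn
  refine (?_ : Triple B _ m ((firstE.coef * n ^ firstE.deg + 2) +
    ((secondE.coef * n ^ secondE.deg + 2) + ((thirdE.coef * n ^ thirdE.deg + 2) +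
    ((shiftConstE.coef * n ^ shiftConstE.deg + 2) + ((alphaE.coef * n ^ alphaE.deg + 2) +
    (((indexE.coef + entryE.coef + 31) * n ^ 2) + 4)))))) _).mono ?_ fun _ h => h
  · have hfirst := fun p : Fin n => (h.setReg (x := 20) (by decide) (p : ℕ)).val_minMinSpread
      (a := 20) (p := p) (by omega) (by simp)
    choose f g hfg hfgmin using hfirst
    obtain ⟨p, hp, hpmin⟩ := val_amin n0 h.reg_zero hfg
    refine (h.assign (x := 5) (e := firstE) (by decide) hp (h.pow_le (by omega) hB)).seq
      fun m₁ h₁ => ?_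
    have H₁ := h₁.holds (h.setReg (by decide) _)
    have p₁ : m₁.reg 5 = (p : ℕ) := by rw [h₁.reg (by decide), Mem.setReg_reg_self]
    have hsecond := fun q : Fin n => (H₁.setReg (x := 40) (by decide) (q : ℕ)).val_minSpread
      (a := 5) (b := 40) (p := p) (q := q) (by omega) (by omega)
      (setReg_reg_ne _ p₁ (by decide)) (by simp)
    choose f' hf' hf'min using hsecond
    obtain ⟨q, hq, hqmin⟩ := val_amin n0 H₁.reg_zero hf'
    refine (H₁.assign (x := 6) (e := secondE) (by decide) hq (h.pow_le (by omega) hB)).seq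
      fun m₂ h₂ => ?_
    have H₂ := h₂.holds (H₁.setReg (by decide) _)
    have p₂ : m₂.reg 5 = (p : ℕ) := by
      rw [h₂.reg (by decide), Mem.setReg_reg_of_ne _ _ (by decide), p₁]
    have q₂ : m₂.reg 6 = (q : ℕ) := by rw [h₂.reg (by decide), Mem.setReg_reg_self]
    obtain ⟨z, hz, hzmin⟩ := val_amin (f := spread (pairWeight w) p q) n0
      H₂.reg_zero fun z => (H₂.setReg (x := 60) (by decide) (z : ℕ)).val_spread (a := 5)
      (b := 6) (c := 60) (p := p) (q := q) (by omega) (by omega) (by omega) (setReg_reg_ne _ p₂ (by decide))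
      (setReg_reg_ne _ q₂ (by decide)) (by simp)
    refine (H₂.assign (x := 7) (e := thirdE) (by decide) hz (h.pow_le (by omega) hB)).seq
      fun m₃ h₃ => ?_
    have H₃ := h₃.holds (H₂.setReg (by decide) _)
    have p₃ : m₃.reg 5 = (p : ℕ) := by
      rw [h₃.reg (by decide), Mem.setReg_reg_of_ne _ _ (by decide), p₂]
    have q₃ : m₃.reg 6 = (q : ℕ) := by
      rw [h₃.reg (by decide), Mem.setReg_reg_of_ne _ _ (by decide), q₂]
    have z₃ : m₃.reg 7 = (z : ℕ) := by rw [h₃.reg (by decide), Mem.setReg_reg_self]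
    refine (H₃.assign (x := 8) (e := shiftConstE) (by decide) (H₃.val_const (H₃.val_fin p₃)
      (H₃.val_fin q₃) (H₃.val_fin z₃)) (h.pow_le (by omega) hB)).seq fun m₄ h₄ => ?_
    set c := pairWeight w p q + pairWeight w z p - pairWeight w z q with hc
    have hcX : |c| ≤ X := by
      have b1 := _root_.abs_le.1 (abs_pairWeight_le w p q)
      have b2 := _root_.abs_le.1 (abs_pairWeight_le w z p)
      have b3 := _root_.abs_le.1 (abs_pairWeight_le w z q)
      exact _root_.abs_le.2 ⟨by omega, by omega⟩
    have H₄ := h₄.holds (H₃.setReg (by decide) _)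
    have p₄ : m₄.reg 5 = (p : ℕ) := by
      rw [h₄.reg (by decide), Mem.setReg_reg_of_ne _ _ (by decide), p₃]
    have c₄ : m₄.reg 8 = c := by rw [h₄.reg (by decide), Mem.setReg_reg_self]
    refine (H₄.assign (x := 1) (e := alphaE) (by decide) (H₄.val_alpha p₄ c₄ hcX)
      (h.pow_le (by omega) hB)).seq fun m₅ h₅ => ?_
    have H₅ := h₅.holds (H₄.setReg (by decide) _)
    have p₅ : m₅.reg 5 = (p : ℕ) := by
      rw [h₅.reg (by decide), Mem.setReg_reg_of_ne _ _ (by decide), p₄]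
    have c₅ : m₅.reg 8 = c := by
      rw [h₅.reg (by decide), Mem.setReg_reg_of_ne _ _ (by decide), c₄]
    have α₅ := h₅.reg (x := 1) (by decide)
    rw [Mem.setReg_reg_self] at α₅
    refine (H₅.writeProg p₅ c₅ hcX α₅ (h.pow_le (by omega) hB)).seq fun m₆ h₆ => ?_
    refine (h₆.1.assign (x := 0) (e := lit 1) (by decide) (val_lit 1)
      (h.pow_le (by simp only [mag]; omega) hB)).mono (by simp [coef, deg]) fun m₇ h₇ => ?_
    refine ⟨?_, p, q, z, c, rfl, fun p' q' z' => ?_, ?_, fun a b => ?_⟩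
    · rw [h₇.reg (by decide), Mem.setReg_reg_self]
    · exact (hzmin _).trans ((hqmin _).trans ((hf'min _ _).trans ((hpmin p').trans
        (hfgmin p' q' z'))))
    · rw [h₇.reg (by decide), Mem.setReg_reg_of_ne _ _ (by decide), h₆.2.1]
    · rw [h₇.2, Mem.setReg_arr, h₆.2.2 a b]
  · have h1 := mul_pow_le (c := firstE.coef) hn (show firstE.deg ≤ 7 by decide)
    have h2 := mul_pow_le (c := secondE.coef) hn (show secondE.deg ≤ 7 by decide)
    have h3 := mul_pow_le (c := thirdE.coef) hn (show thirdE.deg ≤ 7 by decide)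
    have h4 := mul_pow_le (c := shiftConstE.coef) hn (show shiftConstE.deg ≤ 7 by decide)
    have h5 := mul_pow_le (c := alphaE.coef) hn (show alphaE.deg ≤ 7 by decide)
    have h6 := mul_pow_le (c := indexE.coef + entryE.coef + 31) hn (show 2 ≤ 7 by decide)
    have h7 := const_le (c := 14) hn 7
    simp only [add_mul] at *
    omega

/-- The algorithm. -/
def mainProg : Prog :=
  .seq initProg (.seq selectProg (.seq improveProg (branch testE (assign 0 (lit 0)) shiftProg)))

theorem shifted_comm (W : Fin n → Fin n → ℤ) (hW : ∀ a b, W a b = W b a) (p : Fin n) (c : ℤ)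
    (a b : Fin n) : shifted W p c a b = shifted W p c b a := by
  simp only [shifted, eq_comm (a := b), hW b a]
  split_ifs <;> ring

/-- The weighting of the edges obtained from a symmetric function. -/
def ofPairs (W : Fin n → Fin n → ℤ) (hW : ∀ a b, W a b = W b a) : Weighting n :=
  fun e => Sym2.lift ⟨W, hW⟩ e

theorem pairWeight_ofPairs (W : Fin n → Fin n → ℤ) (hW : ∀ a b, W a b = W b a) {a b : Fin n}
    (h : a ≠ b) : pairWeight (ofPairs W hW) a b = W a b := by
  rw [pairWeight_of_ne _ (show (K n).Adj a b by simpa using h)]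
  rfl

/-- The converse translation of the machine's test, by `d n = 2 w(K_n) / (n - 1)`. -/
theorem lt_density {w : Weighting n} (hn : 4 ≤ n) {h : ℤ}
    (hlt : (h + k) * (n - 1) < total (pairWeight w)) : (h : ℚ) < density w * n - k := by
  have hn' : (4 : ℚ) ≤ n := by exact_mod_cast hn
  have h1 : (n : ℚ) - 1 > 0 := by linarith
  rw [← two_mul_weight_top] at hlt
  have h2 : ((h : ℚ) + k) * (n - 1) < 2 * weight w ⊤ := by exact_mod_cast hlt
  have h3 : density w * n = 2 * weight w ⊤ / (n - 1) := by
    rw [density, Nat.cast_choose_two]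
    have : (n : ℚ) ≠ 0 := by positivity
    field_simp
  rw [h3]
  have := (lt_div_iff₀ h1).2 h2
  linarith

end Main
end TSP

/-! ### The main theorem -/

open TSP in
theorem theorem2 :
    ∃ (P : TSP.Prog) (C D : ℕ), ∀ (n k : ℕ) (w : TSP.Weighting n), 5000 * (k + 1) < n →
      ∀ m : TSP.Mem, m.IsInput w k →
        ∃ (m' : TSP.Mem) (t : ℕ),
          TSP.Exec ((n * (TSP.maxAbs w + 1)) ^ D) P m m' t ∧
          t ≤ C * n ^ 7 ∧
          ((m'.reg 0 = 0 ∧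
              ∃ (v : Fin n) (c : (TSP.K n).Walk v v),
                c.IsHamiltonianCycle ∧
                m'.HoldsCycle 1 c ∧
                (TSP.weight w c.toSubgraph : ℚ) < TSP.density w * (n : ℚ) - (k : ℚ)) ∨
            (m'.reg 0 = 1 ∧
              ∃ (w' : TSP.Weighting n) (α : ℤ),
                m'.HoldsWeighting 1 w' ∧
                m'.reg 1 = α ∧
                (∀ (v : Fin n) (c : (TSP.K n).Walk v v), c.IsHamiltonianCycle →
                  TSP.weight w' c.toSubgraph = TSP.weight w c.toSubgraph + α) ∧
                TSP.absWeight w' ⊤ ≤ 4000 * (k : ℤ) * (n : ℤ))) := by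
  -- The time constant and the exponent are the sums of those of the stages.
  refine ⟨mainProg, 21 + ((selectE.coef + (candE 3).coef + 58) + ((improveE.coef +
    (posE (.var 2) 1).coef + (posE (.var 2) 2).coef + 60) + (testE.coef + (2 +
    (firstE.coef + secondE.coef + thirdE.coef + shiftConstE.coef + alphaE.coef +
      (indexE.coef + entryE.coef + 31) + 14))))), 1 + (selectE.mag + (candE 3).mag + 2) +
    (improveE.mag + (posE (.var 2) 1).mag + (posE (.var 2) 2).mag + 2) + testE.mag +
    (firstE.mag + secondE.mag + thirdE.mag + shiftConstE.mag + alphaE.mag +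
      (indexE.mag + entryE.mag + 1)), ?_⟩
  intro n k w hnk m hm
  -- `log X = log n + log (M + 1)`, so a bound `X ^ D` is the required word size. `X` exceeds `n`,
  -- hence `k`, and as `n ≥ 3` also `3 M`.
  set X := n * (maxAbs w + 1) with hX
  have hnX : n ≤ X := Nat.le_mul_of_pos_right _ (Nat.succ_pos _)
  have hMX : 3 * maxAbs w ≤ X := Nat.mul_le_mul (by omega) (Nat.le_succ _)
  have h : Holds X w m := ⟨hm.1, hm.2.2, by omega, hnX, by omega⟩
  have hn := h.one_le
  set D := 1 + (selectE.mag + (candE 3).mag + 2) +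
    (improveE.mag + (posE (.var 2) 1).mag + (posE (.var 2) 2).mag + 2) + testE.mag +
    (firstE.mag + secondE.mag + thirdE.mag + shiftConstE.mag + alphaE.mag +
      (indexE.mag + entryE.mag + 1)) with hD
  suffices H : Triple (X ^ D) mainProg m _ _ from H
  refine Triple.mono (T := 21 * n ^ 1 + ((selectE.coef + (candE 3).coef + 58) * n ^ 7 +
    ((improveE.coef + (posE (.var 2) 1).coef + (posE (.var 2) 2).coef + 60) * n ^ 7 +
    (testE.coef * n ^ testE.deg + (2 + (firstE.coef + secondE.coef + thirdE.coef +
      shiftConstE.coef + alphaE.coef + (indexE.coef + entryE.coef + 31) + 14) * n ^ 7)))))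
    ?_ ?_ fun _ h => h
  · refine (h.initProg hm.2.1 (h.pow_le (by omega) le_rfl)).seq ?_
    rintro m₁ ⟨H₁, k₁, P₁⟩
    refine (H₁.selectProg k₁ P₁ (h.pow_le (by omega) le_rfl)).seq ?_
    rintro m₂ ⟨H₂, k₂, π, P₂, hπ⟩
    refine (H₂.improveProg k₂ P₂ (h.pow_le (by omega) le_rfl)).seq ?_
    rintro m₃ ⟨H₃, k₃, σ, P₃, hσ⟩
    have hle : (cycleWeight (pairWeight w) σ : ℚ) ≤ potential (pairWeight w) 0 1 := by
      rw [hσ.cycleWeight_eq h.four_le]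
      exact hπ
    refine H₃.branch (by decide) (H₃.tests_test P₃ k₃ (by omega)) (h.pow_le (by omega) le_rfl)
      (fun hlt m₄ h₄ => ?_) (fun hge m₄ h₄ => ?_)
    · have h0 := (h₄.holds H₃).assign (B := X ^ D) (x := 0) (e := .lit 0) (by decide) (val_lit 0)
        (h.pow_le (by simp [Ex.mag]) le_rfl)
      refine h0.mono ?_ fun m₅ h₅ => Or.inl ⟨?_, ?_⟩
      · have := const_le (c := 14) hn 7
        simp only [Ex.coef, Ex.deg, add_mul, pow_zero, mul_one] at *
        omega
      · rw [h₅.reg (by decide), Mem.setReg_reg_self]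
      · obtain ⟨v, c, hc, hget, hwt⟩ := exists_hamiltonianCycle (by omega) w σ
        refine ⟨v, c, hc, fun i hi => ?_, ?_⟩
        · rw [h₅.2, Mem.setReg_arr, h₄.2, hget ⟨i, hi⟩]
          exact P₃ ⟨i, hi⟩
        · rw [hwt]
          exact lt_density h.four_le hlt
    · refine ((h₄.holds H₃).shiftProg hMX (h.pow_le (by omega) le_rfl)).mono le_rfl ?_
      rintro m₅ ⟨h0, p, q, z, c, hc, hmin, hα, hcells⟩
      have hcomm := shifted_comm (pairWeight w) (pairWeight_comm w) p c
      refine Or.inr ⟨h0, ofPairs (shifted (pairWeight w) p c) hcomm, _, fun i j hij => hcells i j,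
        hα, fun v cyc hcyc => ?_, ?_⟩
      · refine weight_shift w _ _ c (fun a b hab => ?_) hcyc
        rw [pairWeight_ofPairs _ _ hab, shifted, if_neg hab]
        rfl
      · have hs := spread_le h.four_le (pairWeight w) (pairWeight_comm w) (pairWeight_self w) hle
          (not_lt.1 hge) (hmin)
        -- The spread counts ordered pairs, so the bound `8000 * k * n` on it becomes `4000 * k *
        -- n`.
        have h2 : 2 * absWeight (ofPairs (shifted (pairWeight w) p c) hcomm) ⊤ =
            spread (pairWeight w) p q z := by
          rw [absWeight, two_mul_weight_top, total, spread, ← hc]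
          refine Finset.sum_congr rfl fun a _ => Finset.sum_congr rfl fun b _ => ?_
          rw [pairWeight_abs]
          by_cases hab : a = b
          · rw [hab, pairWeight_self, shifted, if_pos rfl]
          · rw [pairWeight_ofPairs _ _ hab]
        linarith
  · have h1 := mul_pow_le (c := 21) hn (show 1 ≤ 7 by decide)
    have h2 := mul_pow_le (c := testE.coef) hn (show testE.deg ≤ 7 by decide)
    have h3 := const_le (c := 2) hn 7
    simp only [add_mul] at *
    omega
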